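/- **Theorem (Generalization error bounds for sketched multiple regression).** *Setting.* Let $m,d,p,n$ be integers with $1\le m\le d$ and $n\ge 2$. Let $G\in\mathbb R^{d\times d}$ be symmetric with eigenvalues $\lambda_1\ge\dots\ge\lambda_d$ such that $b\,i^{-a}\le\lambda_i\le B\,i^{-a}$ for all $i\in[d]$, where $a>1$ and $0<b\le B$. Let $W^*\in\mathbb R^{d\times p}$ be random with $\mathbb E[W^*W^{*\top}]=I_d$. For (almost) every value of $W^*$, let $P=P_{W^*}$ be a probability distribution of $(x,y)\in\mathbb R^d\times\mathbb R^p$, depending measurably on $W^*$, such that $x\sim\mathcal N(0,G)$, $\mathbb E\|y\|_2^2<\infty$, $\mathbb E[y\mid x]=W^{*\top}x$ and $\mathbb E\|y-W^{*\top}x\|_2^2=\sigma^2$, where $\sigma^2$ is the same for all $W^*$. Let $R\in\mathbb R^{m\times d}$ have i.i.d. $\mathcal N(0,1/m)$ entries, independent of everything else. Write $\mathcal L(W)=\mathbb E_{(x,y)\sim P}\|W^\top x-y\|_2^2$ for $W\in\mathbb R^{d\times p}$, $\mathcal L_R(V)=\mathcal L(R^\top V)$ for $V\in\mathbb R^{m\times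 p}$, and $N_{\rm eff}=n/\log_2 n$. Given i.i.d. samples $D=((x_1,y_1),\dots,(x_n,y_n))\sim P^n$, one-pass SGD with initial stepsize $\gamma>0$ is $$V_0=0,\qquad V_t=V_{t-1}-\gamma_t\,Rx_t\,(V_{t-1}^\top Rx_t-y_t)^\top,\qquad \gamma_t=\gamma\,2^{-\lfloor t/N_{\rm eff}\rfloor},\qquad t=1,\dots,n.$$ The risk decomposes as $\mathcal L_R(V_n)=\mathcal L_{\rm Irred}+\mathcal L_{\rm Approx}+\mathcal L_{\rm Excess}$ with $$\mathcal L_{\rm Irred}=\min_W\mathcal L(W),\quad \mathcal L_{\rm Approx}=\min_V\mathcal L_R(V)-\min_W\mathcal L(W),\quad \mathcal L_{\rm Excess}=\mathcal L_R(V_n)-\min_V\mathcal L_R(V).$$ Put $H=RGR^\top$ with eigenvalues $\tilde\lambda_1,\dots,\tilde\lambda_m$, $V^*=H^{-1}RGW^*$, $\|V\|_H^2=\operatorname{tr}(V^\top HV)$, $$\mathrm{Bias}=\mathbb E_{W^*}\Big\|\prod_{t=1}^n(I-\gamma_tH)\,V^*\Big\|_H^2,\qquad \mathrm{Var}=\frac{\#\{j:\tilde\lambda_j\ge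 \frac1{N_{\rm eff}\gamma}\}+(N_{\rm eff}\gamma)^2\sum_{\tilde\lambda_j<\frac1{N_{\rm eff}\gamma}}\tilde\lambda_j^2}{N_{\rm eff}}.$$ *Claim.* There is a constant $c>0$ depending only on $a,b,B$ such that for every $\kappa>1$ there are constants $c_1,c_2,C_2>0$ depending only on $a,b,B,\kappa$, and for all $s>0$, $\nu\ge1$ there are constants $c_3,C_3>0$ depending only on $a,b,B,\kappa,s,\nu$, such that in every setting as above with $0<\gamma\le c$, with probability at least $1-e^{-c_1m}$ over $R$ the following hold simultaneously. 1. $\mathcal L_{\rm Irred}=\sigma^2$ for almost every $W^*$. 2. If $d\ge\kappa m$, then $c_2\,m^{1-a}\le\mathbb E_{W^*}[\mathcal L_{\rm Approx}]\le C_2\,m^{1-a}$. 3. If $\sigma^2\ge s$ and, for almost every $W^*$, $\nu^{-1}\sigma^2G\preceq\mathbb E_{(x,y)\sim P}\big[\|y-W^{*\top}x\|_2^2\,xx^\top\big]\preceq\nu\sigma^2G$, then $$c_3\,(\mathrm{Bias}+\sigma^2\,\mathrm{Var})\le\mathbb E_{W^*}\mathbb E_{D\sim P^n}[\mathcal L_{\rm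 Excess}]\le C_3\,(\mathrm{Bias}+\sigma^2\,\mathrm{Var}).$$ All expectations in 2 and 3 are finite. -/

import Mathlib

open MeasureTheory ProbabilityTheory
open scoped Matrix

namespace SketchedRegression

noncomputable section

/-- Borel structure on matrices, that of the entrywise product. -/
instance instMeasurableSpaceMatrix {m n : ℕ} : MeasurableSpace (Matrix (Fin m) (Fin n) ℝ) :=
  inferInstanceAs (MeasurableSpace (Fin m → Fin n → ℝ))

/-- The space of examples `(x, y)`: a feature vector in `ℝ^d` and a label in `ℝ^p`, both with the
Euclidean norm. -/
abbrev Example (d p : ℕ) : Type := EuclideanSpace ℝ (Fin d) × EuclideanSpace ℝ (Fin p)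

/-- The prediction `Wᵀ x` of the multiple regression model with parameter `W`. -/
def predict {d p : ℕ} (W : Matrix (Fin d) (Fin p) ℝ) (x : EuclideanSpace ℝ (Fin d)) :
    EuclideanSpace ℝ (Fin p) :=
  WithLp.toLp 2 (Wᵀ *ᵥ x.ofLp)

/-- Population risk `L(W) = E ‖Wᵀ x - y‖²`. -/
def risk {d p : ℕ} (P : Measure (Example d p)) (W : Matrix (Fin d) (Fin p) ℝ) : ℝ :=
  ∫ z, ‖predict W z.1 - z.2‖ ^ 2 ∂P

/-- Risk of the sketched predictor `x ↦ Vᵀ (R x)`, that is `L_R(V) = L(Rᵀ V)`. -/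
def sketchedRisk {d p m : ℕ} (P : Measure (Example d p)) (R : Matrix (Fin m) (Fin d) ℝ)
    (V : Matrix (Fin m) (Fin p) ℝ) : ℝ :=
  risk P (Rᵀ * V)

/-- Irreducible error: the minimal risk over all linear predictors. -/
def irredError {d p : ℕ} (P : Measure (Example d p)) : ℝ :=
  ⨅ W : Matrix (Fin d) (Fin p) ℝ, risk P W

/-- Approximation error: minimal sketched risk minus minimal risk. -/
def approxError {d p m : ℕ} (P : Measure (Example d p)) (R : Matrix (Fin m) (Fin d) ℝ) : ℝ :=
  (⨅ V : Matrix (Fin m) (Fin p) ℝ, sketchedRisk P R V) - irredError P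

/-- Excess error of the sketched parameter `V`. -/
def excessError {d p m : ℕ} (P : Measure (Example d p)) (R : Matrix (Fin m) (Fin d) ℝ)
    (V : Matrix (Fin m) (Fin p) ℝ) : ℝ :=
  sketchedRisk P R V - ⨅ V' : Matrix (Fin m) (Fin p) ℝ, sketchedRisk P R V'

/-- Law of the Gaussian sketch: an `m × d` matrix with i.i.d. `N(0, 1/m)` entries. -/
def sketchLaw (m d : ℕ) : Measure (Matrix (Fin m) (Fin d) ℝ) :=
  Measure.pi (fun _ : Fin m => Measure.pi (fun _ : Fin d => gaussianReal 0 (1 / (m : NNReal))))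

/-- Effective sample size `n / log₂ n`. -/
def effSampleSize (n : ℕ) : ℝ := n / Real.logb 2 n

/-- Geometrically decaying stepsizes with initial stepsize `γ`: the stepsize is halved after every
`n / log₂ n` steps. -/
def stepSize (γ : ℝ) (n t : ℕ) : ℝ := γ / 2 ^ ⌊(t : ℝ) / effSampleSize n⌋₊

/-- The iterates `V_0 = 0`, `V_t = V_{t-1} - γ_t (R x_t) (V_{t-1}ᵀ R x_t - y_t)ᵀ` of one-pass SGD.
The index `t : Fin n` of the sample starts from `0`, so it is used in step `t + 1`. -/
def sgdIterate {d p m n : ℕ} (R : Matrix (Fin m) (Fin d) ℝ) (γ : ℝ)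
    (D : Fin n → Example d p) (t : Fin (n + 1)) : Matrix (Fin m) (Fin p) ℝ :=
  Fin.induction (motive := fun _ => Matrix (Fin m) (Fin p) ℝ) 0
    (fun (s : Fin n) V =>
      V - stepSize γ n ((s : ℕ) + 1) •
        Matrix.vecMulVec (R *ᵥ (D s).1.ofLp) (Vᵀ *ᵥ (R *ᵥ (D s).1.ofLp) - (D s).2.ofLp))
    t

/-- The output `V_n` of one-pass SGD on the sample set `D`. -/
def sgdOutput {d p m n : ℕ} (R : Matrix (Fin m) (Fin d) ℝ) (γ : ℝ) (D : Fin n → Example d p) :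
    Matrix (Fin m) (Fin p) ℝ :=
  sgdIterate R γ D (Fin.last n)

/-- Covariance `R G Rᵀ` of the sketched features. -/
def sketchedCov {d m : ℕ} (G : Matrix (Fin d) (Fin d) ℝ) (R : Matrix (Fin m) (Fin d) ℝ) :
    Matrix (Fin m) (Fin m) ℝ :=
  R * G * Rᵀ

theorem sketchedCov_isHermitian {d m : ℕ} {G : Matrix (Fin d) (Fin d) ℝ} (hG : G.IsHermitian)
    (R : Matrix (Fin m) (Fin d) ℝ) : (sketchedCov G R).IsHermitian := by
  have h := Matrix.isHermitian_mul_mul_conjTranspose R hG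
  rwa [Matrix.conjTranspose_eq_transpose_of_trivial] at h

/-- The optimal sketched parameter `V* = (R G Rᵀ)⁻¹ R G W`. -/
def optSketched {d p m : ℕ} (G : Matrix (Fin d) (Fin d) ℝ) (R : Matrix (Fin m) (Fin d) ℝ)
    (W : Matrix (Fin d) (Fin p) ℝ) : Matrix (Fin m) (Fin p) ℝ :=
  (sketchedCov G R)⁻¹ * R * G * W

/-- `‖V‖²_A = tr (Vᵀ A V)`. -/
def sqNorm {m p : ℕ} (A : Matrix (Fin m) (Fin m) ℝ) (V : Matrix (Fin m) (Fin p) ℝ) : ℝ :=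
  (Vᵀ * A * V).trace

/-- Bias error `‖∏_{t=1}^n (I - γ_t R G Rᵀ) V*‖²` in the norm of `R G Rᵀ`. -/
def biasError {d p m : ℕ} (G : Matrix (Fin d) (Fin d) ℝ) (R : Matrix (Fin m) (Fin d) ℝ)
    (γ : ℝ) (n : ℕ) (W : Matrix (Fin d) (Fin p) ℝ) : ℝ :=
  sqNorm (sketchedCov G R)
    (((List.range n).map (fun t => 1 - stepSize γ n (t + 1) • sketchedCov G R)).prod *
      optSketched G R W)

/-- Variance error of a symmetric matrix `H` (the sketched covariance) with eigenvalues `λ_j`: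
`(#{j : λ_j ≥ 1/(Nγ)} + (Nγ)² ∑_{j : λ_j < 1/(Nγ)} λ_j²) / N` with `N = n / log₂ n`. -/
def varError {m : ℕ} {H : Matrix (Fin m) (Fin m) ℝ} (hH : H.IsHermitian) (γ : ℝ) (n : ℕ) : ℝ :=
  (((Finset.univ.filter fun j => 1 / (effSampleSize n * γ) ≤ hH.eigenvalues j).card : ℝ) +
      (effSampleSize n * γ) ^ 2 *
        ∑ j ∈ Finset.univ.filter fun j => hH.eigenvalues j < 1 / (effSampleSize n * γ),
          hH.eigenvalues j ^ 2) /
    effSampleSize n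

/-- Power law spectrum: the eigenvalues `λ_1 ≥ λ_2 ≥ …` of `G` satisfy
`b i^{-a} ≤ λ_i ≤ B i^{-a}`. -/
def PowerLawSpectrum {d : ℕ} {G : Matrix (Fin d) (Fin d) ℝ} (hG : G.IsHermitian)
    (a b B : ℝ) : Prop :=
  ∀ i : Fin (Fintype.card (Fin d)),
    b * (((i : ℕ) : ℝ) + 1) ^ (-a) ≤ hG.eigenvalues₀ i ∧ hG.eigenvalues₀ i ≤ B * (((i : ℕ) : ℝ) + 1) ^ (-a)

/-- Gaussian features with a well-specified linear model: `x ∼ N(0, G)`, `E[y | x] = Wᵀ x` and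
`E ‖y - Wᵀ x‖² = σ²`, for labels with finite second moment. -/
structure GaussianWellSpecified {d p : ℕ} (P : Measure (Example d p))
    (G : Matrix (Fin d) (Fin d) ℝ) (W : Matrix (Fin d) (Fin p) ℝ) (σ : ℝ) : Prop where
  gaussian : P.map Prod.fst = multivariateGaussian 0 G
  memLp : MemLp (fun z : Example d p => z.2) 2 P
  condExp_eq : P[fun z : Example d p => z.2 | MeasurableSpace.comap Prod.fst inferInstance]
    =ᵐ[P] fun z => predict W z.1
  noise_eq : ∫ z, ‖z.2 - predict W z.1‖ ^ 2 ∂P = σ ^ 2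

/-- The noise level does not degenerate along any feature direction:
`ν⁻¹ σ² G ≼ E[‖y - Wᵀ x‖² x xᵀ] ≼ ν σ² G`, as quadratic forms. -/
def ComparableNoise {d p : ℕ} (P : Measure (Example d p))
    (G : Matrix (Fin d) (Fin d) ℝ) (W : Matrix (Fin d) (Fin p) ℝ) (σ ν : ℝ) : Prop :=
  ∀ u : Fin d → ℝ,
    ν⁻¹ * σ ^ 2 * (u ⬝ᵥ G *ᵥ u) ≤ ∫ z, ‖z.2 - predict W z.1‖ ^ 2 * (u ⬝ᵥ z.1.ofLp) ^ 2 ∂P ∧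
    ∫ z, ‖z.2 - predict W z.1‖ ^ 2 * (u ⬝ᵥ z.1.ofLp) ^ 2 ∂P ≤ ν * σ ^ 2 * (u ⬝ᵥ G *ᵥ u)

end

end SketchedRegression

/-! All randomness of the sketch is confined to one event (`sketch_good_event`) of probability at
least `1 - e^{-m/2}`: `H = R G Rᵀ` is positive definite, `tr H ≤ 10 tr G`, and a sum of leverage
residuals is at most a constant times the spectral tail beyond rank `m/4`. On it every claim is
deterministic in `R`.

Approximation. Averaged over the isotropic prior, the approximation error is `∑ Λ_j (1 - ℓ_j)`, with
`ℓ_j` the leverage scores of the columns `R u_j`, `u_j` the eigenvectors of `G`. Since `0 ≤ ℓ_j ≤ 1`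
and `∑ ℓ_j = m`, having more than `m` large eigenvalues forces a residual of order `m · m^{-a}`,
whatever the nondegenerate sketch. For the upper bound, `Λ_j (1 - ℓ_j)` is the minimum of a
quadratic function, so one test vector suffices. For each of the top `m/4` indices, the other
columns determine a subspace of dimension at least `m/2`, orthogonal to the other top columns, on
which the Gram form of the tail is `O(tail/m)`. The Gaussian column `R u_j` is independent of it and
has a projection bounded below except with probability `e^{-3m}` (`gaussian_small_ball`); the
rescaled projection is the test vector (`sketch_coordinate_failure`).

Excess. For Gaussian features Wick's formula yields an exact closed linear recursion for the
expected squared errors of SGD in the eigendirections of `H` (`integral_eigenError_sgdRun`). Its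
homogeneous part `(1 - η λ)²` produces the bias. The rest is a source comparable to `(η λ)²`, once
the risk is known to stay bounded, which uses `γ tr H ≤ 1/4`. `second_moment_recursion_bounds` thus
reduces to scalar recursions whose value after `n` steps is of order `min(1, (Nγλ)²)/N`, the summand
of Var. Averaging over `W` turns `‖W‖_G²` into `tr G`, which is absorbed into `σ²` because `σ² ≥ s`.
-/

namespace SketchedRegression

/-! ### Stepsize schedule and scalar recursions. -/

section Scalar

theorem one_le_effSampleSize {n : ℕ} (hn : 2 ≤ n) : 1 ≤ effSampleSize n := by
  have h2 : (2 : ℝ) ≤ n := by exact_mod_cast hn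
  have hlog : 0 < Real.logb 2 n := Real.logb_pos (by norm_num) (by linarith)
  rw [effSampleSize, le_div_iff₀ hlog, one_mul, Real.logb_le_iff_le_rpow (by norm_num) (by linarith),
    Real.rpow_natCast]
  exact_mod_cast (Nat.lt_two_pow_self).le

theorem effSampleSize_le {n : ℕ} (hn : 2 ≤ n) : effSampleSize n ≤ n := by
  have h2 : (2 : ℝ) ≤ n := by exact_mod_cast hn
  have hlog : 1 ≤ Real.logb 2 n := by
    rw [Real.le_logb_iff_rpow_le (by norm_num) (by linarith)]
    simpa using h2
  exact div_le_self (by linarith) hlog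

/-- The factor by which a smoothly decaying stepsize shrinks in every step. -/
noncomputable def decayRate (n : ℕ) : ℝ := 2 ^ (-(1 / effSampleSize n))

theorem decayRate_pow (n k : ℕ) : decayRate n ^ k = 2 ^ (-((k : ℝ) / effSampleSize n)) := by
  rw [decayRate, ← Real.rpow_natCast, ← Real.rpow_mul (by norm_num)]
  congr 1
  ring

theorem decayRate_pos (n : ℕ) : 0 < decayRate n := Real.rpow_pos_of_pos (by norm_num) _

theorem decayRate_eq (n : ℕ) : decayRate n = (1 / 2 : ℝ) ^ (1 / effSampleSize n) := by
  rw [decayRate, Real.rpow_neg (by norm_num), one_div (2 : ℝ), Real.inv_rpow (by norm_num)]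

/-- Bernoulli's inequality `(1 + s)^p ≤ 1 + p s` for `p ≤ 1`, at `s = -1/2`. With `le_decayRate`,
which uses `s = 1`, it puts `1 - decayRate n` exactly at order `1/N`. -/
theorem decayRate_le {n : ℕ} (hn : 2 ≤ n) : decayRate n ≤ 1 - 1 / (2 * effSampleSize n) := by
  have hN := one_le_effSampleSize hn
  have hN0 : 0 < effSampleSize n := by linarith
  have h := rpow_one_add_le_one_add_mul_self (s := -(1 / 2)) (by norm_num)
    (p := 1 / effSampleSize n) (by positivity) ((div_le_one hN0).2 hN)
  rw [decayRate_eq]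
  calc (1 / 2 : ℝ) ^ (1 / effSampleSize n) = (1 + -(1 / 2)) ^ (1 / effSampleSize n) := by norm_num
    _ ≤ _ := h
    _ = _ := by field_simp; ring

theorem le_decayRate {n : ℕ} (hn : 2 ≤ n) : 1 - 1 / effSampleSize n ≤ decayRate n := by
  have hN := one_le_effSampleSize hn
  have hN0 : 0 < effSampleSize n := by linarith
  have h := rpow_one_add_le_one_add_mul_self (s := 1) (by norm_num)
    (p := 1 / effSampleSize n) (by positivity) ((div_le_one hN0).2 hN)
  have h1 : decayRate n = ((1 + 1 : ℝ) ^ (1 / effSampleSize n))⁻¹ := by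
    rw [decayRate, Real.rpow_neg (by norm_num)]; norm_num
  have hp : 0 < (1 + 1 : ℝ) ^ (1 / effSampleSize n) := Real.rpow_pos_of_pos (by norm_num) _
  rw [h1]
  have h2 : (1 + 1 / effSampleSize n * 1)⁻¹ ≤ ((1 + 1 : ℝ) ^ (1 / effSampleSize n))⁻¹ :=
    inv_anti₀ hp h
  refine le_trans ?_ h2
  rw [mul_one, ← one_div, le_div_iff₀ (by positivity)]
  nlinarith [sq_nonneg (1 / effSampleSize n)]

theorem half_le_decayRate {n : ℕ} (hn : 2 ≤ n) : 1 / 2 ≤ decayRate n := by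
  have hN := one_le_effSampleSize hn
  have hN0 : 0 < effSampleSize n := by linarith
  rw [decayRate_eq]
  calc (1 / 2 : ℝ) = (1 / 2) ^ (1 : ℝ) := by simp
    _ ≤ _ := Real.rpow_le_rpow_of_exponent_ge (by norm_num) (by norm_num) ((div_le_one hN0).2 hN)

theorem decayRate_lt_one {n : ℕ} (hn : 2 ≤ n) : decayRate n < 1 := by
  have hN := one_le_effSampleSize hn
  have := decayRate_le hn
  have h : 0 < 1 / (2 * effSampleSize n) := by positivity
  linarith

/-- `N = n / log₂ n` is such that `n` steps amount to `log₂ n` halvings. -/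
theorem decayRate_pow_self {n : ℕ} (hn : 2 ≤ n) : decayRate n ^ n = 1 / n := by
  have h2 : (2 : ℝ) ≤ n := by exact_mod_cast hn
  have hlog : 0 < Real.logb 2 n := Real.logb_pos (by norm_num) (by linarith)
  rw [decayRate_pow, effSampleSize, div_div_cancel₀ (by positivity), Real.rpow_neg (by norm_num),
    Real.rpow_logb (by norm_num) (by norm_num) (by linarith), one_div]

/-- Rounding the number of halvings down costs at most a factor 2, so this bound and `stepSize_le`
replace the staircase schedule by a geometric sequence. -/
theorem le_stepSize {γ : ℝ} (hγ : 0 ≤ γ) {n : ℕ} (hn : 2 ≤ n) (t : ℕ) :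
    γ * decayRate n ^ t ≤ stepSize γ n t := by
  have hN := one_le_effSampleSize hn
  rw [stepSize, div_eq_mul_inv, decayRate_pow, Real.rpow_neg (by norm_num)]
  gcongr
  rw [← Real.rpow_natCast]
  exact Real.rpow_le_rpow_of_exponent_le (by norm_num) (Nat.floor_le (by positivity))

theorem stepSize_le {γ : ℝ} (hγ : 0 ≤ γ) {n : ℕ} (hn : 2 ≤ n) (t : ℕ) :
    stepSize γ n t ≤ 2 * (γ * decayRate n ^ t) := by
  have hN := one_le_effSampleSize hn
  have h : (2 : ℝ) ^ ((t : ℝ) / effSampleSize n) ≤ 2 * 2 ^ ⌊(t : ℝ) / effSampleSize n⌋₊ := by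
    rw [← pow_succ', ← Real.rpow_natCast]
    refine Real.rpow_le_rpow_of_exponent_le (by norm_num) ?_
    push_cast
    exact (Nat.lt_floor_add_one _).le
  rw [stepSize, decayRate_pow, Real.rpow_neg (by norm_num), div_le_iff₀ (by positivity)]
  have hp : 0 < (2 : ℝ) ^ ((t : ℝ) / effSampleSize n) := Real.rpow_pos_of_pos (by norm_num) _
  calc γ = γ * ((2 : ℝ) ^ ((t : ℝ) / effSampleSize n))⁻¹ * 2 ^ ((t : ℝ) / effSampleSize n) := by
        field_simp
    _ ≤ γ * ((2 : ℝ) ^ ((t : ℝ) / effSampleSize n))⁻¹ * (2 * 2 ^ ⌊(t : ℝ) / effSampleSize n⌋₊) := by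
        gcongr
    _ = _ := by ring

theorem stepSize_nonneg {γ : ℝ} (hγ : 0 ≤ γ) (n t : ℕ) : 0 ≤ stepSize γ n t := by
  unfold stepSize; positivity

theorem stepSize_le_init {γ : ℝ} (hγ : 0 ≤ γ) (n t : ℕ) : stepSize γ n t ≤ γ :=
  div_le_self hγ (one_le_pow₀ (by norm_num))

theorem sum_decayRate_pow_le {n : ℕ} (hn : 2 ≤ n) (k l : ℕ) :
    ∑ t ∈ Finset.Ico k l, decayRate n ^ t ≤ 2 * effSampleSize n * decayRate n ^ k := by
  have hN := one_le_effSampleSize hn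
  have h0 := decayRate_pos n
  have h1 := decayRate_lt_one hn
  have h2 := decayRate_le hn
  have h3 := geom_sum_Ico_le_of_lt_one (m := k) (n := l) h0.le h1
  refine h3.trans ?_
  rw [div_le_iff₀ (by linarith)]
  have h4 : 1 ≤ 2 * effSampleSize n * (1 - decayRate n) := by
    have : 2 * effSampleSize n * (1 / (2 * effSampleSize n)) = 1 := by field_simp
    nlinarith
  have := pow_pos h0 k
  nlinarith

/-- The variance recursion settles at the inverse effective sample size. -/
theorem variance_recursion_le_inv {n : ℕ} (hn : 2 ≤ n) {γ lam : ℝ} (hγ : 0 ≤ γ) (hl : 0 ≤ lam)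
    (hx : γ * lam ≤ 1) {u : ℕ → ℝ} (h0 : u 0 = 0)
    (hu : ∀ t, u (t + 1) ≤ (1 - stepSize γ n (t + 1) * lam) * u t +
      (stepSize γ n (t + 1) * lam) ^ 2) :
    u n ≤ 4 / effSampleSize n := by
  have hN := one_le_effSampleSize hn
  have hq := decayRate_pos n
  -- The recursion follows an equilibrium proportional to the current step `y`. The equilibrium
  -- drifts by at most `2 y / N` per step, and the additive `2 / N` absorbs this drift.
  have key : ∀ t, u t ≤ 2 * (γ * lam * decayRate n ^ (t + 1)) + 2 / effSampleSize n := by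
    intro t
    induction t with
    | zero => rw [h0]; positivity
    | succ t ih =>
      set x := stepSize γ n (t + 1) * lam with hxdef
      set y := γ * lam * decayRate n ^ (t + 1) with hy
      have hyx : y ≤ x := by
        have := mul_le_mul_of_nonneg_right (le_stepSize hγ hn (t + 1)) hl
        rw [hy, hxdef]; linarith
      have hxy : x ≤ 2 * y := by
        have := mul_le_mul_of_nonneg_right (stepSize_le hγ hn (t + 1)) hl
        rw [hy, hxdef]; linarith
      have hx1 : x ≤ 1 := by
        have := mul_le_mul_of_nonneg_right (stepSize_le_init hγ n (t + 1)) hl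
        linarith
      have hy0 : 0 ≤ y := by positivity
      have hy' : y - y * (1 / effSampleSize n) ≤ γ * lam * decayRate n ^ (t + 1 + 1) := by
        rw [pow_succ, ← mul_assoc, ← hy]
        have := mul_le_mul_of_nonneg_left (le_decayRate hn) hy0
        linarith
      have h1 := mul_le_mul_of_nonneg_left ih (sub_nonneg.2 hx1)
      have h2 := hu t
      have h3 : x * (2 * y - x) ≥ 0 := mul_nonneg (by linarith) (by linarith)
      have h4 : (x - y) * (2 / effSampleSize n) ≥ 0 := mul_nonneg (by linarith) (by positivity)
      have h5 : y * (2 / effSampleSize n) = 2 * (y * (1 / effSampleSize n)) := by ring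
      nlinarith
  refine (key n).trans ?_
  have h1 : γ * lam * decayRate n ^ (n + 1) ≤ 1 / effSampleSize n := by
    have h2 : decayRate n ^ (n + 1) ≤ 1 / effSampleSize n := by
      refine (pow_le_pow_of_le_one hq.le (decayRate_lt_one hn).le (Nat.le_succ n)).trans ?_
      rw [decayRate_pow_self hn]
      exact one_div_le_one_div_of_le (by linarith) (effSampleSize_le hn)
    calc _ ≤ 1 * (1 / effSampleSize n) := by gcongr
      _ = _ := one_mul _
  have : 4 / effSampleSize n = 2 * (1 / effSampleSize n) + 2 / effSampleSize n := by ring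
  linarith

/-- Useful when `Nγλ` is small and contraction is negligible: it is dropped, and the sources sum to
at most `4 (γλ)² · 2N`. -/
theorem variance_recursion_le_sq {n : ℕ} (hn : 2 ≤ n) {γ lam : ℝ} (hγ : 0 ≤ γ) (hl : 0 ≤ lam)
    {u : ℕ → ℝ} (h0 : u 0 = 0) (hpos : ∀ t, 0 ≤ u t)
    (hu : ∀ t, u (t + 1) ≤ (1 - stepSize γ n (t + 1) * lam) * u t +
      (stepSize γ n (t + 1) * lam) ^ 2) :
    u n ≤ 8 * ((effSampleSize n * γ * lam) ^ 2 / effSampleSize n) := by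
  have hN := one_le_effSampleSize hn
  have hq := decayRate_pos n
  have hq1 := decayRate_lt_one hn
  have key : ∀ t, u t ≤ ∑ s ∈ Finset.range t, (stepSize γ n (s + 1) * lam) ^ 2 := by
    intro t
    induction t with
    | zero => simp [h0]
    | succ t ih =>
      rw [Finset.sum_range_succ]
      have := hu t
      have := mul_nonneg (mul_nonneg (stepSize_nonneg hγ n (t + 1)) hl) (hpos t)
      linarith
  refine (key n).trans ?_
  calc ∑ s ∈ Finset.range n, (stepSize γ n (s + 1) * lam) ^ 2
      ≤ ∑ s ∈ Finset.range n, 4 * (γ * lam) ^ 2 * decayRate n ^ s := by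
        refine Finset.sum_le_sum fun s _ => ?_
        have h1 : stepSize γ n (s + 1) * lam ≤ 2 * (γ * decayRate n ^ (s + 1)) * lam :=
          mul_le_mul_of_nonneg_right (stepSize_le hγ hn (s + 1)) hl
        have h2 : (stepSize γ n (s + 1) * lam) ^ 2 ≤ (2 * (γ * decayRate n ^ (s + 1)) * lam) ^ 2 :=
          pow_le_pow_left₀ (mul_nonneg (stepSize_nonneg hγ n (s + 1)) hl) h1 2
        have h3 : (decayRate n ^ (s + 1)) ^ 2 ≤ decayRate n ^ s := by
          rw [← pow_mul]
          exact pow_le_pow_of_le_one hq.le hq1.le (by omega)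
        calc _ ≤ _ := h2
          _ = 4 * (γ * lam) ^ 2 * (decayRate n ^ (s + 1)) ^ 2 := by ring
          _ ≤ _ := by gcongr
    _ = 4 * (γ * lam) ^ 2 * ∑ s ∈ Finset.Ico 0 n, decayRate n ^ s := by
        rw [← Finset.mul_sum, Finset.range_eq_Ico]
    _ ≤ 4 * (γ * lam) ^ 2 * (2 * effSampleSize n * decayRate n ^ 0) := by
        gcongr; exact sum_decayRate_pow_le hn 0 n
    _ = _ := by field_simp; ring

/-- Only the steps after a suitable time `k` are counted. Their `x` sum to at most 4, so contraction
leaves a factor `e^{-16}`, yet at least `N` of them have size comparable to the step at time `k`. -/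
theorem le_variance_recursion {n : ℕ} (hn : 2 ≤ n) {γ lam : ℝ} (hγ : 0 < γ) (hl : 0 < lam)
    (hx : γ * lam ≤ 1 / 4) {u : ℕ → ℝ} (hpos : ∀ t, 0 ≤ u t)
    (hu : ∀ t, (1 - stepSize γ n (t + 1) * lam) ^ 2 * u t +
      (stepSize γ n (t + 1) * lam) ^ 2 ≤ u (t + 1)) :
    Real.exp (-16) / 16 * (min 1 ((effSampleSize n * γ * lam) ^ 2) / effSampleSize n) ≤ u n := by
  have hN := one_le_effSampleSize hn
  have hNn := effSampleSize_le hn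
  have hq := decayRate_pos n
  have hq1 := decayRate_lt_one hn
  have hqh := half_le_decayRate hn
  set N := effSampleSize n with hNdef
  set q := decayRate n with hqdef
  have hgl : 0 < γ * lam := mul_pos hγ hl
  set x : ℕ → ℝ := fun t => stepSize γ n (t + 1) * lam with hxdef
  have hyx : ∀ t, γ * lam * q ^ (t + 1) ≤ x t := fun t => by
    have := mul_le_mul_of_nonneg_right (le_stepSize hγ.le hn (t + 1)) hl.le
    simp only [hxdef]; linarith
  have hxy : ∀ t, x t ≤ 2 * (γ * lam * q ^ (t + 1)) := fun t => by
    have := mul_le_mul_of_nonneg_right (stepSize_le hγ.le hn (t + 1)) hl.le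
    simp only [hxdef]; linarith
  have hx0 : ∀ t, 0 ≤ x t := fun t => mul_nonneg (stepSize_nonneg hγ.le n (t + 1)) hl.le
  have hx1 : ∀ t, x t ≤ 1 / 2 := fun t => by
    have := mul_le_mul_of_nonneg_right (stepSize_le_init hγ.le n (t + 1)) hl.le
    simp only [hxdef]; linarith
  -- the time after which the stepsizes sum to a constant
  obtain ⟨k, hk1, hk2, hk3⟩ : ∃ k : ℕ, N * (γ * lam * q ^ (k + 1)) ≤ 1 ∧
      (1 / 2) * min 1 (N * γ * lam) ≤ N * (γ * lam * q ^ (k + 1)) ∧ (k : ℝ) + N ≤ n := by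
    have hex : ∃ k : ℕ, N * (γ * lam * q ^ (k + 1)) ≤ 1 := by
      refine ⟨n - 1, ?_⟩
      rw [Nat.sub_add_cancel (by omega), hqdef, decayRate_pow_self hn]
      have h2 : (2 : ℝ) ≤ n := by exact_mod_cast hn
      calc N * (γ * lam * (1 / n)) ≤ n * (1 * (1 / n)) := by gcongr; linarith
        _ = 1 := by field_simp
    obtain ⟨k, hk, hkmin⟩ : ∃ k : ℕ, N * (γ * lam * q ^ (k + 1)) ≤ 1 ∧
        ∀ j < k, ¬ N * (γ * lam * q ^ (j + 1)) ≤ 1 := by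
      classical
      exact ⟨Nat.find hex, Nat.find_spec hex, fun j hj => Nat.find_min hex hj⟩
    refine ⟨k, hk, ?_⟩
    rcases Nat.eq_zero_or_pos k with h | h
    · rw [h]
      refine ⟨?_, by simpa using hNn⟩
      have h1 : min 1 (N * γ * lam) ≤ N * γ * lam := min_le_right _ _
      have h2 : N * (γ * lam) * (1 / 2) ≤ N * (γ * lam) * q := by gcongr
      simp only [zero_add, pow_one]
      linarith
    · have h1 := hkmin (k - 1) (by omega)
      rw [show k - 1 + 1 = k by omega, not_le] at h1
      have h2 : 1 / 2 ≤ N * (γ * lam * q ^ (k + 1)) := by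
        rw [pow_succ]
        have : 1 * (1 / 2) ≤ N * (γ * lam * q ^ k) * q := by gcongr
        linarith
      refine ⟨?_, ?_⟩
      · have h1 : min 1 (N * γ * lam) ≤ 1 := min_le_left _ _
        linarith
      -- With fewer than `N` steps left, `q^N = 1/2` gives `q^k ≤ 2 q^n = 2/n`, hence `N γ λ q^k ≤
      -- 1/2`, against the minimality of `k`.
      · by_contra hcon
        push Not at hcon
        have hn0 : (0 : ℝ) < n := by exact_mod_cast (by omega : 0 < n)
        have h3 : q ^ k * (1 / 2) ≤ q ^ n := by
          have h4 : (1 / 2 : ℝ) = 2 ^ (-(N / N)) := by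
            rw [div_self (by linarith), Real.rpow_neg_one]; norm_num
          rw [h4, hqdef, decayRate_pow, decayRate_pow, ← Real.rpow_add (by norm_num)]
          refine Real.rpow_le_rpow_of_exponent_le (by norm_num) ?_
          rw [← hNdef, ← neg_add, neg_le_neg_iff, ← add_div]
          gcongr
        rw [hqdef, decayRate_pow_self hn, ← hqdef] at h3
        have h5 : N * (γ * lam * (q ^ k * (1 / 2))) ≤ n * ((1 / 4) * (1 / n)) := by
          gcongr
        have h6 : (n : ℝ) * ((1 / 4) * (1 / n)) = 1 / 4 := by field_simp
        rw [h6] at h5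
        linarith
  have key : ∀ t, k ≤ t → Real.exp (-4 * ∑ s ∈ Finset.Ico k t, x s) *
      ∑ s ∈ Finset.Ico k t, x s ^ 2 ≤ u t := by
    intro t ht
    induction t, ht using Nat.le_induction with
    | base => simpa using hpos k
    | succ t ht ih =>
      rw [Finset.sum_Ico_succ_top ht, Finset.sum_Ico_succ_top ht, mul_add, mul_add, Real.exp_add]
      refine le_trans ?_ (hu t)
      change _ ≤ (1 - x t) ^ 2 * u t + x t ^ 2
      have hS : 0 ≤ ∑ s ∈ Finset.Ico k t, x s := Finset.sum_nonneg fun s _ => hx0 s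
      have hQ : 0 ≤ ∑ s ∈ Finset.Ico k t, x s ^ 2 := Finset.sum_nonneg fun s _ => sq_nonneg _
      have hE : Real.exp (-4 * ∑ s ∈ Finset.Ico k t, x s) ≤ 1 := Real.exp_le_one_iff.2 (by linarith)
      have hF : Real.exp (-4 * x t) ≤ 1 := Real.exp_le_one_iff.2 (by linarith [hx0 t])
      -- `e^{-2x} ≤ 1 - x` on `[0, 1/2]`, because `(1 - x)(1 + 2x) ≥ 1` there.
      have hG : Real.exp (-4 * x t) ≤ (1 - x t) ^ 2 := by
        have h1 : Real.exp (-2 * x t) ≤ 1 - x t := by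
          have h2 : 1 + 2 * x t ≤ Real.exp (2 * x t) := by
            linarith [Real.add_one_le_exp (2 * x t)]
          have h3 : Real.exp (-2 * x t) = (Real.exp (2 * x t))⁻¹ := by
            rw [← Real.exp_neg]; ring_nf
          rw [h3, inv_le_iff_one_le_mul₀ (Real.exp_pos _)]
          have h4 : (1 - x t) * (1 + 2 * x t) ≤ (1 - x t) * Real.exp (2 * x t) :=
            mul_le_mul_of_nonneg_left h2 (by linarith [hx1 t])
          nlinarith [hx0 t, hx1 t]
        calc Real.exp (-4 * x t) = Real.exp (-2 * x t) ^ 2 := by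
              rw [← Real.exp_nat_mul]; ring_nf
          _ ≤ _ := pow_le_pow_left₀ (Real.exp_pos _).le h1 2
      have h5 : Real.exp (-4 * ∑ s ∈ Finset.Ico k t, x s) * Real.exp (-4 * x t) *
          ∑ s ∈ Finset.Ico k t, x s ^ 2 ≤ (1 - x t) ^ 2 * u t := by
        calc _ = Real.exp (-4 * x t) * (Real.exp (-4 * ∑ s ∈ Finset.Ico k t, x s) *
              ∑ s ∈ Finset.Ico k t, x s ^ 2) := by ring
          _ ≤ _ := by gcongr
      have h6 : Real.exp (-4 * ∑ s ∈ Finset.Ico k t, x s) * Real.exp (-4 * x t) * x t ^ 2 ≤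
          1 * 1 * x t ^ 2 := by gcongr
      linarith
  have hkn : k ≤ n := by
    have : (k : ℝ) ≤ n := by linarith
    exact_mod_cast this
  refine le_trans ?_ (key n hkn)
  have hsum : ∑ s ∈ Finset.Ico k n, x s ≤ 4 := by
    calc ∑ s ∈ Finset.Ico k n, x s ≤ ∑ s ∈ Finset.Ico k n, 2 * (γ * lam) * q * q ^ s :=
          Finset.sum_le_sum fun s _ => (hxy s).trans (le_of_eq (by ring))
      _ = 2 * (γ * lam) * q * ∑ s ∈ Finset.Ico k n, q ^ s := by rw [Finset.mul_sum]
      _ ≤ 2 * (γ * lam) * q * (2 * N * q ^ k) := by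
          gcongr; exact sum_decayRate_pow_le hn k n
      _ = 4 * (N * (γ * lam * q ^ (k + 1))) := by ring
      _ ≤ 4 := by linarith
  -- During the `⌈N⌉` steps from `k` on, the geometric sequence loses at most a factor 2.
  have hsq : N / 4 * (γ * lam * q ^ (k + 1)) ^ 2 ≤ ∑ s ∈ Finset.Ico k n, x s ^ 2 := by
    have hc : k + ⌈N⌉₊ ≤ n := by
      have : ⌈N⌉₊ ≤ n - k := by
        rw [Nat.ceil_le, Nat.cast_sub hkn]; linarith
      omega
    calc N / 4 * (γ * lam * q ^ (k + 1)) ^ 2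
        ≤ ⌈N⌉₊ / 4 * (γ * lam * q ^ (k + 1)) ^ 2 := by gcongr; exact Nat.le_ceil N
      _ = ∑ s ∈ Finset.Ico k (k + ⌈N⌉₊), (γ * lam * q ^ (k + 1) * (1 / 2)) ^ 2 := by
          rw [Finset.sum_const, Nat.card_Ico, nsmul_eq_mul, Nat.add_sub_cancel_left]; ring
      _ ≤ ∑ s ∈ Finset.Ico k (k + ⌈N⌉₊), x s ^ 2 := by
          refine Finset.sum_le_sum fun s hs => ?_
          rw [Finset.mem_Ico] at hs
          refine pow_le_pow_left₀ (by positivity) (le_trans ?_ (hyx s)) 2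
          have h1 : q ^ (s + 1) = q ^ (k + 1) * q ^ (s - k) := by
            rw [← pow_add]; congr 1; omega
          rw [h1, ← mul_assoc]
          gcongr
          have h2 : (1 / 2 : ℝ) = 2 ^ (-(1 : ℝ)) := by rw [Real.rpow_neg_one]; norm_num
          rw [h2, hqdef, decayRate_pow]
          refine Real.rpow_le_rpow_of_exponent_le (by norm_num) ?_
          rw [neg_le_neg_iff, div_le_one (by linarith)]
          have h3 : s - k < ⌈N⌉₊ := by omega
          exact (Nat.lt_ceil.1 h3).le
      _ ≤ _ := Finset.sum_le_sum_of_subset_of_nonneg (Finset.Ico_subset_Ico_right hc)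
          fun _ _ _ => sq_nonneg _
  have hmin : min 1 ((N * γ * lam) ^ 2) / N ≤ 4 * (N * (γ * lam * q ^ (k + 1)) ^ 2) := by
    have h1 : min 1 ((N * γ * lam) ^ 2) = (min 1 (N * γ * lam)) ^ 2 := by
      rcases le_total 1 (N * γ * lam) with h | h
      · rw [min_eq_left h, min_eq_left (one_le_pow₀ h), one_pow]
      · rw [min_eq_right h, min_eq_right (pow_le_one₀ (by positivity) h)]
    have h2 : 0 ≤ min 1 (N * γ * lam) := le_min zero_le_one (by positivity)
    have h3 : ((1 / 2) * min 1 (N * γ * lam)) ^ 2 ≤ (N * (γ * lam * q ^ (k + 1))) ^ 2 :=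
      pow_le_pow_left₀ (by positivity) hk2 2
    rw [h1, div_le_iff₀ (by linarith)]
    nlinarith
  have hexp : Real.exp (-16) ≤ Real.exp (-4 * ∑ s ∈ Finset.Ico k n, x s) :=
    Real.exp_le_exp.2 (by linarith)
  calc Real.exp (-16) / 16 * (min 1 ((N * γ * lam) ^ 2) / N)
      ≤ Real.exp (-16) / 16 * (4 * (N * (γ * lam * q ^ (k + 1)) ^ 2)) := by gcongr
    _ = Real.exp (-16) * (N / 4 * (γ * lam * q ^ (k + 1)) ^ 2) := by ring
    _ ≤ _ := by gcongr

/-- Two-sided bound for the exact second moment recursion of one-pass SGD in the eigenbasis. -/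
theorem second_moment_recursion_bounds {ι : Type*} [Fintype ι] {n : ℕ} (hn : 2 ≤ n) {γ : ℝ}
    (hγ : 0 < γ) {lam : ι → ℝ} (hl : ∀ i, 0 < lam i) (htr : γ * ∑ i, lam i ≤ 1 / 4)
    {A lo hi : ℝ} (hA : 0 ≤ A) (hlo : 0 ≤ lo) (hhi : 0 ≤ hi) {Z : ι → ℝ}
    (hZlo : ∀ i, lo * lam i ≤ Z i) (hZhi : ∀ i, Z i ≤ hi * lam i) {α : ℕ → ι → ℝ}
    (hα0 : ∀ i, 0 ≤ α 0 i)
    (hα : ∀ t i, α (t + 1) i =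
      (1 - 2 * (stepSize γ n (t + 1) * lam i) + 2 * (stepSize γ n (t + 1) * lam i) ^ 2) * α t i +
      stepSize γ n (t + 1) ^ 2 * lam i * (A + ∑ j, lam j * α t j) +
      stepSize γ n (t + 1) ^ 2 * Z i) :
    (∑ i, lam i * ((∏ t ∈ Finset.range n, (1 - stepSize γ n (t + 1) * lam i)) ^ 2 * α 0 i)) +
        lo * (Real.exp (-16) / 16 *
          ∑ i, min 1 ((effSampleSize n * γ * lam i) ^ 2) / effSampleSize n) ≤
      ∑ i, lam i * α n i ∧
    ∑ i, lam i * α n i ≤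
      (∑ i, lam i * ((∏ t ∈ Finset.range n, (1 - stepSize γ n (t + 1) * lam i)) ^ 2 * α 0 i)) +
        5 * ((∑ i, lam i * α 0 i) + A + hi) * (8 *
          ∑ i, min 1 ((effSampleSize n * γ * lam i) ^ 2) / effSampleSize n) := by
  have hN := one_le_effSampleSize hn
  have hη0 : ∀ t, 0 ≤ stepSize γ n (t + 1) := fun t => stepSize_nonneg hγ.le n _
  have hηγ : ∀ t, stepSize γ n (t + 1) ≤ γ := fun t => stepSize_le_init hγ.le n _
  have hγl : ∀ i, γ * lam i ≤ 1 / 4 := fun i => by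
    have h := Finset.single_le_sum (f := lam) (fun j _ => (hl j).le) (Finset.mem_univ i)
    exact (mul_le_mul_of_nonneg_left h hγ.le).trans htr
  have hx0 : ∀ t i, 0 ≤ stepSize γ n (t + 1) * lam i := fun t i => mul_nonneg (hη0 t) (hl i).le
  have hx1 : ∀ t i, stepSize γ n (t + 1) * lam i ≤ 1 / 4 := fun t i =>
    (mul_le_mul_of_nonneg_right (hηγ t) (hl i).le).trans (hγl i)
  have hZ0 : ∀ i, 0 ≤ Z i := fun i => (mul_nonneg hlo (hl i).le).trans (hZlo i)
  have hpos : ∀ t i, 0 ≤ α t i := by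
    intro t
    induction t with
    | zero => exact hα0
    | succ t ih =>
      intro i
      rw [hα]
      have h1 : 0 ≤ ∑ j, lam j * α t j := Finset.sum_nonneg fun j _ => mul_nonneg (hl j).le (ih j)
      have h2 : 0 ≤ 1 - 2 * (stepSize γ n (t + 1) * lam i) +
          2 * (stepSize γ n (t + 1) * lam i) ^ 2 := by nlinarith [hx1 t i]
      have := ih i
      have := hl i
      have := hZ0 i
      positivity
  have hS0 : ∀ t, 0 ≤ ∑ j, lam j * α t j := fun t =>
    Finset.sum_nonneg fun j _ => mul_nonneg (hl j).le (hpos t j)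
  set M := (∑ i, lam i * α 0 i) + A + hi with hM
  have hM0 : 0 ≤ M := by have := hS0 0; positivity
  -- the excess risk stays bounded along the trajectory
  have hbdd : ∀ t, (∀ i, α t i ≤ α 0 i + 3 * γ * M) ∧ ∑ j, lam j * α t j ≤ 2 * M := by
    -- The trace condition closes the bootstrap: `M + 3M · γ ∑ λ ≤ M + 3M/4 ≤ 2M`.
    have hsum : ∀ t, (∀ i, α t i ≤ α 0 i + 3 * γ * M) → ∑ j, lam j * α t j ≤ 2 * M := by
      intro t ht
      calc ∑ j, lam j * α t j ≤ ∑ j, lam j * (α 0 j + 3 * γ * M) :=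
            Finset.sum_le_sum fun j _ => mul_le_mul_of_nonneg_left (ht j) (hl j).le
        _ = (∑ j, lam j * α 0 j) + 3 * M * (γ * ∑ j, lam j) := by
            simp only [mul_add, Finset.sum_add_distrib, ← Finset.sum_mul]; ring
        _ ≤ M + 3 * M * (1 / 4) := by
            gcongr
            rw [hM]; linarith
        _ ≤ 2 * M := by linarith
    intro t
    induction t with
    | zero =>
      have h : ∀ i, α 0 i ≤ α 0 i + 3 * γ * M := fun i => by
        have : 0 ≤ 3 * γ * M := by positivity
        linarith
      exact ⟨h, hsum 0 h⟩
    | succ t ih =>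
      suffices h : ∀ i, α (t + 1) i ≤ α 0 i + 3 * γ * M from ⟨h, hsum _ h⟩
      intro i
      rw [hα]
      set η := stepSize γ n (t + 1)
      have hx := hx0 t i
      have hx' := hx1 t i
      have h1 : (1 - 2 * (η * lam i) + 2 * (η * lam i) ^ 2) * α t i ≤ (1 - η * lam i) * α t i := by
        refine mul_le_mul_of_nonneg_right ?_ (hpos t i)
        nlinarith
      have h2 : (1 - η * lam i) * α t i ≤ (1 - η * lam i) * (α 0 i + 3 * γ * M) :=
        mul_le_mul_of_nonneg_left (ih.1 i) (by linarith)
      -- With `x = η λ_i` the sources are at most `x · 3γM`, so the new value is below `(1 - x)(α₀ +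
      -- 3γM) + x · 3γM`, which stays within the claimed bound.
      have h3 : η ^ 2 * lam i * (A + ∑ j, lam j * α t j) + η ^ 2 * Z i ≤
          η * lam i * (γ * (3 * M)) := by
        calc η ^ 2 * lam i * (A + ∑ j, lam j * α t j) + η ^ 2 * Z i
            ≤ η ^ 2 * lam i * (A + 2 * M) + η ^ 2 * (hi * lam i) := by
              have := ih.2
              have := hZhi i
              have := (hl i).le
              gcongr
          _ = η * lam i * (η * (A + hi + 2 * M)) := by ring
          _ ≤ η * lam i * (γ * (3 * M)) := by
              have h4 : A + hi + 2 * M ≤ 3 * M := by have := hS0 0; rw [hM]; linarith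
              have h5 : η ≤ γ := hηγ t
              gcongr
      have h4 : 0 ≤ η * lam i * α 0 i := mul_nonneg hx (hα0 i)
      nlinarith
  -- Removing the noise-free solution leaves zero initial data. As `1 - 2x + 2x² = (1 - x)² + x²`,
  -- the extra `x²` part of the diagonal coefficient is counted as a source.
  set δ : ℕ → ι → ℝ := fun t i => lam i * α t i -
    lam i * ((∏ s ∈ Finset.range t, (1 - stepSize γ n (s + 1) * lam i)) ^ 2 * α 0 i) with hδ
  have hδ0 : ∀ i, δ 0 i = 0 := fun i => by simp [hδ]
  have hδs : ∀ t i, δ (t + 1) i = (1 - stepSize γ n (t + 1) * lam i) ^ 2 * δ t i +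
      (stepSize γ n (t + 1) * lam i) ^ 2 * (lam i * α t i + A + ∑ j, lam j * α t j) +
      stepSize γ n (t + 1) ^ 2 * lam i * Z i := by
    intro t i
    simp only [hδ, Finset.prod_range_succ]
    rw [hα]
    ring
  have hδlo : ∀ t i, (1 - stepSize γ n (t + 1) * lam i) ^ 2 * δ t i +
      lo * (stepSize γ n (t + 1) * lam i) ^ 2 ≤ δ (t + 1) i := by
    intro t i
    rw [hδs]
    have h1 : 0 ≤ (stepSize γ n (t + 1) * lam i) ^ 2 *
        (lam i * α t i + A + ∑ j, lam j * α t j) :=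
      mul_nonneg (sq_nonneg _) (by have := hS0 t; have := mul_nonneg (hl i).le (hpos t i); linarith)
    have h2 : stepSize γ n (t + 1) ^ 2 * lam i * (lo * lam i) ≤
        stepSize γ n (t + 1) ^ 2 * lam i * Z i :=
      mul_le_mul_of_nonneg_left (hZlo i) (mul_nonneg (sq_nonneg _) (hl i).le)
    linarith
  -- `λ_i α_i` and the full sum are each at most `2M`, and `A + hi ≤ M`; together `5M`.
  have hδhi : ∀ t i, δ (t + 1) i ≤ (1 - stepSize γ n (t + 1) * lam i) ^ 2 * δ t i +
      5 * M * (stepSize γ n (t + 1) * lam i) ^ 2 := by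
    intro t i
    rw [hδs]
    have h0 : lam i * α t i ≤ ∑ j, lam j * α t j :=
      Finset.single_le_sum (f := fun j => lam j * α t j)
        (fun j _ => mul_nonneg (hl j).le (hpos t j)) (Finset.mem_univ i)
    have h1 : (stepSize γ n (t + 1) * lam i) ^ 2 * (lam i * α t i + A + ∑ j, lam j * α t j) ≤
        (stepSize γ n (t + 1) * lam i) ^ 2 * (4 * M + A) :=
      mul_le_mul_of_nonneg_left (by have := (hbdd t).2; linarith) (sq_nonneg _)
    have h2 : stepSize γ n (t + 1) ^ 2 * lam i * Z i ≤
        stepSize γ n (t + 1) ^ 2 * lam i * (hi * lam i) :=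
      mul_le_mul_of_nonneg_left (hZhi i) (mul_nonneg (sq_nonneg _) (hl i).le)
    have h3 : (stepSize γ n (t + 1) * lam i) ^ 2 * (4 * M + A + hi) ≤
        (stepSize γ n (t + 1) * lam i) ^ 2 * (5 * M) :=
      mul_le_mul_of_nonneg_left (by have := hS0 0; rw [hM]; linarith) (sq_nonneg _)
    linarith
  have lower : ∀ i, lo * (Real.exp (-16) / 16 *
      (min 1 ((effSampleSize n * γ * lam i) ^ 2) / effSampleSize n)) ≤ δ n i := by
    intro i
    let w : ℕ → ℝ := fun t => Nat.rec 0 (fun t w => (1 - stepSize γ n (t + 1) * lam i) ^ 2 * w +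
      (stepSize γ n (t + 1) * lam i) ^ 2) t
    have hw0 : ∀ t, 0 ≤ w t := by
      intro t
      induction t with
      | zero => exact le_rfl
      | succ t ih => exact add_nonneg (mul_nonneg (sq_nonneg _) ih) (sq_nonneg _)
    have hcmp : ∀ t, lo * w t ≤ δ t i := by
      intro t
      induction t with
      | zero => simp [w, hδ0]
      | succ t ih =>
        refine le_trans ?_ (hδlo t i)
        have := mul_le_mul_of_nonneg_left ih (sq_nonneg (1 - stepSize γ n (t + 1) * lam i))
        change lo * ((1 - stepSize γ n (t + 1) * lam i) ^ 2 * w t + _) ≤ _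
        linarith
    exact (mul_le_mul_of_nonneg_left
      (le_variance_recursion hn hγ (hl i) (hγl i) hw0 fun t => le_rfl) hlo).trans (hcmp n)
  have upper : ∀ i, δ n i ≤ 5 * M * (8 *
      (min 1 ((effSampleSize n * γ * lam i) ^ 2) / effSampleSize n)) := by
    intro i
    let w : ℕ → ℝ := fun t => Nat.rec 0 (fun t w => (1 - stepSize γ n (t + 1) * lam i) * w +
      (stepSize γ n (t + 1) * lam i) ^ 2) t
    have hw0 : ∀ t, 0 ≤ w t := by
      intro t
      induction t with
      | zero => exact le_rfl
      | succ t ih =>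
        exact add_nonneg (mul_nonneg (by have := hx1 t i; linarith) ih) (sq_nonneg _)
    have hcmp : ∀ t, δ t i ≤ 5 * M * w t := by
      intro t
      induction t with
      | zero => simp [w, hδ0]
      | succ t ih =>
        refine (hδhi t i).trans ?_
        have h1 := mul_le_mul_of_nonneg_left ih (sq_nonneg (1 - stepSize γ n (t + 1) * lam i))
        have h2 : (1 - stepSize γ n (t + 1) * lam i) ^ 2 * (5 * M * w t) ≤
            (1 - stepSize γ n (t + 1) * lam i) * (5 * M * w t) := by
          refine mul_le_mul_of_nonneg_right ?_ (mul_nonneg (by positivity) (hw0 t))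
          have := hx0 t i
          have := hx1 t i
          nlinarith
        change _ ≤ 5 * M * ((1 - stepSize γ n (t + 1) * lam i) * w t + _)
        linarith
    refine (hcmp n).trans (mul_le_mul_of_nonneg_left ?_ (by positivity))
    have h1 := variance_recursion_le_inv hn hγ.le (hl i).le ((hγl i).trans (by norm_num))
      (u := w) rfl fun t => le_rfl
    have h2 := variance_recursion_le_sq hn hγ.le (hl i).le (u := w) rfl hw0 fun t => le_rfl
    rcases le_total 1 ((effSampleSize n * γ * lam i) ^ 2) with h | h
    · rw [min_eq_left h]
      refine h1.trans ?_
      rw [← mul_div_assoc]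
      gcongr
      norm_num
    · rw [min_eq_right h]
      exact h2
  have hsplit : ∑ i, lam i * α n i =
      (∑ i, lam i * ((∏ t ∈ Finset.range n, (1 - stepSize γ n (t + 1) * lam i)) ^ 2 * α 0 i)) +
        ∑ i, δ n i := by
    rw [← Finset.sum_add_distrib]
    exact Finset.sum_congr rfl fun i _ => by simp [hδ]
  rw [hsplit]
  constructor
  · gcongr
    rw [Finset.mul_sum, Finset.mul_sum]
    exact Finset.sum_le_sum fun i _ => lower i
  · gcongr
    rw [Finset.mul_sum, Finset.mul_sum]
    exact Finset.sum_le_sum fun i _ => upper i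

end Scalar

end SketchedRegression

namespace SketchedRegression

/-! ### Gaussian tail, small ball and invariance properties of the sketch. -/

section Gaussian

open scoped NNReal ENNReal

/-- Gaussian integral of the exponential of a square, for an admissible exponent. -/
theorem integrable_exp_mul_sq_gaussianReal {v : ℝ≥0} (hv : v ≠ 0) {t : ℝ} (ht : 2 * t * v < 1) :
    Integrable (fun x : ℝ => Real.exp (t * x ^ 2)) (gaussianReal 0 v) ∧
    ∫ x, Real.exp (t * x ^ 2) ∂(gaussianReal 0 v) = √(1 / (1 - 2 * t * v)) := by
  have hv0 : (0 : ℝ) < v := by positivity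
  have hb : 0 < (1 - 2 * t * v) / (2 * v) := by
    have : 0 < 1 - 2 * t * v := by linarith
    positivity
  have hfun : ∀ x : ℝ, gaussianPDFReal 0 v x * Real.exp (t * x ^ 2) =
      (√(2 * Real.pi * v))⁻¹ * Real.exp (-((1 - 2 * t * v) / (2 * v)) * x ^ 2) := by
    intro x
    rw [gaussianPDFReal, mul_assoc, ← Real.exp_add]
    congr 2
    field_simp
    ring
  constructor
  · rw [gaussianReal_of_var_ne_zero _ hv, integrable_withDensity_iff_integrable_smul₀'
      (measurable_gaussianPDF 0 v).aemeasurable (by simp [gaussianPDF])]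
    simp only [toReal_gaussianPDF, smul_eq_mul, hfun]
    exact (integrable_exp_neg_mul_sq hb).const_mul _
  · rw [integral_gaussianReal_eq_integral_smul hv]
    simp only [smul_eq_mul, hfun]
    rw [integral_const_mul, integral_gaussian, ← Real.sqrt_inv, ← Real.sqrt_mul (by positivity)]
    congr 1
    have := Real.pi_pos
    field_simp

/-- For `y = t v ≤ 1/4` one has `(1 - 2y)(1 + 4y) ≥ 1`, so `1/(1 - 2y) ≤ e^{4y}`; the square root
halves the exponent. -/
theorem integral_exp_mul_sq_gaussianReal_le {v : ℝ≥0} (hv : v ≠ 0) {t : ℝ} (ht0 : 0 ≤ t)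
    (ht : 4 * t * v ≤ 1) :
    ∫ x, Real.exp (t * x ^ 2) ∂(gaussianReal 0 v) ≤ Real.exp (2 * t * v) := by
  have hv0 : (0 : ℝ) < v := by positivity
  have hy0 : 0 ≤ t * v := by positivity
  rw [(integrable_exp_mul_sq_gaussianReal hv (by nlinarith)).2]
  refine Real.sqrt_le_iff.2 ⟨(Real.exp_pos _).le, ?_⟩
  rw [← Real.exp_nat_mul, div_le_iff₀ (by nlinarith)]
  have h1 : 1 + 4 * (t * v) ≤ Real.exp ((2 : ℕ) * (2 * t * v)) := by
    have := Real.add_one_le_exp ((2 : ℕ) * (2 * t * v) : ℝ)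
    push_cast at this ⊢
    linarith
  have h2 : (1 + 4 * (t * v)) * (1 - 2 * t * v) ≤
      Real.exp ((2 : ℕ) * (2 * t * v)) * (1 - 2 * t * v) :=
    mul_le_mul_of_nonneg_right h1 (by nlinarith)
  nlinarith

theorem sketch_variance_ne_zero {m : ℕ} (hm : 1 ≤ m) : (1 / (m : ℝ≥0)) ≠ 0 := by
  have : (m : ℝ≥0) ≠ 0 := by exact_mod_cast (by omega : m ≠ 0)
  positivity

/-- Coordinates of a centered isotropic Gaussian along an orthonormal family are again
independent. -/
theorem map_dotProduct_pi_gaussianReal {ι κ : Type*} [Fintype ι] [Fintype κ]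
    (s : ℝ≥0) (v : κ → ι → ℝ)
    (hv : ∀ t : κ → ℝ, ∑ j, (∑ i, t i * v i j) ^ 2 = ∑ i, t i ^ 2) :
    (Measure.pi fun _ : ι => gaussianReal 0 s).map (fun r i => v i ⬝ᵥ r) =
      Measure.pi fun _ : κ => gaussianReal 0 s := by
  have hmeas : Measurable fun (r : ι → ℝ) (i : κ) => v i ⬝ᵥ r := by
    simp only [dotProduct]; fun_prop
  have : IsProbabilityMeasure ((Measure.pi fun _ : ι => gaussianReal 0 s).map
      (fun r i => v i ⬝ᵥ r)) := Measure.isProbabilityMeasure_map hmeas.aemeasurable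
  -- The characteristic function at `t` is that of the original vector at `∑ t_i v_i`. It depends
  -- only on the Euclidean norm, which `hv` says is preserved.
  refine charFun_eq_pi_iff.1 fun t => ?_
  have h1 : charFun (((Measure.pi fun _ : ι => gaussianReal 0 s).map
      (fun r i => v i ⬝ᵥ r)).map (WithLp.toLp 2)) t =
      charFun ((Measure.pi fun _ : ι => gaussianReal 0 s).map (WithLp.toLp 2))
        (WithLp.toLp 2 fun j => ∑ i, t i * v i j) := by
    rw [Measure.map_map (by fun_prop) hmeas, charFun_apply, charFun_apply,
      integral_map (by fun_prop) (by fun_prop), integral_map (by fun_prop) (by fun_prop)]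
    congr 1
    ext r
    congr 3
    simp only [Function.comp_apply, PiLp.inner_apply, RCLike.inner_apply, conj_trivial, dotProduct,
      Finset.mul_sum, Finset.sum_mul]
    rw [Finset.sum_comm]
    exact Finset.sum_congr rfl fun j _ => Finset.sum_congr rfl fun i _ => by ring
  rw [h1, charFun_pi]
  simp only [charFun_gaussianReal]
  rw [← Complex.exp_sum, ← Complex.exp_sum]
  congr 1
  simp only [Complex.ofReal_zero, mul_zero, zero_mul, zero_sub, Finset.sum_neg_distrib]
  rw [← Finset.sum_div, ← Finset.sum_div, ← Finset.mul_sum, ← Finset.mul_sum]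
  congr 3
  exact_mod_cast hv t

/-- Small ball estimate for the projection of a Gaussian vector on a subspace of at least half
the dimension. -/
theorem gaussian_small_ball {m q : ℕ} (hm : 1 ≤ m) (hq : m ≤ 2 * q) (v : Fin q → Fin m → ℝ)
    (hv : ∀ t : Fin q → ℝ, ∑ j, (∑ i, t i * v i j) ^ 2 = ∑ i, t i ^ 2) :
    (Measure.pi fun _ : Fin m => gaussianReal 0 (1 / (m : ℝ≥0)))
      {r | ∑ i, (v i ⬝ᵥ r) ^ 2 ≤ Real.exp (-16)} ≤ ENNReal.ofReal (Real.exp (-(3 * m))) := by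
  have hmeas : Measurable fun (r : Fin m → ℝ) (i : Fin q) => v i ⬝ᵥ r := by
    simp only [dotProduct]; fun_prop
  have hs := sketch_variance_ne_zero hm
  have hm0 : (0 : ℝ) < m := by exact_mod_cast hm
  set s : ℝ≥0 := 1 / (m : ℝ≥0) with hsdef
  have hsm : (m : ℝ) * s = 1 := by rw [hsdef]; push_cast; field_simp
  have hset : MeasurableSet {z : Fin q → ℝ | ∑ i, z i ^ 2 ≤ Real.exp (-16)} :=
    measurableSet_le (by fun_prop) (by fun_prop)
  have h0 : (Measure.pi fun _ : Fin m => gaussianReal 0 s)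
      {r | ∑ i, (v i ⬝ᵥ r) ^ 2 ≤ Real.exp (-16)} =
      (Measure.pi fun _ : Fin q => gaussianReal 0 s) {z | ∑ i, z i ^ 2 ≤ Real.exp (-16)} := by
    rw [← map_dotProduct_pi_gaussianReal s v hv, Measure.map_apply hmeas hset]
    rfl
  rw [h0]
  -- Chernoff exponent: each coordinate contributes `(1 + 2e^16)^{-1/2} ≤ e^{-8}`, at least `m/2`
  -- coordinates give `e^{-4m}`, and the threshold `e^{-16}` costs only `e^m`.
  set t : ℝ := -(m * Real.exp 16) with ht
  have hts : 2 * t * s = -(2 * Real.exp 16) := by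
    rw [ht]; linear_combination (-2 * Real.exp 16) * hsm
  have he := Real.exp_pos 16
  have hint := integrable_exp_mul_sq_gaussianReal hs (t := t) (by rw [hts]; linarith)
  have hexp : ∀ z : Fin q → ℝ, Real.exp (t * ∑ i, z i ^ 2) = ∏ i, Real.exp (t * z i ^ 2) := fun z => by
    rw [Finset.mul_sum, Real.exp_sum]
  have h1 := measure_le_le_exp_mul_mgf (μ := Measure.pi fun _ : Fin q => gaussianReal 0 s)
    (X := fun z => ∑ i, z i ^ 2) (t := t) (Real.exp (-16)) (by rw [ht]; nlinarith) (by
      simp only [hexp]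
      exact Integrable.fintype_prod fun _ => hint.1)
  rw [← ofReal_measureReal]
  refine ENNReal.ofReal_le_ofReal (h1.trans ?_)
  rw [mgf]
  simp only [hexp]
  rw [integral_fintype_prod_eq_prod (fun (_ : Fin q) (x : ℝ) => Real.exp (t * x ^ 2)),
    Finset.prod_const, Finset.card_univ, Fintype.card_fin, hint.2, hts]
  have h2 : √(1 / (1 - -(2 * Real.exp 16))) ≤ Real.exp (-8) := by
    refine Real.sqrt_le_iff.2 ⟨(Real.exp_pos _).le, ?_⟩
    rw [← Real.exp_nat_mul, div_le_iff₀ (by linarith)]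
    have : Real.exp ((2 : ℕ) * (-8)) * Real.exp 16 = 1 := by
      rw [← Real.exp_add]; norm_num
    have := Real.exp_pos ((2 : ℕ) * (-8))
    nlinarith
  have h3 : -t * Real.exp (-16) = m := by
    have : Real.exp 16 * Real.exp (-16) = 1 := by rw [← Real.exp_add]; norm_num
    rw [ht]; linear_combination (m : ℝ) * this
  rw [h3]
  calc Real.exp m * √(1 / (1 - -(2 * Real.exp 16))) ^ q
      ≤ Real.exp m * Real.exp (-8) ^ q := by gcongr
    _ = Real.exp (m + q * (-8)) := by rw [← Real.exp_nat_mul, Real.exp_add]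
    _ ≤ Real.exp (-(3 * m)) := by
        refine Real.exp_le_exp.2 ?_
        have : (m : ℝ) ≤ 2 * q := by exact_mod_cast hq
        linarith

/-- Upper tail of a weighted squared Frobenius norm of the sketch. -/
theorem sketch_weighted_norm_tail {m d : ℕ} (hm : 1 ≤ m) (w : Fin d → ℝ) (hw : ∀ j, 0 ≤ w j) :
    (Measure.pi fun _ : Fin m => Measure.pi fun _ : Fin d => gaussianReal 0 (1 / (m : ℝ≥0)))
      {R | 10 * ∑ j, w j < ∑ i, ∑ j, w j * R i j ^ 2} ≤ ENNReal.ofReal (Real.exp (-(2 * m))) := by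
  have hs := sketch_variance_ne_zero hm
  have hm0 : (0 : ℝ) < m := by exact_mod_cast hm
  set s : ℝ≥0 := 1 / (m : ℝ≥0) with hsdef
  have hsm : (s : ℝ) = 1 / m := by rw [hsdef]; push_cast; rfl
  rcases (Finset.sum_nonneg fun j (_ : j ∈ Finset.univ) => hw j).eq_or_lt with h0 | hpos
  · have hz : ∀ j, w j = 0 := fun j =>
      (Finset.sum_eq_zero_iff_of_nonneg fun j _ => hw j).1 h0.symm j (Finset.mem_univ j)
    simp [hz]
  set T := ∑ j, w j with hT
  -- Since `w j ≤ T`, this exponent is admissible for every weight. Chernoff then gives `e^{-10θT} ·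
  -- e^{m/2} = e^{-5m/2 + m/2}`.
  set θ : ℝ := m / (4 * T) with hθ
  have hθ0 : 0 < θ := by positivity
  have hle : ∀ j, 4 * (θ * w j) * s ≤ 1 := fun j => by
    have : w j ≤ T := Finset.single_le_sum (fun j _ => hw j) (Finset.mem_univ j)
    rw [hsm, hθ]
    field_simp
    exact this
  have hint := fun j => integrable_exp_mul_sq_gaussianReal hs (t := θ * w j) (by
    have := hle j
    have : 0 ≤ θ * w j * s := mul_nonneg (mul_nonneg hθ0.le (hw j)) s.2
    linarith)
  have hexp : ∀ R : Fin m → Fin d → ℝ, Real.exp (θ * ∑ i, ∑ j, w j * R i j ^ 2) =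
      ∏ i, ∏ j, Real.exp (θ * w j * R i j ^ 2) := fun R => by
    simp only [Finset.mul_sum, Real.exp_sum, mul_assoc]
  have hint2 : Integrable (fun r : Fin d → ℝ => ∏ j, Real.exp (θ * w j * r j ^ 2))
      (Measure.pi fun _ : Fin d => gaussianReal 0 s) :=
    Integrable.fintype_prod (f := fun j x => Real.exp (θ * w j * x ^ 2)) fun j => (hint j).1
  have h1 := measure_ge_le_exp_mul_mgf
    (μ := Measure.pi fun _ : Fin m => Measure.pi fun _ : Fin d => gaussianReal 0 s)
    (X := fun R => ∑ i, ∑ j, w j * R i j ^ 2) (t := θ) (10 * T) hθ0.le (by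
      simp only [hexp]
      exact Integrable.fintype_prod
        (f := fun (_ : Fin m) (r : Fin d → ℝ) => ∏ j, Real.exp (θ * w j * r j ^ 2)) fun _ => hint2)
  rw [← ofReal_measureReal]
  refine ENNReal.ofReal_le_ofReal ((measureReal_mono fun R hR => ?_).trans (h1.trans ?_))
  · exact le_of_lt (Set.mem_ofPred.1 hR)
  rw [mgf]
  simp only [hexp]
  rw [integral_fintype_prod_eq_prod
    (fun (_ : Fin m) (r : Fin d → ℝ) => ∏ j, Real.exp (θ * w j * r j ^ 2))]
  simp only [integral_fintype_prod_eq_prod (fun j (x : ℝ) => Real.exp (θ * w j * x ^ 2)),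
    Finset.prod_const, Finset.card_univ, Fintype.card_fin]
  have h2 : ∏ j, ∫ x, Real.exp (θ * w j * x ^ 2) ∂(gaussianReal 0 s) ≤
      ∏ j, Real.exp (2 * (θ * w j) * s) :=
    Finset.prod_le_prod (fun j _ => integral_nonneg fun x => (Real.exp_pos _).le) fun j _ =>
      integral_exp_mul_sq_gaussianReal_le hs (mul_nonneg hθ0.le (hw j)) (hle j)
  have h3 : ∏ j, Real.exp (2 * (θ * w j) * s) = Real.exp (1 / 2) := by
    rw [← Real.exp_sum, ← Finset.sum_mul, ← Finset.mul_sum, ← Finset.mul_sum, ← hT, hsm, hθ]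
    congr 1
    field_simp
    norm_num
  calc Real.exp (-θ * (10 * T)) * (∏ j, ∫ x, Real.exp (θ * w j * x ^ 2) ∂(gaussianReal 0 s)) ^ m
      ≤ Real.exp (-θ * (10 * T)) * Real.exp (1 / 2) ^ m := by
        rw [← h3]
        gcongr
    _ = Real.exp (-(2 * m)) := by
        rw [← Real.exp_nat_mul, ← Real.exp_add]
        congr 1
        rw [hθ]
        field_simp
        norm_num

/-- Rotating the features does not change the law of the sketch. -/
theorem measurePreserving_mul_sketchLaw {m d : ℕ} (U : Matrix (Fin d) (Fin d) ℝ)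
    (hU : U * Uᵀ = 1) :
    MeasurePreserving (fun R : Fin m → Fin d → ℝ => fun i j => (fun k => U k j) ⬝ᵥ R i)
      (Measure.pi fun _ : Fin m => Measure.pi fun _ : Fin d => gaussianReal 0 (1 / (m : ℝ≥0)))
      (Measure.pi fun _ : Fin m => Measure.pi fun _ : Fin d => gaussianReal 0 (1 / (m : ℝ≥0))) := by
  have hmeas : Measurable fun (r : Fin d → ℝ) (j : Fin d) => (fun k => U k j) ⬝ᵥ r := by
    simp only [dotProduct]; fun_prop
  refine measurePreserving_pi _ _ fun _ => ⟨hmeas, ?_⟩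
  refine map_dotProduct_pi_gaussianReal _ (fun j k => U k j) fun t => ?_
  have h1 : ∀ j, ∑ i, t i * U j i = (U *ᵥ t) j := fun j => by
    simp only [Matrix.mulVec, dotProduct, mul_comm]
  have h2 : Uᵀ * U = 1 := mul_eq_one_comm.1 hU
  simp only [h1]
  have h3 : (U *ᵥ t) ⬝ᵥ (U *ᵥ t) = t ⬝ᵥ t := by
    rw [Matrix.dotProduct_mulVec, Matrix.vecMul_mulVec, h2, Matrix.vecMul_one]
  simpa only [dotProduct, sq] using h3

/-- The columns of the sketch are independent and isotropic. -/
theorem measurePreserving_swap_sketchLaw (m d : ℕ) (s : ℝ≥0) :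
    MeasurePreserving (fun (R : Fin m → Fin d → ℝ) (j : Fin d) (i : Fin m) => R i j)
      (Measure.pi fun _ : Fin m => Measure.pi fun _ : Fin d => gaussianReal 0 s)
      (Measure.pi fun _ : Fin d => Measure.pi fun _ : Fin m => gaussianReal 0 s) := by
  refine ⟨by fun_prop, ?_⟩
  -- Both iterated products are images of a product over index pairs, where transposition merely
  -- relabels coordinates.
  have h1 : ∀ k l : ℕ, (Measure.pi fun _ : Fin k => Measure.pi fun _ : Fin l => gaussianReal 0 s) =
      (Measure.pi fun _ : Fin k × Fin l => gaussianReal 0 s).map (fun f i j => f (i, j)) := by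
    intro k l
    have h := Measure.infinitePi_map_curry (ι := Fin k) (κ := Fin l) (fun _ _ => gaussianReal 0 s)
    simp only [Measure.infinitePi_eq_pi] at h
    exact h.symm
  rw [h1, h1, Measure.map_map (by fun_prop) (by fun_prop)]
  have h2 : (Measure.pi fun _ : Fin d × Fin m => gaussianReal 0 s) =
      (Measure.pi fun _ : Fin m × Fin d => gaussianReal 0 s).map (fun f p => f (p.2, p.1)) := by
    have h := Measure.infinitePi_map_piCongrLeft (fun _ : Fin d × Fin m => gaussianReal 0 s)
      (Equiv.prodComm (Fin m) (Fin d))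
    simp only [Measure.infinitePi_eq_pi] at h
    rw [← h]
    congr 1
  rw [h2, Measure.map_map (by fun_prop) (by fun_prop)]
  rfl

/-- A set whose slices along one coordinate are small is small. -/
theorem measure_pi_le_of_slices {ι : Type*} [Fintype ι] [DecidableEq ι] {E : Type*}
    [MeasurableSpace E] (μ : ι → Measure E) [∀ i, IsProbabilityMeasure (μ i)] {S : Set (ι → E)}
    (hS : MeasurableSet S) (i : ι) {ε : ℝ≥0∞}
    (h : ∀ x : ι → E, μ i {r | Function.update x i r ∈ S} ≤ ε) : Measure.pi μ S ≤ ε := by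
  have hf : Measurable (S.indicator (1 : (ι → E) → ℝ≥0∞)) := measurable_one.indicator hS
  have key := lintegral_le_of_lmarginal_le (μ := μ) {i} hf (measurable_const (a := ε)) (by
    intro x
    rw [lmarginal_singleton, lmarginal_singleton]
    simp only [lintegral_const, measure_univ, mul_one]
    refine le_trans (le_of_eq ?_) (h x)
    have hm : MeasurableSet {r | Function.update x i r ∈ S} := measurable_update x hS
    rw [← lintegral_indicator_one hm]
    rfl)
  rw [lintegral_indicator_one hS] at key
  simpa using key

theorem absolutelyContinuous_pi {n : ℕ} {E : Type*} [MeasurableSpace E] (μ ν : Measure E)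
    [SigmaFinite μ] [SigmaFinite ν] (h : μ ≪ ν) :
    (Measure.pi fun _ : Fin n => μ) ≪ (Measure.pi fun _ : Fin n => ν) := by
  induction n with
  | zero => rw [Measure.pi_of_empty, Measure.pi_of_empty]
  | succ n ih =>
    have h1 := (measurePreserving_piFinSuccAbove (fun _ : Fin (n + 1) => μ) 0).symm
    have h2 := (measurePreserving_piFinSuccAbove (fun _ : Fin (n + 1) => ν) 0).symm
    rw [← h1.map_eq, ← h2.map_eq]
    exact (h.prod ih).map (MeasurableEquiv.measurable _)

/-- Almost surely the rows of the sketch are linearly independent. -/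
theorem ae_sketch_injective {m d : ℕ} (hm : 1 ≤ m) (hmd : m ≤ d) :
    ∀ᵐ R ∂(Measure.pi fun _ : Fin m => Measure.pi fun _ : Fin d => gaussianReal 0 (1 / (m : ℝ≥0))),
      ∀ v : Fin m → ℝ, (∀ j, ∑ i, v i * R i j = 0) → v = 0 := by
  have hac : (Measure.pi fun _ : Fin m => Measure.pi fun _ : Fin d =>
      gaussianReal 0 (1 / (m : ℝ≥0))) ≪ (volume : Measure (Fin m → Fin d → ℝ)) :=
    absolutelyContinuous_pi _ _ (absolutelyContinuous_pi _ _
      (gaussianReal_absolutelyContinuous 0 (sketch_variance_ne_zero hm)))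
  refine hac.ae_le ?_
  let B : (Fin m → Fin d → ℝ) → Matrix (Fin m) (Fin m) ℝ := fun R =>
    Matrix.of fun i j => R i (Fin.castLE hmd j)
  -- Moving along `E` adds a multiple of the identity to the leading square block `B`.
  let E : Fin m → Fin d → ℝ := fun i j => if j = Fin.castLE hmd i then 1 else 0
  have hBc : Continuous B := by
    refine continuous_matrix fun i j => ?_
    simp only [B, Matrix.of_apply]
    fun_prop
  have hBE : ∀ R (t : ℝ), B (R + t • E) = B R + t • (1 : Matrix (Fin m) (Fin m) ℝ) := by
    intro R t
    ext i j
    simp only [B, E, Matrix.of_apply, Pi.add_apply, Pi.smul_apply, smul_eq_mul, Matrix.add_apply,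
      Matrix.smul_apply, Matrix.one_apply, Fin.castLE_inj, eq_comm]
  let Z : Set (Fin m → Fin d → ℝ) := {R | (B R).det = 0}
  have hZ : MeasurableSet Z := (isClosed_eq (hBc.matrix_det) continuous_const).measurableSet
  have hnull : (volume : Measure (Fin m → Fin d → ℝ)) Z = 0 := by
    have hS : MeasurableSet {p : ℝ × (Fin m → Fin d → ℝ) | p.2 + p.1 • E ∈ Z} := by
      have hc : Continuous fun p : ℝ × (Fin m → Fin d → ℝ) => p.2 + p.1 • E := by fun_prop
      exact hc.measurable hZ
    have h1 : ((volume : Measure ℝ).prod (volume : Measure (Fin m → Fin d → ℝ)))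
        {p | p.2 + p.1 • E ∈ Z} = 0 := by
      rw [Measure.prod_apply_symm hS]
      refine (lintegral_congr fun R => ?_).trans lintegral_zero
      -- On each line `R + t E` the determinant is the characteristic polynomial of `-B R` at `t`,
      -- so it vanishes at finitely many `t`.
      refine Set.Finite.measure_zero (Set.Finite.subset (Polynomial.finite_setOfPred_isRoot
        (p := (-(B R)).charpoly) (Matrix.charpoly_monic _).ne_zero) ?_) _
      intro t ht
      have ht' : (B (R + t • E)).det = 0 := ht
      rw [hBE] at ht'
      change Polynomial.IsRoot _ t
      rw [Polynomial.IsRoot, Matrix.eval_charpoly, sub_neg_eq_add, add_comm, ← ht']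
      congr 2
      ext i j
      simp [Matrix.scalar_apply, Matrix.one_apply, Matrix.diagonal_apply]
    rw [Measure.measure_prod_null hS] at h1
    -- One null slice is enough: it is a translate of `Z`, and Lebesgue measure is translation
    -- invariant.
    obtain ⟨t, ht⟩ := h1.exists
    have h2 : Prod.mk t ⁻¹' {p : ℝ × (Fin m → Fin d → ℝ) | p.2 + p.1 • E ∈ Z} =
        (fun R => R + t • E) ⁻¹' Z := rfl
    simp only [h2, measure_preimage_add_right] at ht
    exact ht
  have hae : ∀ᵐ R ∂(volume : Measure (Fin m → Fin d → ℝ)), (B R).det ≠ 0 := by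
    rw [ae_iff]
    simpa using hnull
  filter_upwards [hae] with R hR v hv
  refine Matrix.eq_zero_of_vecMul_eq_zero hR ?_
  ext j
  exact hv (Fin.castLE hmd j)

end Gaussian

end SketchedRegression

namespace SketchedRegression

/-! ### Leverage scores and the good event for independent Gaussian columns. -/

section Columns

open scoped NNReal ENNReal

/-- Weighted Gram matrix `∑ j, Λ j • a j (a j)ᵀ` of a family of vectors. -/
noncomputable def gram {m : ℕ} {ι : Type*} [Fintype ι] (Λ : ι → ℝ) (A : ι → Fin m → ℝ) :
    Matrix (Fin m) (Fin m) ℝ :=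
  ∑ j, Λ j • Matrix.vecMulVec (A j) (A j)

variable {m : ℕ} {ι : Type*} [Fintype ι]

theorem gram_mulVec (Λ : ι → ℝ) (A : ι → Fin m → ℝ) (v : Fin m → ℝ) :
    gram Λ A *ᵥ v = ∑ j, (Λ j * (A j ⬝ᵥ v)) • A j := by
  rw [gram, Matrix.sum_mulVec]
  refine Finset.sum_congr rfl fun j _ => ?_
  rw [Matrix.smul_mulVec, Matrix.vecMulVec_mulVec]
  ext i
  simp [mul_comm, mul_left_comm]

theorem dotProduct_gram_mulVec (Λ : ι → ℝ) (A : ι → Fin m → ℝ) (v w : Fin m → ℝ) :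
    v ⬝ᵥ gram Λ A *ᵥ w = ∑ j, Λ j * (A j ⬝ᵥ v) * (A j ⬝ᵥ w) := by
  rw [gram_mulVec, dotProduct_sum]
  refine Finset.sum_congr rfl fun j _ => ?_
  rw [dotProduct_smul, smul_eq_mul, dotProduct_comm v]
  ring

theorem gram_isHermitian (Λ : ι → ℝ) (A : ι → Fin m → ℝ) : (gram Λ A).IsHermitian := by
  rw [Matrix.IsHermitian, Matrix.conjTranspose_eq_transpose_of_trivial, gram,
    Matrix.transpose_sum]
  refine Finset.sum_congr rfl fun j _ => ?_
  rw [Matrix.transpose_smul, Matrix.transpose_vecMulVec]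

theorem gram_posDef {Λ : ι → ℝ} (hΛ : ∀ j, 0 < Λ j) {A : ι → Fin m → ℝ}
    (hA : ∀ v : Fin m → ℝ, (∀ j, A j ⬝ᵥ v = 0) → v = 0) : (gram Λ A).PosDef := by
  refine Matrix.PosDef.of_dotProduct_mulVec_pos (gram_isHermitian Λ A) fun v hv => ?_
  rw [star_trivial, dotProduct_gram_mulVec]
  obtain ⟨j, hj⟩ : ∃ j, A j ⬝ᵥ v ≠ 0 := by
    by_contra hcon
    push Not at hcon
    exact hv (hA v hcon)
  refine Finset.sum_pos' (fun j _ => ?_) ⟨j, Finset.mem_univ j, ?_⟩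
  · rw [mul_assoc]; exact mul_nonneg (hΛ j).le (mul_self_nonneg _)
  · rw [mul_assoc]; exact mul_pos (hΛ j) (mul_self_pos.2 hj)

theorem gram_trace (Λ : ι → ℝ) (A : ι → Fin m → ℝ) :
    (gram Λ A).trace = ∑ j, Λ j * ∑ i, A j i ^ 2 := by
  rw [gram, Matrix.trace_sum]
  refine Finset.sum_congr rfl fun j _ => ?_
  rw [Matrix.trace_smul, Matrix.trace_vecMulVec, smul_eq_mul, dotProduct]
  simp only [sq]

/-- Leverage score of the `j`-th vector. -/
noncomputable def leverage (Λ : ι → ℝ) (A : ι → Fin m → ℝ) (j : ι) : ℝ :=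
  Λ j * (A j ⬝ᵥ (gram Λ A)⁻¹ *ᵥ A j)

theorem gram_mulVec_inv {Λ : ι → ℝ} {A : ι → Fin m → ℝ} (hH : (gram Λ A).PosDef)
    (v : Fin m → ℝ) : gram Λ A *ᵥ ((gram Λ A)⁻¹ *ᵥ v) = v := by
  rw [Matrix.mulVec_mulVec, Matrix.mul_nonsing_inv _ ((Matrix.isUnit_iff_isUnit_det _).1 hH.isUnit),
    Matrix.one_mulVec]

theorem leverage_nonneg {Λ : ι → ℝ} (hΛ : ∀ j, 0 < Λ j) {A : ι → Fin m → ℝ}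
    (hH : (gram Λ A).PosDef) (j : ι) : 0 ≤ leverage Λ A j := by
  have h := hH.inv.posSemidef.dotProduct_mulVec_nonneg (A j)
  rw [star_trivial] at h
  exact mul_nonneg (hΛ j).le h

/-- With `g = H⁻¹ A_j`, the form `gᵀ H g = A_j · g` contains the nonnegative summand `Λ_j (A_j ·
g)²`; dividing by `A_j · g` gives the bound. -/
theorem leverage_le_one {Λ : ι → ℝ} (hΛ : ∀ j, 0 < Λ j) {A : ι → Fin m → ℝ}
    (hH : (gram Λ A).PosDef) (j : ι) : leverage Λ A j ≤ 1 := by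
  set g := (gram Λ A)⁻¹ *ᵥ A j with hg
  have h1 : g ⬝ᵥ gram Λ A *ᵥ g = A j ⬝ᵥ g := by
    rw [hg, gram_mulVec_inv hH, dotProduct_comm]
  rw [dotProduct_gram_mulVec] at h1
  have h2 : Λ j * (A j ⬝ᵥ g) * (A j ⬝ᵥ g) ≤ A j ⬝ᵥ g := by
    refine le_trans ?_ h1.le
    refine Finset.single_le_sum (f := fun j => Λ j * (A j ⬝ᵥ g) * (A j ⬝ᵥ g)) (fun i _ => ?_)
      (Finset.mem_univ j)
    rw [mul_assoc]; exact mul_nonneg (hΛ i).le (mul_self_nonneg _)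
  have h0 := leverage_nonneg hΛ hH j
  rw [leverage, ← hg] at h0 ⊢
  have h3 : 0 ≤ A j ⬝ᵥ g := nonneg_of_mul_nonneg_right h0 (hΛ j)
  rcases h3.eq_or_lt with h | h
  · rw [← h]; simp
  · exact le_of_mul_le_mul_right (by linarith) h

/-- Both sides are the trace of `H⁻¹ H`. This fixed budget `m` drives the lower bound on the
approximation error. -/
theorem sum_leverage {Λ : ι → ℝ} {A : ι → Fin m → ℝ} (hH : (gram Λ A).PosDef) :
    ∑ j, leverage Λ A j = m := by
  have h1 : ((gram Λ A)⁻¹ * gram Λ A).trace = m := by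
    rw [Matrix.nonsing_inv_mul _ ((Matrix.isUnit_iff_isUnit_det _).1 hH.isUnit), Matrix.trace_one,
      Fintype.card_fin]
  rw [← h1]
  conv_rhs => rw [gram, Matrix.mul_sum, Matrix.trace_sum]
  refine Finset.sum_congr rfl fun j _ => ?_
  rw [leverage, Matrix.mul_smul, Matrix.trace_smul, smul_eq_mul, Matrix.mul_vecMulVec,
    Matrix.trace_vecMulVec, dotProduct_comm]
  rfl

/-- The leverage scores characterize the best approximation of each coordinate. -/
theorem residual_le [DecidableEq ι] {Λ : ι → ℝ} {A : ι → Fin m → ℝ}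
    (hH : (gram Λ A).PosDef) (j : ι) (v : Fin m → ℝ) :
    Λ j * (1 - leverage Λ A j) ≤
      Λ j * (1 - A j ⬝ᵥ v) ^ 2 + ∑ i ∈ Finset.univ.erase j, Λ i * (A i ⬝ᵥ v) ^ 2 := by
  set g := (gram Λ A)⁻¹ *ᵥ A j with hg
  have hHg : gram Λ A *ᵥ g = A j := gram_mulVec_inv hH _
  -- Completing the square: the right side minus the left side is the `H`-form at `v - Λ_j g`.
  have h1 := hH.posSemidef.dotProduct_mulVec_nonneg (v - Λ j • g)
  have h2 : g ⬝ᵥ gram Λ A *ᵥ v = A j ⬝ᵥ v := by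
    rw [dotProduct_gram_mulVec, ← hHg, gram_mulVec, sum_dotProduct]
    refine Finset.sum_congr rfl fun i _ => ?_
    rw [smul_dotProduct, smul_eq_mul]
  rw [star_trivial, Matrix.mulVec_sub, Matrix.mulVec_smul, hHg, sub_dotProduct, dotProduct_sub,
    dotProduct_sub, smul_dotProduct, smul_dotProduct, h2, dotProduct_smul, dotProduct_smul,
    dotProduct_gram_mulVec, dotProduct_comm v, dotProduct_comm g] at h1
  rw [← Finset.add_sum_erase _ _ (Finset.mem_univ j)] at h1
  simp only [smul_eq_mul] at h1
  have h3 : ∑ i ∈ Finset.univ.erase j, Λ i * (A i ⬝ᵥ v) * (A i ⬝ᵥ v) =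
      ∑ i ∈ Finset.univ.erase j, Λ i * (A i ⬝ᵥ v) ^ 2 :=
    Finset.sum_congr rfl fun i _ => by ring
  rw [h3] at h1
  rw [leverage, ← hg]
  nlinarith

/-- At most `m` directions can be resolved by an `m`-dimensional sketch. -/
theorem le_sum_residual {Λ : ι → ℝ} (hΛ : ∀ j, 0 < Λ j) {A : ι → Fin m → ℝ}
    (hH : (gram Λ A).PosDef) (J : Finset ι) {l : ℝ} (hl0 : 0 ≤ l) (hl : ∀ j ∈ J, l ≤ Λ j) :
    l * (J.card - m) ≤ ∑ j, Λ j * (1 - leverage Λ A j) := by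
  calc l * (J.card - m) ≤ l * ∑ j ∈ J, (1 - leverage Λ A j) := by
        gcongr
        rw [Finset.sum_sub_distrib, Finset.sum_const, nsmul_one, ← sum_leverage hH]
        refine sub_le_sub_left ?_ _
        exact Finset.sum_le_sum_of_subset_of_nonneg (Finset.subset_univ J)
          fun j _ _ => leverage_nonneg hΛ hH j
    _ = ∑ j ∈ J, l * (1 - leverage Λ A j) := Finset.mul_sum _ _ _
    _ ≤ ∑ j ∈ J, Λ j * (1 - leverage Λ A j) := Finset.sum_le_sum fun j hj =>
        mul_le_mul_of_nonneg_right (hl j hj) (by linarith [leverage_le_one hΛ hH j])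
    _ ≤ _ := Finset.sum_le_sum_of_subset_of_nonneg (Finset.subset_univ J) fun j _ _ =>
        mul_nonneg (hΛ j).le (by linarith [leverage_le_one hΛ hH j])

/-- Spectral decomposition of a symmetric matrix. -/
theorem eq_gram_eigenvectorBasis {H : Matrix (Fin m) (Fin m) ℝ} (hH : H.IsHermitian) :
    H = gram hH.eigenvalues fun l => (hH.eigenvectorBasis l).ofLp := by
  conv_lhs => rw [hH.spectral_theorem, Unitary.conjStarAlgAut_apply]
  ext i j
  simp [gram, Matrix.mul_apply, Matrix.sum_apply, Matrix.vecMulVec_apply, Matrix.diagonal_apply,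
    Matrix.star_apply, Matrix.IsHermitian.eigenvectorUnitary_apply]
  refine Finset.sum_congr rfl fun l _ => ?_
  ring

theorem dotProduct_mulVec_eq_sum_eigenvalues {H : Matrix (Fin m) (Fin m) ℝ} (hH : H.IsHermitian)
    (v w : Fin m → ℝ) :
    v ⬝ᵥ H *ᵥ w = ∑ l, hH.eigenvalues l * ((hH.eigenvectorBasis l).ofLp ⬝ᵥ v) *
      ((hH.eigenvectorBasis l).ofLp ⬝ᵥ w) := by
  conv_lhs => rw [eq_gram_eigenvectorBasis hH]
  exact dotProduct_gram_mulVec _ _ v w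

theorem inner_eq_dotProduct (v w : EuclideanSpace ℝ (Fin m)) :
    inner ℝ v w = v.ofLp ⬝ᵥ w.ofLp := by
  simp [PiLp.inner_apply, dotProduct, mul_comm]

/-- A subspace of at least half the dimension that is orthogonal to few given vectors and on which
a positive semidefinite form of small trace is small. -/
theorem exists_good_subspace [DecidableEq ι] {Λ : ι → ℝ} (hΛ : ∀ j, 0 < Λ j) (A : ι → Fin m → ℝ)
    (I J : Finset ι) (hI : 4 * I.card ≤ m) {τ : ℝ} (hτ : 0 < τ)
    (htail : ∑ j ∈ J, Λ j * ∑ i, A j i ^ 2 ≤ τ) :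
    ∃ (q : ℕ) (w : Fin q → Fin m → ℝ), m ≤ 2 * q ∧
      (∀ t : Fin q → ℝ, ∑ j, (∑ i, t i * w i j) ^ 2 = ∑ i, t i ^ 2) ∧
      (∀ j ∈ I, ∀ k, A j ⬝ᵥ w k = 0) ∧
      ∀ t : Fin q → ℝ, ∑ j ∈ J, Λ j * (A j ⬝ᵥ fun k => ∑ i, t i * w i k) ^ 2 ≤
        4 * τ / m * ∑ i, t i ^ 2 := by
  rcases Nat.eq_zero_or_pos m with rfl | hm
  · exact ⟨0, fun _ _ => 0, by simp, by simp, by simp, by simp [dotProduct]⟩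
  have hm0 : (0 : ℝ) < m := by exact_mod_cast hm
  set T := gram (fun j : J => Λ j) (fun j : J => A j) with hT
  have hTh : T.IsHermitian := gram_isHermitian _ _
  set μ := hTh.eigenvalues with hμ
  set b := hTh.eigenvectorBasis with hb
  have hTpsd : T.PosSemidef := by
    refine Matrix.PosSemidef.of_dotProduct_mulVec_nonneg hTh fun v => ?_
    rw [star_trivial, hT, dotProduct_gram_mulVec]
    refine Finset.sum_nonneg fun j _ => ?_
    rw [mul_assoc]
    exact mul_nonneg (hΛ _).le (mul_self_nonneg _)
  have hμ0 : ∀ l, 0 ≤ μ l := hTpsd.eigenvalues_nonneg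
  have hμsum : ∑ l, μ l ≤ τ := by
    have h1 : T.trace = ∑ l, μ l := by simpa using hTh.trace_eq_sum_eigenvalues
    rw [← h1, hT, gram_trace]
    refine le_trans (le_of_eq ?_) htail
    exact Finset.sum_coe_sort J (fun j => Λ j * ∑ i, A j i ^ 2)
  -- Since the eigenvalues sum to at most `τ`, at most `m/4` of them exceed `4τ/m`.
  set Lg : Finset (Fin m) := Finset.univ.filter fun l => 4 * τ / m < μ l with hLg
  have hLcard : 4 * Lg.card ≤ m := by
    have h1 : Lg.card * (4 * τ / m) ≤ τ := by
      calc Lg.card * (4 * τ / m) = ∑ l ∈ Lg, 4 * τ / m := by rw [Finset.sum_const, nsmul_eq_mul]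
        _ ≤ ∑ l ∈ Lg, μ l := Finset.sum_le_sum fun l hl => (Finset.mem_filter.1 hl).2.le
        _ ≤ ∑ l, μ l := Finset.sum_le_sum_of_subset_of_nonneg (Finset.subset_univ _)
            fun l _ _ => hμ0 l
        _ ≤ τ := hμsum
    have h2 : (4 * Lg.card : ℝ) ≤ m := by
      rw [← mul_div_assoc, div_le_iff₀ hm0] at h1
      nlinarith
    exact_mod_cast h2
  -- Its kernel is orthogonal to the vectors of `I` and to the large eigenvectors: at most `m/4 +
  -- m/4` conditions, hence dimension at least `m/2`.
  let f : EuclideanSpace ℝ (Fin m) →ₗ[ℝ] (I ⊕ Lg → ℝ) :=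
    LinearMap.pi fun s => match s with
      | Sum.inl j => innerₛₗ ℝ (WithLp.toLp 2 (A j) : EuclideanSpace ℝ (Fin m))
      | Sum.inr l => innerₛₗ ℝ (b l)
  set K := LinearMap.ker f with hK
  have hdim : m ≤ 2 * Module.finrank ℝ K := by
    have h1 := f.finrank_range_add_finrank_ker
    have h2 : Module.finrank ℝ (LinearMap.range f) ≤ I.card + Lg.card := by
      refine (Submodule.finrank_le _).trans ?_
      simp
    rw [finrank_euclideanSpace_fin, ← hK] at h1
    omega
  let w := stdOrthonormalBasis ℝ K
  have hKI : ∀ v ∈ K, ∀ j ∈ I, A j ⬝ᵥ v.ofLp = 0 := by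
    intro v hv j hj
    have h1 := congrFun (LinearMap.mem_ker.1 hv) (Sum.inl ⟨j, hj⟩)
    simpa [f, PiLp.inner_apply, dotProduct, mul_comm] using h1
  have hKL : ∀ v ∈ K, ∀ l ∈ Lg, inner ℝ (b l) v = 0 := by
    intro v hv l hl
    have h1 := congrFun (LinearMap.mem_ker.1 hv) (Sum.inr ⟨l, hl⟩)
    simpa [f] using h1
  have hcomb : ∀ t : Fin (Module.finrank ℝ K) → ℝ, (fun k => ∑ i, t i * (w i : EuclideanSpace ℝ (Fin m)) k) =
      ((∑ i, t i • w i : K) : EuclideanSpace ℝ (Fin m)).ofLp := by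
    intro t
    ext k
    simp
  have hnorm : ∀ t : Fin (Module.finrank ℝ K) → ℝ, ‖(∑ i, t i • w i : K)‖ ^ 2 = ∑ i, t i ^ 2 := by
    intro t
    have h1 := w.orthonormal.inner_sum t t Finset.univ
    rw [real_inner_self_eq_norm_sq] at h1
    simpa [sq] using h1
  refine ⟨Module.finrank ℝ K, fun i => (w i : EuclideanSpace ℝ (Fin m)).ofLp, hdim, fun t => ?_,
    fun j hj k => hKI _ (w k).2 j hj, fun t => ?_⟩
  · have h1 : ∀ j, ∑ i, t i * (w i : EuclideanSpace ℝ (Fin m)).ofLp j =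
        ((∑ i, t i • w i : K) : EuclideanSpace ℝ (Fin m)) j := fun j => congrFun (hcomb t) j
    simp only [h1]
    rw [← hnorm t, Submodule.coe_norm, EuclideanSpace.real_norm_sq_eq]
  · rw [hcomb]
    set v : K := ∑ i, t i • w i with hv
    have h1 : ∑ j ∈ J, Λ j * (A j ⬝ᵥ (v : EuclideanSpace ℝ (Fin m)).ofLp) ^ 2 =
        (v : EuclideanSpace ℝ (Fin m)).ofLp ⬝ᵥ T *ᵥ (v : EuclideanSpace ℝ (Fin m)).ofLp := by
      rw [hT, dotProduct_gram_mulVec, ← Finset.sum_coe_sort J]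
      exact Finset.sum_congr rfl fun j _ => by ring
    have h2 : (v : EuclideanSpace ℝ (Fin m)).ofLp ⬝ᵥ T *ᵥ (v : EuclideanSpace ℝ (Fin m)).ofLp =
        ∑ l, μ l * inner ℝ (b l) (v : EuclideanSpace ℝ (Fin m)) ^ 2 := by
      rw [dotProduct_mulVec_eq_sum_eigenvalues hTh]
      refine Finset.sum_congr rfl fun l _ => ?_
      rw [inner_eq_dotProduct, mul_assoc, ← sq]
    have h3 : ∑ i, t i ^ 2 = ∑ l, inner ℝ (b l) (v : EuclideanSpace ℝ (Fin m)) ^ 2 := by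
      rw [← hnorm t, ← hv, Submodule.coe_norm, b.sum_sq_inner_right]
    rw [h1, h2, h3, Finset.mul_sum]
    refine Finset.sum_le_sum fun l _ => ?_
    by_cases hl : l ∈ Lg
    · rw [hKL _ v.2 l hl]; simp
    · have : μ l ≤ 4 * τ / m := by simpa [hLg] using hl
      gcongr

/-- A coordinate of large weight is badly approximated only with exponentially small probability. -/
theorem sketch_coordinate_failure {d : ℕ} (hm : 1 ≤ m) {Λ : Fin d → ℝ} (hΛ : ∀ j, 0 < Λ j)
    (J : Finset (Fin d)) (hJ : 4 * J.card ≤ m) {τ : ℝ} (hτ : 0 < τ) {j : Fin d} (hj : j ∈ J) :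
    (Measure.pi fun _ : Fin d => Measure.pi fun _ : Fin m => gaussianReal 0 (1 / (m : ℝ≥0)))
      {A | ∑ i ∈ Jᶜ, Λ i * ∑ k, A i k ^ 2 ≤ τ ∧ ∀ v : Fin m → ℝ, 4 * τ / m * Real.exp 16 ≤
        Λ j * (1 - A j ⬝ᵥ v) ^ 2 + ∑ i ∈ Finset.univ.erase j, Λ i * (A i ⬝ᵥ v) ^ 2} ≤
      ENNReal.ofReal (Real.exp (-(3 * m))) := by
  have hm0 : (0 : ℝ) < m := by exact_mod_cast hm
  have hmeas : MeasurableSet {A : Fin d → Fin m → ℝ | ∑ i ∈ Jᶜ, Λ i * ∑ k, A i k ^ 2 ≤ τ ∧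
      ∀ v : Fin m → ℝ, 4 * τ / m * Real.exp 16 ≤
        Λ j * (1 - A j ⬝ᵥ v) ^ 2 + ∑ i ∈ Finset.univ.erase j, Λ i * (A i ⬝ᵥ v) ^ 2} := by
    refine IsClosed.measurableSet (IsClosed.inter ?_ ?_)
    · have hc : Continuous fun A : Fin d → Fin m → ℝ => ∑ i ∈ Jᶜ, Λ i * ∑ k, A i k ^ 2 := by
        fun_prop
      exact isClosed_le hc continuous_const
    · change IsClosed {A : Fin d → Fin m → ℝ | ∀ v : Fin m → ℝ, 4 * τ / m * Real.exp 16 ≤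
        Λ j * (1 - A j ⬝ᵥ v) ^ 2 + ∑ i ∈ Finset.univ.erase j, Λ i * (A i ⬝ᵥ v) ^ 2}
      simp only [Set.ofPred_forall]
      refine isClosed_iInter fun v => isClosed_le continuous_const ?_
      simp only [dotProduct]
      fun_prop
  -- All columns but the `j`-th are frozen. The tail condition does not involve column `j`, so a
  -- slice is empty or the frozen columns supply a good subspace, fixed before the column `r` is
  -- drawn.
  refine measure_pi_le_of_slices _ hmeas j fun A => ?_
  by_cases hA : ∑ i ∈ Jᶜ, Λ i * ∑ k, A i k ^ 2 ≤ τ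
  swap
  · refine le_trans (le_of_eq ?_) (zero_le (a := ENNReal.ofReal _))
    convert measure_empty (μ := Measure.pi fun _ : Fin m => gaussianReal 0 (1 / (m : ℝ≥0)))
    rw [Set.eq_empty_iff_forall_notMem]
    rintro r ⟨hr, -⟩
    refine hA (le_trans (le_of_eq ?_) hr)
    refine Finset.sum_congr rfl fun i hi => ?_
    rw [Function.update_of_ne]
    rintro rfl
    exact Finset.mem_compl.1 hi hj
  obtain ⟨q, w, hq, hw, hwI, hwJ⟩ := exists_good_subspace hΛ A (J.erase j) Jᶜ
    (by have := Finset.card_erase_le (s := J) (a := j); omega) hτ hA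
  refine le_trans (measure_mono ?_) (gaussian_small_ball hm hq w hw)
  rintro r ⟨-, hr⟩
  simp only [Set.mem_ofPred]
  by_contra hcon
  push Not at hcon
  set ρ := ∑ i, (w i ⬝ᵥ r) ^ 2 with hρ
  have hρ0 : 0 < ρ := (Real.exp_pos _).trans hcon
  -- The test vector is the projection of `r` on the subspace divided by its squared norm `ρ`, so it
  -- pairs to 1 with `r` and has squared norm `1/ρ`.
  have h1 := hr fun k => ∑ i, (w i ⬝ᵥ r / ρ) * w i k
  have hrv : r ⬝ᵥ (fun k => ∑ i, (w i ⬝ᵥ r / ρ) * w i k) = 1 := by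
    have : r ⬝ᵥ (fun k => ∑ i, (w i ⬝ᵥ r / ρ) * w i k) = ∑ i, (w i ⬝ᵥ r / ρ) * (w i ⬝ᵥ r) := by
      simp only [dotProduct, Finset.mul_sum]
      rw [Finset.sum_comm]
      exact Finset.sum_congr rfl fun i _ => Finset.sum_congr rfl fun k _ => by ring
    rw [this, ← div_self hρ0.ne', hρ, Finset.sum_div]
    exact Finset.sum_congr rfl fun i _ => by ring
  rw [Function.update_self, hrv, sub_self] at h1
  have h2 : ∑ i ∈ Finset.univ.erase j, Λ i * (Function.update A j r i ⬝ᵥ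
      (fun k => ∑ i, (w i ⬝ᵥ r / ρ) * w i k)) ^ 2 ≤ 4 * τ / m * ∑ i, (w i ⬝ᵥ r / ρ) ^ 2 := by
    refine le_trans (le_of_eq ?_) (hwJ _)
    have hsub : Jᶜ ⊆ Finset.univ.erase j := fun i hi => by
      rw [Finset.mem_erase]
      refine ⟨?_, Finset.mem_univ i⟩
      rintro rfl
      exact Finset.mem_compl.1 hi hj
    rw [← Finset.sum_subset hsub]
    · refine Finset.sum_congr rfl fun i hi => ?_
      rw [Function.update_of_ne (Finset.ne_of_mem_erase (hsub hi))]
    · intro i hi hiJ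
      have hij := Finset.ne_of_mem_erase hi
      have hiJ' : i ∈ J.erase j := Finset.mem_erase.2 ⟨hij, by simpa using hiJ⟩
      have h0 : A i ⬝ᵥ (fun k => ∑ l, (w l ⬝ᵥ r / ρ) * w l k) = 0 := by
        have : A i ⬝ᵥ (fun k => ∑ l, (w l ⬝ᵥ r / ρ) * w l k) =
            ∑ l, (w l ⬝ᵥ r / ρ) * (A i ⬝ᵥ w l) := by
          simp only [dotProduct, Finset.mul_sum]
          rw [Finset.sum_comm]
          exact Finset.sum_congr rfl fun l _ => Finset.sum_congr rfl fun k _ => by ring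
        rw [this]
        exact Finset.sum_eq_zero fun l _ => by rw [hwI i hiJ' l, mul_zero]
      rw [Function.update_of_ne hij, h0]
      simp
  have h3 : ∑ i, (w i ⬝ᵥ r / ρ) ^ 2 = 1 / ρ := by
    simp only [div_pow]
    rw [← Finset.sum_div, ← hρ]
    field_simp
  have h4 : 1 / ρ < Real.exp 16 := by
    rw [div_lt_iff₀ hρ0]
    have h5 := mul_lt_mul_of_pos_left hcon (Real.exp_pos 16)
    rwa [← Real.exp_add, add_neg_cancel, Real.exp_zero] at h5
  have h5 : 4 * τ / m * (1 / ρ) < 4 * τ / m * Real.exp 16 :=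
    mul_lt_mul_of_pos_left h4 (by positivity)
  rw [h3] at h2
  rw [zero_pow two_ne_zero, mul_zero, zero_add] at h1
  linarith

/-- The event on which a sketch with columns `A j` behaves well, and its probability. -/
theorem sketch_columns_good_event {d : ℕ} (hm : 1 ≤ m) (hmd : m ≤ d) {Λ : Fin d → ℝ}
    (hΛ : ∀ j, 0 < Λ j) (J : Finset (Fin d)) (hJ : 4 * J.card ≤ m) :
    (Measure.pi fun _ : Fin d => Measure.pi fun _ : Fin m => gaussianReal 0 (1 / (m : ℝ≥0)))
      {A | ¬ ((gram Λ A).PosDef ∧ (gram Λ A).trace ≤ 10 * ∑ j, Λ j ∧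
        ∑ j, Λ j * (1 - leverage Λ A j) ≤ 50 * Real.exp 16 * ∑ j ∈ Jᶜ, Λ j)} ≤
      ENNReal.ofReal (Real.exp (-(1 / 2 * m))) := by
  classical
  have hm0 : (1 : ℝ) ≤ m := by exact_mod_cast hm
  set P := (Measure.pi fun _ : Fin d => Measure.pi fun _ : Fin m =>
    gaussianReal 0 (1 / (m : ℝ≥0))) with hP
  have hswap := measurePreserving_swap_sketchLaw m d (1 / (m : ℝ≥0))
  -- This makes the tail strictly positive, as required of `τ`.
  have hJc : Jᶜ.Nonempty := by
    rw [← Finset.card_pos, Finset.card_compl, Fintype.card_fin]; omega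
  set σ := ∑ j ∈ Jᶜ, Λ j with hσ
  have hσ0 : 0 < σ := Finset.sum_pos (fun j _ => hΛ j) hJc
  set τ := 10 * σ with hτ
  have hτ0 : 0 < τ := by positivity
  -- weighted norms
  have hnorm : ∀ w : Fin d → ℝ, (∀ j, 0 ≤ w j) →
      P {A | 10 * ∑ j, w j < ∑ j, w j * ∑ i, A j i ^ 2} ≤ ENNReal.ofReal (Real.exp (-(2 * m))) := by
    intro w hw
    have hS : MeasurableSet {A : Fin d → Fin m → ℝ | 10 * ∑ j, w j < ∑ j, w j * ∑ i, A j i ^ 2} :=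
      measurableSet_lt (by fun_prop) (by fun_prop)
    rw [hP, ← hswap.measure_preimage hS.nullMeasurableSet]
    refine le_trans (measure_mono fun R hR => ?_) (sketch_weighted_norm_tail hm w hw)
    simp only [Set.preimage, Set.mem_ofPred] at hR ⊢
    refine hR.trans_eq ?_
    simp only [Finset.mul_sum]
    exact Finset.sum_comm
  set E1 := {A : Fin d → Fin m → ℝ | 10 * ∑ j, Λ j < ∑ j, Λ j * ∑ i, A j i ^ 2} with hE1
  -- Weights supported off `J`: the same norm bound then controls the mass of the tail columns.
  set w2 : Fin d → ℝ := fun j => if j ∈ Jᶜ then Λ j else 0 with hw2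
  set E2 := {A : Fin d → Fin m → ℝ | 10 * ∑ j, w2 j < ∑ j, w2 j * ∑ i, A j i ^ 2} with hE2
  set E3 : Fin d → Set (Fin d → Fin m → ℝ) := fun j =>
    {A | ∑ i ∈ Jᶜ, Λ i * ∑ k, A i k ^ 2 ≤ τ ∧ ∀ v : Fin m → ℝ, 4 * τ / m * Real.exp 16 ≤
        Λ j * (1 - A j ⬝ᵥ v) ^ 2 + ∑ i ∈ Finset.univ.erase j, Λ i * (A i ⬝ᵥ v) ^ 2} with hE3
  set E4 := {A : Fin d → Fin m → ℝ | ¬ ∀ v : Fin m → ℝ, (∀ j, A j ⬝ᵥ v = 0) → v = 0} with hE4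
  have hP4 : P E4 = 0 := by
    rw [hP, ← hswap.map_eq]
    have h := ae_sketch_injective hm hmd
    have h2 : ∀ᵐ A ∂(Measure.map (fun (R : Fin m → Fin d → ℝ) (j : Fin d) (i : Fin m) => R i j)
        (Measure.pi fun _ : Fin m => Measure.pi fun _ : Fin d => gaussianReal 0 (1 / (m : ℝ≥0)))),
        ∀ v : Fin m → ℝ, (∀ j, A j ⬝ᵥ v = 0) → v = 0 := by
      -- Transposition is a measurable equivalence, so the almost sure statement transfers without
      -- measurability of the event.
      have he : MeasurableEmbedding
          (fun (R : Fin m → Fin d → ℝ) (j : Fin d) (i : Fin m) => R i j) :=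
        (⟨⟨fun R j i => R i j, fun A i j => A j i, fun _ => rfl, fun _ => rfl⟩, by
          exact hswap.measurable, by
          exact (measurePreserving_swap_sketchLaw d m 1).measurable⟩ :
          (Fin m → Fin d → ℝ) ≃ᵐ (Fin d → Fin m → ℝ)).measurableEmbedding
      rw [he.ae_map_iff]
      filter_upwards [h] with R hR v hv
      refine hR v fun j => ?_
      rw [← hv j]
      exact Finset.sum_congr rfl fun i _ => mul_comm _ _
    exact h2
  have hsub : {A | ¬ ((gram Λ A).PosDef ∧ (gram Λ A).trace ≤ 10 * ∑ j, Λ j ∧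
        ∑ j, Λ j * (1 - leverage Λ A j) ≤ 50 * Real.exp 16 * σ)} ⊆
      E1 ∪ E2 ∪ (⋃ j ∈ J, E3 j) ∪ E4 := by
    intro A hA
    by_contra hcon
    simp only [Set.mem_union, Set.mem_iUnion, not_or, not_exists] at hcon
    obtain ⟨⟨⟨h1, h2⟩, h3⟩, h4⟩ := hcon
    simp only [hE1, hE2, hE4, Set.mem_ofPred, not_lt, not_not] at h1 h2 h4
    have hH := gram_posDef hΛ h4
    have htail : ∑ i ∈ Jᶜ, Λ i * ∑ k, A i k ^ 2 ≤ τ := by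
      simpa only [hw2, ite_mul, zero_mul, Finset.sum_ite_mem, Finset.univ_inter] using h2
    refine hA ⟨hH, by rwa [gram_trace], ?_⟩
    rw [← Finset.sum_add_sum_compl J]
    have h5 : ∀ j ∈ J, Λ j * (1 - leverage Λ A j) ≤ 4 * τ / m * Real.exp 16 := by
      intro j hj
      have h6 := h3 j hj
      simp only [hE3, Set.mem_ofPred, not_and, not_forall, not_le] at h6
      obtain ⟨v, hv⟩ := h6 htail
      exact (residual_le hH j v).trans hv.le
    -- `4 |J| ≤ m` cancels the factor `4/m`: the top indices cost `τ e^16 = 10 e^16 σ` altogether,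
    -- and the tail at most `σ`.
    have h6 : ∑ j ∈ J, Λ j * (1 - leverage Λ A j) ≤ τ * Real.exp 16 := by
      refine (Finset.sum_le_card_nsmul J _ _ h5).trans ?_
      have h7 : (4 * J.card : ℝ) ≤ m := by exact_mod_cast hJ
      rw [nsmul_eq_mul]
      calc (J.card : ℝ) * (4 * τ / m * Real.exp 16) = (4 * J.card) / m * (τ * Real.exp 16) := by ring
        _ ≤ 1 * (τ * Real.exp 16) := by
            gcongr
            rw [div_le_one (by linarith)]
            exact h7
        _ = _ := one_mul _
    have h7 : ∑ j ∈ Jᶜ, Λ j * (1 - leverage Λ A j) ≤ σ :=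
      Finset.sum_le_sum fun j _ => mul_le_of_le_one_right (hΛ j).le
        (by linarith [leverage_nonneg hΛ hH j])
    have h8 : 1 ≤ Real.exp 16 := Real.one_le_exp (by norm_num)
    rw [hτ] at h6
    nlinarith
  have hPE : P (E1 ∪ E2 ∪ (⋃ j ∈ J, E3 j) ∪ E4) ≤ ENNReal.ofReal (Real.exp (-(2 * m))) +
      ENNReal.ofReal (Real.exp (-(2 * m))) + ∑ j ∈ J, ENNReal.ofReal (Real.exp (-(3 * m))) + 0 := by
    refine (measure_union_le _ _).trans (add_le_add ((measure_union_le _ _).trans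
      (add_le_add ((measure_union_le _ _).trans (add_le_add ?_ ?_)) ?_)) hP4.le)
    · exact hnorm Λ fun j => (hΛ j).le
    · refine hnorm w2 fun j => ?_
      simp only [hw2]
      split_ifs
      exacts [(hΛ j).le, le_rfl]
    · exact (measure_biUnion_finset_le J E3).trans
        (Finset.sum_le_sum fun j hj => sketch_coordinate_failure hm hΛ J hJ hτ0 hj)
  refine (measure_mono hsub).trans (hPE.trans ?_)
  rw [add_zero, Finset.sum_const, nsmul_eq_mul, ← ENNReal.ofReal_natCast, ← ENNReal.ofReal_mul
    (by positivity), ← ENNReal.ofReal_add (by positivity) (by positivity),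
    ← ENNReal.ofReal_add (by positivity) (by positivity)]
  refine ENNReal.ofReal_le_ofReal ?_
  -- The union bound over `J` loses a factor below `e^m`, paid for by the rate `e^{-3m}` of a single
  -- coordinate.
  have h1 : (J.card : ℝ) * Real.exp (-(3 * m)) ≤ Real.exp (-(2 * m)) := by
    have h2 : (J.card : ℝ) ≤ Real.exp m := by
      have h3 : (4 * J.card : ℝ) ≤ m := by exact_mod_cast hJ
      linarith [Real.add_one_le_exp (m : ℝ)]
    calc (J.card : ℝ) * Real.exp (-(3 * m)) ≤ Real.exp m * Real.exp (-(3 * m)) := by gcongr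
      _ = _ := by rw [← Real.exp_add]; congr 1; ring
  have h2 : 3 * Real.exp (-(2 * m)) ≤ Real.exp (-(1 / 2 * m)) := by
    have h3 : (3 : ℝ) ≤ Real.exp (3 / 2 * m) := by
      have h4 : Real.exp (3 / 2) ≤ Real.exp (3 / 2 * m) := Real.exp_le_exp.2 (by linarith)
      have h5 := Real.quadratic_le_exp_of_nonneg (x := 3 / 2) (by norm_num)
      linarith
    calc 3 * Real.exp (-(2 * m)) ≤ Real.exp (3 / 2 * m) * Real.exp (-(2 * m)) := by gcongr
      _ = _ := by rw [← Real.exp_add]; congr 1; ring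
  linarith

end Columns

end SketchedRegression

namespace SketchedRegression

/-! ### Moments of the features and orthogonality of the noise. -/

section Moments

open scoped NNReal ENNReal

/-- The fourth derivative of the moment generating function at 0. Each differentiation sends `p ·
mgf` to `(p' + p · v t) · mgf`, so only polynomials have to be tracked. -/
theorem integral_pow_four_gaussianReal (v : ℝ≥0) :
    ∫ x, x ^ 4 ∂(gaussianReal 0 v) = 3 * (v : ℝ) ^ 2 := by
  have h := iteratedDeriv_mgf_zero (X := id) (μ := gaussianReal 0 v) (by simp) 4
  have h1 : (gaussianReal 0 v)[id ^ 4] = ∫ x, x ^ 4 ∂(gaussianReal 0 v) := rfl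
  rw [← h1, ← h, mgf_id_gaussianReal]
  have hf : ∀ t : ℝ, HasDerivAt (fun t : ℝ => Real.exp (0 * t + v * t ^ 2 / 2))
      (v * t * Real.exp (0 * t + v * t ^ 2 / 2)) t := by
    intro t
    have h0 : HasDerivAt (fun t : ℝ => 0 * t + v * t ^ 2 / 2) (v * t) t := by
      have := ((hasDerivAt_pow 2 t).const_mul (v : ℝ)).div_const 2
      simp only [zero_mul, zero_add]
      convert! this using 1
      norm_num; ring
    have := h0.exp
    rwa [mul_comm] at this
  have hp : ∀ (p p' : ℝ → ℝ), (∀ t, HasDerivAt p (p' t) t) →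
      deriv (fun t => p t * Real.exp (0 * t + v * t ^ 2 / 2)) =
        fun t => (p' t + p t * (v * t)) * Real.exp (0 * t + v * t ^ 2 / 2) := by
    intro p p' hp
    funext t
    refine HasDerivAt.deriv ?_
    convert! (hp t).mul (hf t) using 1
    ring
  have d1 : deriv (fun t : ℝ => Real.exp (0 * t + v * t ^ 2 / 2)) =
      fun t => (v * t) * Real.exp (0 * t + v * t ^ 2 / 2) := funext fun t => (hf t).deriv
  rw [iteratedDeriv_eq_iterate]
  simp only [Function.iterate_succ, Function.iterate_zero, Function.comp_apply, id]
  rw [d1, hp (fun t => v * t) (fun _ => v) fun t => by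
      simpa using (hasDerivAt_id t).const_mul (v : ℝ),
    hp (fun t => (v : ℝ) + v * t * (v * t)) (fun t => 2 * v ^ 2 * t) fun t => by
      have := (((hasDerivAt_id t).const_mul (v : ℝ)).mul
        ((hasDerivAt_id t).const_mul (v : ℝ))).const_add (v : ℝ)
      convert! this using 1
      simp only [id]; ring,
    hp (fun t => 2 * (v : ℝ) ^ 2 * t + (v + v * t * (v * t)) * (v * t))
      (fun t => 3 * v ^ 2 + 3 * v ^ 3 * t ^ 2) fun t => by
      have := ((hasDerivAt_id t).const_mul (3 * (v : ℝ) ^ 2)).add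
        ((hasDerivAt_pow 3 t).const_mul ((v : ℝ) ^ 3))
      convert! this using 1
      · funext t; simp only [id, Pi.add_apply]; ring
      · norm_num; ring]
  simp

variable {d p : ℕ} {P : Measure (Example d p)}
  {G : Matrix (Fin d) (Fin d) ℝ} {W : Matrix (Fin d) (Fin p) ℝ} {σ : ℝ}

theorem GaussianWellSpecified.map_dotProduct (h : GaussianWellSpecified P G W σ)
    (hG : G.PosSemidef) (u : Fin d → ℝ) :
    P.map (fun z => u ⬝ᵥ z.1.ofLp) = gaussianReal 0 (u ⬝ᵥ G *ᵥ u).toNNReal := by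
  have h1 : (fun z : Example d p => u ⬝ᵥ z.1.ofLp) =
      (innerSL ℝ (WithLp.toLp 2 u : EuclideanSpace ℝ (Fin d))) ∘ Prod.fst := by
    ext z
    simp [PiLp.inner_apply, dotProduct, mul_comm]
  rw [h1, ← Measure.map_map (by fun_prop) (by fun_prop), h.gaussian,
    IsGaussian.map_eq_gaussianReal]
  congr 1
  · rw [ContinuousLinearMap.integral_comp_id_comm IsGaussian.integrable_id,
      integral_id_multivariateGaussian, map_zero]
  · congr 1
    have h2 := covarianceBilin_multivariateGaussian (μ := 0) hG (WithLp.toLp 2 u) (WithLp.toLp 2 u)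
    rw [covarianceBilin_self IsGaussian.memLp_two_id] at h2
    exact h2

theorem GaussianWellSpecified.memLp_dotProduct (h : GaussianWellSpecified P G W σ)
    (hG : G.PosSemidef) (u : Fin d → ℝ) (q : ℝ≥0) :
    MemLp (fun z : Example d p => u ⬝ᵥ z.1.ofLp) q P := by
  have hm : Measurable fun z : Example d p => u ⬝ᵥ z.1.ofLp := by
    simp only [dotProduct]; fun_prop
  have h1 := memLp_id_gaussianReal (μ := 0) (v := (u ⬝ᵥ G *ᵥ u).toNNReal) q
  rw [← h.map_dotProduct hG u] at h1
  exact (memLp_map_measure_iff (by fun_prop) hm.aemeasurable).1 h1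

theorem GaussianWellSpecified.integral_sq (h : GaussianWellSpecified P G W σ)
    (hG : G.PosSemidef) (u : Fin d → ℝ) :
    ∫ z, (u ⬝ᵥ z.1.ofLp) ^ 2 ∂P = u ⬝ᵥ G *ᵥ u := by
  have hm : Measurable fun z : Example d p => u ⬝ᵥ z.1.ofLp := by
    simp only [dotProduct]; fun_prop
  have h0 : 0 ≤ u ⬝ᵥ G *ᵥ u := by simpa using hG.dotProduct_mulVec_nonneg u
  have h1 := integral_map (μ := P) hm.aemeasurable (f := fun x : ℝ => x ^ 2) (by fun_prop)
  rw [← h1, h.map_dotProduct hG u]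
  have h2 := variance_id_gaussianReal (μ := 0) (v := (u ⬝ᵥ G *ᵥ u).toNNReal)
  rw [variance_eq_integral aemeasurable_id] at h2
  simp only [id, integral_id_gaussianReal, sub_zero] at h2
  rw [h2, Real.coe_toNNReal _ h0]

theorem GaussianWellSpecified.integral_pow_four (h : GaussianWellSpecified P G W σ)
    (hG : G.PosSemidef) (u : Fin d → ℝ) :
    ∫ z, (u ⬝ᵥ z.1.ofLp) ^ 4 ∂P = 3 * (u ⬝ᵥ G *ᵥ u) ^ 2 := by
  have hm : Measurable fun z : Example d p => u ⬝ᵥ z.1.ofLp := by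
    simp only [dotProduct]; fun_prop
  have h0 : 0 ≤ u ⬝ᵥ G *ᵥ u := by simpa using hG.dotProduct_mulVec_nonneg u
  have h1 := integral_map (μ := P) hm.aemeasurable (f := fun x : ℝ => x ^ 4) (by fun_prop)
  rw [← h1, h.map_dotProduct hG u, integral_pow_four_gaussianReal, Real.coe_toNNReal _ h0]

theorem dotProduct_mulVec_comm (hG : G.IsHermitian) (u v : Fin d → ℝ) :
    u ⬝ᵥ G *ᵥ v = v ⬝ᵥ G *ᵥ u := by
  have h : Gᵀ = G := by rw [← Matrix.conjTranspose_eq_transpose_of_trivial]; exact hG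
  rw [Matrix.dotProduct_mulVec, ← Matrix.mulVec_transpose, h, dotProduct_comm]

theorem GaussianWellSpecified.integral_mul (h : GaussianWellSpecified P G W σ)
    (hG : G.PosSemidef) (u v : Fin d → ℝ) :
    ∫ z, (u ⬝ᵥ z.1.ofLp) * (v ⬝ᵥ z.1.ofLp) ∂P = u ⬝ᵥ G *ᵥ v := by
  have hint : ∀ w : Fin d → ℝ, Integrable (fun z : Example d p => (w ⬝ᵥ z.1.ofLp) ^ 2) P :=
    fun w => (h.memLp_dotProduct hG w 2).integrable_sq
  have h1 : ∀ z : Example d p, (u ⬝ᵥ z.1.ofLp) * (v ⬝ᵥ z.1.ofLp) =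
      4⁻¹ * (((u + v) ⬝ᵥ z.1.ofLp) ^ 2 - ((u - v) ⬝ᵥ z.1.ofLp) ^ 2) := fun z => by
    rw [add_dotProduct, sub_dotProduct]; ring
  simp only [h1]
  rw [integral_const_mul, integral_sub (hint _) (hint _), h.integral_sq hG, h.integral_sq hG]
  simp only [Matrix.mulVec_add, Matrix.mulVec_sub, add_dotProduct, sub_dotProduct, dotProduct_add,
    dotProduct_sub, dotProduct_mulVec_comm hG.1 v u]
  ring

theorem GaussianWellSpecified.integrable_pow_four [IsProbabilityMeasure P]
    (h : GaussianWellSpecified P G W σ)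
    (hG : G.PosSemidef) (u : Fin d → ℝ) :
    Integrable (fun z : Example d p => (u ⬝ᵥ z.1.ofLp) ^ 4) P := by
  have h1 := (h.memLp_dotProduct hG u 4).integrable_norm_pow (by norm_num)
  refine h1.congr (ae_of_all _ fun z => ?_)
  simp only [Real.norm_eq_abs]
  exact Even.pow_abs (by decide) _

/-- Polarization, `12 x² y² = (x + y)⁴ + (x - y)⁴ - 2x⁴ - 2y⁴`, reduces mixed moments to fourth
powers of single linear forms. -/
theorem GaussianWellSpecified.integrable_sq_mul_sq [IsProbabilityMeasure P]
    (h : GaussianWellSpecified P G W σ)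
    (hG : G.PosSemidef) (u v : Fin d → ℝ) :
    Integrable (fun z : Example d p => (u ⬝ᵥ z.1.ofLp) ^ 2 * (v ⬝ᵥ z.1.ofLp) ^ 2) P := by
  have h1 : (fun z : Example d p => (u ⬝ᵥ z.1.ofLp) ^ 2 * (v ⬝ᵥ z.1.ofLp) ^ 2) = fun z =>
      12⁻¹ * (((u + v) ⬝ᵥ z.1.ofLp) ^ 4 + ((u - v) ⬝ᵥ z.1.ofLp) ^ 4 -
        2 * (u ⬝ᵥ z.1.ofLp) ^ 4 - 2 * (v ⬝ᵥ z.1.ofLp) ^ 4) := by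
    funext z
    rw [add_dotProduct, sub_dotProduct]; ring
  rw [h1]
  have := h.integrable_pow_four hG
  exact ((((this _).add (this _)).sub ((this u).const_mul 2)).sub ((this v).const_mul 2)).const_mul _

/-- Wick's formula for two linear forms. -/
theorem GaussianWellSpecified.integral_sq_mul_sq [IsProbabilityMeasure P]
    (h : GaussianWellSpecified P G W σ)
    (hG : G.PosSemidef) (u v : Fin d → ℝ) :
    ∫ z, (u ⬝ᵥ z.1.ofLp) ^ 2 * (v ⬝ᵥ z.1.ofLp) ^ 2 ∂P =
      (u ⬝ᵥ G *ᵥ u) * (v ⬝ᵥ G *ᵥ v) + 2 * (u ⬝ᵥ G *ᵥ v) ^ 2 := by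
  have h1 : ∀ z : Example d p, (u ⬝ᵥ z.1.ofLp) ^ 2 * (v ⬝ᵥ z.1.ofLp) ^ 2 =
      12⁻¹ * (((u + v) ⬝ᵥ z.1.ofLp) ^ 4 + ((u - v) ⬝ᵥ z.1.ofLp) ^ 4 -
        2 * (u ⬝ᵥ z.1.ofLp) ^ 4 - 2 * (v ⬝ᵥ z.1.ofLp) ^ 4) := by
    intro z
    rw [add_dotProduct, sub_dotProduct]; ring
  have hi := h.integrable_pow_four hG
  simp only [h1]
  have hi1 : Integrable (fun z : Example d p => ((u + v) ⬝ᵥ z.1.ofLp) ^ 4 +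
      ((u - v) ⬝ᵥ z.1.ofLp) ^ 4) P := (hi _).add (hi _)
  have hi2 : Integrable (fun z : Example d p => ((u + v) ⬝ᵥ z.1.ofLp) ^ 4 +
      ((u - v) ⬝ᵥ z.1.ofLp) ^ 4 - 2 * (u ⬝ᵥ z.1.ofLp) ^ 4) P := hi1.sub ((hi u).const_mul 2)
  rw [integral_const_mul, integral_sub hi2 ((hi v).const_mul 2),
    integral_sub hi1 ((hi u).const_mul 2), integral_add (hi _) (hi _), integral_const_mul,
    integral_const_mul]
  simp only [h.integral_pow_four hG]
  simp only [Matrix.mulVec_add, Matrix.mulVec_sub, add_dotProduct, sub_dotProduct, dotProduct_add,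
    dotProduct_sub, dotProduct_mulVec_comm hG.1 v u]
  ring

/-- The label noise. -/
noncomputable def noise (W : Matrix (Fin d) (Fin p) ℝ) (z : Example d p) (c : Fin p) : ℝ :=
  z.2 c - (fun k => W k c) ⬝ᵥ z.1.ofLp

theorem predict_apply (W : Matrix (Fin d) (Fin p) ℝ) (x : EuclideanSpace ℝ (Fin d)) (c : Fin p) :
    predict W x c = (fun k => W k c) ⬝ᵥ x.ofLp := rfl

theorem sq_norm_sub_predict (W : Matrix (Fin d) (Fin p) ℝ) (z : Example d p) :
    ‖z.2 - predict W z.1‖ ^ 2 = ∑ c, noise W z c ^ 2 := by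
  rw [EuclideanSpace.real_norm_sq_eq]; rfl

theorem measurable_noise (W : Matrix (Fin d) (Fin p) ℝ) (c : Fin p) :
    Measurable fun z : Example d p => noise W z c := by
  simp only [noise, dotProduct]; fun_prop

theorem GaussianWellSpecified.memLp_label (h : GaussianWellSpecified P G W σ) (c : Fin p) :
    MemLp (fun z : Example d p => z.2 c) 2 P := by
  refine h.memLp.mono (by fun_prop) (ae_of_all _ fun z => ?_)
  exact PiLp.norm_apply_le z.2 c

theorem GaussianWellSpecified.memLp_noise (h : GaussianWellSpecified P G W σ)
    (hG : G.PosSemidef) (c : Fin p) : MemLp (fun z : Example d p => noise W z c) 2 P :=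
  (h.memLp_label c).sub (h.memLp_dotProduct hG _ 2)

/-- The noise is uncorrelated with every square integrable function of the features. -/
theorem GaussianWellSpecified.integral_mul_noise [IsProbabilityMeasure P]
    (h : GaussianWellSpecified P G W σ)
    (hG : G.PosSemidef) {f : EuclideanSpace ℝ (Fin d) → ℝ} (hf : Measurable f)
    (hf2 : MemLp (fun z : Example d p => f z.1) 2 P) (c : Fin p) :
    Integrable (fun z : Example d p => f z.1 * noise W z c) P ∧
    ∫ z, f z.1 * noise W z c ∂P = 0 := by
  have hi1 : Integrable (fun z : Example d p => f z.1 * noise W z c) P :=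
    hf2.integrable_mul (h.memLp_noise hG c)
  refine ⟨hi1, ?_⟩
  set M : MeasurableSpace (Example d p) := MeasurableSpace.comap Prod.fst inferInstance with hM
  have hMle : M ≤ (Prod.instMeasurableSpace : MeasurableSpace (Example d p)) := measurable_fst.comap_le
  have hfm : StronglyMeasurable[M] fun z : Example d p => f z.1 :=
    (hf.comp (comap_measurable Prod.fst)).stronglyMeasurable
  have hil : Integrable (fun z : Example d p => f z.1 * z.2 c) P :=
    hf2.integrable_mul (h.memLp_label c)
  have hip : Integrable (fun z : Example d p => f z.1 * ((fun k => W k c) ⬝ᵥ z.1.ofLp)) P :=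
    hf2.integrable_mul (q := (2 : ℝ≥0∞)) (h.memLp_dotProduct hG _ 2)
  have hy : Integrable (fun z : Example d p => z.2) P := h.memLp.integrable (by norm_num)
  -- The vector-valued conditional expectation commutes with the coordinate projection; the
  -- feature-measurable factor `f` can then be pulled out.
  have h1 : P[fun z : Example d p => z.2 c | M] =ᵐ[P] fun z => (fun k => W k c) ⬝ᵥ z.1.ofLp := by
    have h2 := (EuclideanSpace.proj (𝕜 := ℝ) c).comp_condExp_comm (m := M) hy
    filter_upwards [h2, h.condExp_eq] with z hz hz'
    have h3 : P[fun z : Example d p => z.2 c | M] z =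
      (EuclideanSpace.proj (𝕜 := ℝ) c) (P[fun z : Example d p => z.2 | M] z) := hz.symm
    rw [h3, hz']
    rfl
  have h4 := condExp_mul_of_stronglyMeasurable_left (μ := P) hfm hil
    ((h.memLp_label c).integrable (by norm_num))
  have h5 : ∫ z, f z.1 * z.2 c ∂P = ∫ z, f z.1 * ((fun k => W k c) ⬝ᵥ z.1.ofLp) ∂P := by
    rw [← integral_condExp hMle]
    refine integral_congr_ae ?_
    filter_upwards [h4, h1] with z hz hz'
    refine hz.trans ?_
    simp only [Pi.mul_apply, hz']
  simp only [noise, mul_sub]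
  rw [integral_sub hil hip, h5, sub_self]

end Moments

end SketchedRegression

namespace SketchedRegression

/-! ### Normal equations and orthogonality for the sketched problem. -/

section Algebra

variable {m d p : ℕ}

theorem sqNorm_eq_sum (A : Matrix (Fin m) (Fin m) ℝ) (V : Matrix (Fin m) (Fin p) ℝ) :
    sqNorm A V = ∑ c, (fun k => V k c) ⬝ᵥ A *ᵥ fun k => V k c := by
  rw [sqNorm, Matrix.trace]
  refine Finset.sum_congr rfl fun c _ => ?_
  rw [Matrix.diag_apply, Matrix.mul_assoc, Matrix.mul_apply']
  rfl

theorem sqNorm_nonneg {A : Matrix (Fin m) (Fin m) ℝ} (hA : A.PosSemidef)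
    (V : Matrix (Fin m) (Fin p) ℝ) : 0 ≤ sqNorm A V := by
  rw [sqNorm_eq_sum]
  exact Finset.sum_nonneg fun c _ => by simpa using hA.dotProduct_mulVec_nonneg fun k => V k c

theorem sqNorm_mul (A : Matrix (Fin m) (Fin m) ℝ) (X : Matrix (Fin m) (Fin d) ℝ)
    (W : Matrix (Fin d) (Fin p) ℝ) : sqNorm A (X * W) = sqNorm (Xᵀ * A * X) W := by
  simp only [sqNorm, Matrix.transpose_mul, Matrix.mul_assoc]

theorem transpose_eq_self {G : Matrix (Fin d) (Fin d) ℝ} (hG : G.IsHermitian) : Gᵀ = G := by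
  rw [← Matrix.conjTranspose_eq_transpose_of_trivial]; exact hG

theorem sqNorm_eq_sum_eigenvalues {H : Matrix (Fin m) (Fin m) ℝ} (hH : H.IsHermitian)
    (V : Matrix (Fin m) (Fin p) ℝ) :
    sqNorm H V = ∑ l, hH.eigenvalues l *
      ∑ c, (Vᵀ *ᵥ (hH.eigenvectorBasis l).ofLp) c ^ 2 := by
  rw [sqNorm_eq_sum]
  simp only [dotProduct_mulVec_eq_sum_eigenvalues hH, Finset.mul_sum]
  rw [Finset.sum_comm]
  refine Finset.sum_congr rfl fun l _ => Finset.sum_congr rfl fun c _ => ?_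
  have : (Vᵀ *ᵥ (hH.eigenvectorBasis l).ofLp) c =
      (hH.eigenvectorBasis l).ofLp ⬝ᵥ fun k => V k c := by
    rw [dotProduct_comm]; rfl
  rw [this]
  ring

variable {G : Matrix (Fin d) (Fin d) ℝ} {R : Matrix (Fin m) (Fin d) ℝ}

/-- Normal equations of the sketched problem. -/
theorem sketch_normal_equation (hH : (sketchedCov G R).PosDef) (W : Matrix (Fin d) (Fin p) ℝ)
    (V : Matrix (Fin m) (Fin p) ℝ) :
    R * G * (Rᵀ * V - W) = sketchedCov G R * (V - optSketched G R W) := by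
  have hu := (Matrix.isUnit_iff_isUnit_det _).1 hH.isUnit
  rw [Matrix.mul_sub, Matrix.mul_sub, optSketched, ← Matrix.mul_assoc, ← Matrix.mul_assoc,
    ← Matrix.mul_assoc, ← Matrix.mul_assoc, Matrix.mul_nonsing_inv _ hu, Matrix.one_mul]
  rfl

theorem sqNorm_add {G : Matrix (Fin d) (Fin d) ℝ} (hG : G.IsHermitian)
    (X Y : Matrix (Fin d) (Fin p) ℝ) (h : Xᵀ * G * Y = 0) :
    sqNorm G (X + Y) = sqNorm G X + sqNorm G Y := by
  have h2 : Yᵀ * G * X = 0 := by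
    have := congrArg Matrix.transpose h
    rwa [Matrix.transpose_mul, Matrix.transpose_mul, Matrix.transpose_transpose,
      transpose_eq_self hG, Matrix.transpose_zero, ← Matrix.mul_assoc] at this
  simp only [sqNorm, Matrix.transpose_add, Matrix.add_mul, Matrix.mul_add, h, h2, Matrix.trace_add,
    Matrix.trace_zero]
  ring

/-- The normal equations say that the residual of `optSketched` is `G`-orthogonal to the range of
`Rᵀ`. -/
theorem sketch_pythagoras (hG : G.IsHermitian) (hH : (sketchedCov G R).PosDef)
    (W : Matrix (Fin d) (Fin p) ℝ) (V : Matrix (Fin m) (Fin p) ℝ) :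
    sqNorm G (Rᵀ * V - W) = sqNorm G (Rᵀ * optSketched G R W - W) +
      sqNorm (sketchedCov G R) (V - optSketched G R W) := by
  have h1 : Rᵀ * V - W = Rᵀ * (V - optSketched G R W) + (Rᵀ * optSketched G R W - W) := by
    rw [Matrix.mul_sub]; abel
  have h2 := sketch_normal_equation hH W (optSketched G R W)
  rw [sub_self, Matrix.mul_zero] at h2
  rw [h1, sqNorm_add hG, add_comm]
  · congr 1
    rw [sqNorm_mul, Matrix.transpose_transpose]
    rfl
  · rw [Matrix.transpose_mul, Matrix.transpose_transpose, Matrix.mul_assoc, Matrix.mul_assoc,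
      ← Matrix.mul_assoc R, h2, Matrix.mul_zero]

theorem sqNorm_neg (A : Matrix (Fin m) (Fin m) ℝ) (V : Matrix (Fin m) (Fin p) ℝ) :
    sqNorm A (-V) = sqNorm A V := by
  simp [sqNorm]

/-- Pythagoras at `V = 0`. It merges the approximation error and the initial excess of SGD into
`‖W‖_G²`, whose prior mean is `tr G`. -/
theorem sqNorm_eq_approx_add (hG : G.IsHermitian) (hH : (sketchedCov G R).PosDef)
    (W : Matrix (Fin d) (Fin p) ℝ) :
    sqNorm G W = sqNorm G (Rᵀ * optSketched G R W - W) +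
      sqNorm (sketchedCov G R) (optSketched G R W) := by
  have h := sketch_pythagoras hG hH W 0
  rwa [Matrix.mul_zero, zero_sub, zero_sub, sqNorm_neg, sqNorm_neg] at h

theorem transpose_mulVec_dotProduct_mulVec (R : Matrix (Fin m) (Fin d) ℝ)
    (G : Matrix (Fin d) (Fin d) ℝ) (q : Fin m → ℝ) (x : Fin d → ℝ) :
    (Rᵀ *ᵥ q) ⬝ᵥ G *ᵥ x = q ⬝ᵥ (R * G) *ᵥ x := by
  rw [Matrix.mulVec_transpose, ← Matrix.dotProduct_mulVec, Matrix.mulVec_mulVec]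

/-- This is the covariance of the feature in direction `q_l` with the signal residual. Being a
multiple of the `l`-th error coordinate alone, it lets the second moment recursion close in the
eigenbasis. -/
theorem eigen_cross_term (hH : (sketchedCov G R).PosDef) (W : Matrix (Fin d) (Fin p) ℝ)
    (V : Matrix (Fin m) (Fin p) ℝ) (l : Fin m) (c : Fin p) :
    (Rᵀ *ᵥ (hH.1.eigenvectorBasis l).ofLp) ⬝ᵥ G *ᵥ (fun k => (Rᵀ * V - W) k c) =
      hH.1.eigenvalues l *
        ((V - optSketched G R W)ᵀ *ᵥ (hH.1.eigenvectorBasis l).ofLp) c := by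
  have h1 : (R * G) *ᵥ (fun k => (Rᵀ * V - W) k c) =
      sketchedCov G R *ᵥ fun k => (V - optSketched G R W) k c := by
    have h2 := sketch_normal_equation hH W V
    ext i
    exact congrFun (congrFun h2 i) c
  rw [transpose_mulVec_dotProduct_mulVec, h1, dotProduct_mulVec_comm hH.1,
    hH.1.mulVec_eigenvectorBasis, dotProduct_smul, smul_eq_mul]
  rfl

theorem eigen_square_term (hH : (sketchedCov G R).PosDef) (l : Fin m) :
    (Rᵀ *ᵥ (hH.1.eigenvectorBasis l).ofLp) ⬝ᵥ G *ᵥ (Rᵀ *ᵥ (hH.1.eigenvectorBasis l).ofLp) =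
      hH.1.eigenvalues l := by
  rw [transpose_mulVec_dotProduct_mulVec, Matrix.mulVec_mulVec]
  change _ ⬝ᵥ sketchedCov G R *ᵥ _ = _
  rw [hH.1.mulVec_eigenvectorBasis, dotProduct_smul, ← inner_eq_dotProduct,
    real_inner_self_eq_norm_sq, (hH.1.eigenvectorBasis).orthonormal.1 l]
  simp

end Algebra

/-! ### Risk formulas and the expected effect of one SGD step. -/

section Risk

open scoped NNReal ENNReal

variable {m d p : ℕ} {P : Measure (Example d p)}
  {G : Matrix (Fin d) (Fin d) ℝ} {W : Matrix (Fin d) (Fin p) ℝ} {σ : ℝ}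

theorem GaussianWellSpecified.integral_sq_sub_noise [IsProbabilityMeasure P]
    (h : GaussianWellSpecified P G W σ)
    (hG : G.PosSemidef) (u : Fin d → ℝ) (c : Fin p) :
    Integrable (fun z : Example d p => (u ⬝ᵥ z.1.ofLp - noise W z c) ^ 2) P ∧
    ∫ z, (u ⬝ᵥ z.1.ofLp - noise W z c) ^ 2 ∂P = u ⬝ᵥ G *ᵥ u + ∫ z, noise W z c ^ 2 ∂P := by
  have hu := h.memLp_dotProduct hG u 2
  have hm : Measurable fun x : EuclideanSpace ℝ (Fin d) => u ⬝ᵥ x.ofLp := by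
    simp only [dotProduct]; fun_prop
  have h1 := h.integral_mul_noise hG hm hu c
  have i1 : Integrable (fun z : Example d p => (u ⬝ᵥ z.1.ofLp) ^ 2) P := hu.integrable_sq
  have i2 : Integrable (fun z : Example d p => noise W z c ^ 2) P :=
    (h.memLp_noise hG c).integrable_sq
  have he : (fun z : Example d p => (u ⬝ᵥ z.1.ofLp - noise W z c) ^ 2) =
      (fun z : Example d p => (u ⬝ᵥ z.1.ofLp) ^ 2) +
        (fun z : Example d p => noise W z c ^ 2) -
        (fun z : Example d p => 2 * (u ⬝ᵥ z.1.ofLp * noise W z c)) := by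
    funext z
    simp only [Pi.add_apply, Pi.sub_apply]
    ring
  rw [he]
  refine ⟨(i1.add i2).sub (h1.1.const_mul 2), ?_⟩
  rw [integral_sub' (i1.add i2) (h1.1.const_mul 2), integral_add' i1 i2, integral_const_mul, h1.2,
    h.integral_sq hG]
  ring

theorem GaussianWellSpecified.sum_integral_noise (h : GaussianWellSpecified P G W σ)
    (hG : G.PosSemidef) : ∑ c, ∫ z, noise W z c ^ 2 ∂P = σ ^ 2 := by
  rw [← h.noise_eq]
  simp only [sq_norm_sub_predict]
  rw [integral_finsetSum]
  exact fun c _ => (h.memLp_noise hG c).integrable_sq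

/-- The noise is uncorrelated with linear forms of the features, so no cross term survives; all risk
minimization becomes geometry in the `G`-norm. -/
theorem GaussianWellSpecified.risk_eq [IsProbabilityMeasure P]
    (h : GaussianWellSpecified P G W σ)
    (hG : G.PosSemidef) (W' : Matrix (Fin d) (Fin p) ℝ) :
    risk P W' = σ ^ 2 + sqNorm G (W' - W) := by
  have h1 : ∀ z : Example d p, ‖predict W' z.1 - z.2‖ ^ 2 =
      ∑ c, ((fun k => (W' - W) k c) ⬝ᵥ z.1.ofLp - noise W z c) ^ 2 := by
    intro z
    rw [EuclideanSpace.real_norm_sq_eq]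
    refine Finset.sum_congr rfl fun c _ => ?_
    congr 1
    have h2 : (fun k => (W' - W) k c) = (fun k => W' k c) - fun k => W k c := rfl
    rw [h2, sub_dotProduct, PiLp.sub_apply, predict_apply, noise]
    ring
  rw [risk]
  simp only [h1]
  rw [integral_finsetSum _ fun c _ => (h.integral_sq_sub_noise hG _ c).1]
  simp only [(h.integral_sq_sub_noise hG _ _).2]
  rw [Finset.sum_add_distrib, h.sum_integral_noise hG, sqNorm_eq_sum, add_comm]

theorem GaussianWellSpecified.irredError_eq [IsProbabilityMeasure P]
    (h : GaussianWellSpecified P G W σ)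
    (hG : G.PosSemidef) : irredError P = σ ^ 2 := by
  have hr := h.risk_eq hG
  have hle : ∀ W', σ ^ 2 ≤ risk P W' := fun W' => by
    rw [hr]; linarith [sqNorm_nonneg hG (W' - W)]
  refine le_antisymm ?_ (le_ciInf hle)
  refine (ciInf_le ⟨σ ^ 2, by rintro _ ⟨W', rfl⟩; exact hle W'⟩ W).trans (le_of_eq ?_)
  rw [hr, sub_self]
  simp [sqNorm]

variable {R : Matrix (Fin m) (Fin d) ℝ}

theorem GaussianWellSpecified.iInf_sketchedRisk [IsProbabilityMeasure P]
    (h : GaussianWellSpecified P G W σ)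
    (hG : G.PosSemidef) (hH : (sketchedCov G R).PosDef) :
    ⨅ V : Matrix (Fin m) (Fin p) ℝ, sketchedRisk P R V =
      σ ^ 2 + sqNorm G (Rᵀ * optSketched G R W - W) := by
  have hr : ∀ V : Matrix (Fin m) (Fin p) ℝ, sketchedRisk P R V =
      σ ^ 2 + (sqNorm G (Rᵀ * optSketched G R W - W) +
        sqNorm (sketchedCov G R) (V - optSketched G R W)) := fun V => by
    rw [sketchedRisk, h.risk_eq hG, sketch_pythagoras hG.1 hH]
  have hle : ∀ V : Matrix (Fin m) (Fin p) ℝ,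
      σ ^ 2 + sqNorm G (Rᵀ * optSketched G R W - W) ≤ sketchedRisk P R V := fun V => by
    rw [hr]; linarith [sqNorm_nonneg hH.posSemidef (V - optSketched G R W)]
  refine le_antisymm ?_ (le_ciInf hle)
  refine (ciInf_le ⟨_, by rintro _ ⟨V, rfl⟩; exact hle V⟩ (optSketched G R W)).trans (le_of_eq ?_)
  rw [hr, sub_self]
  simp [sqNorm]

theorem GaussianWellSpecified.approxError_eq [IsProbabilityMeasure P]
    (h : GaussianWellSpecified P G W σ)
    (hG : G.PosSemidef) (hH : (sketchedCov G R).PosDef) :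
    approxError P R = sqNorm G (Rᵀ * optSketched G R W - W) := by
  rw [approxError, h.iInf_sketchedRisk hG hH, h.irredError_eq hG]; ring

theorem GaussianWellSpecified.excessError_eq [IsProbabilityMeasure P]
    (h : GaussianWellSpecified P G W σ)
    (hG : G.PosSemidef) (hH : (sketchedCov G R).PosDef) (V : Matrix (Fin m) (Fin p) ℝ) :
    excessError P R V = sqNorm (sketchedCov G R) (V - optSketched G R W) := by
  rw [excessError, h.iInf_sketchedRisk hG hH, sketchedRisk, h.risk_eq hG,
    sketch_pythagoras hG.1 hH]
  ring

/-- Expected effect of one step of SGD on one coordinate. -/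
theorem GaussianWellSpecified.integral_sgd_coordinate [IsProbabilityMeasure P]
    (h : GaussianWellSpecified P G W σ)
    (hG : G.PosSemidef) (u v : Fin d → ℝ) (w η : ℝ) (c : Fin p)
    (hN : Integrable (fun z : Example d p => noise W z c ^ 2 * (u ⬝ᵥ z.1.ofLp) ^ 2) P) :
    Integrable (fun z : Example d p =>
      (w - η * (u ⬝ᵥ z.1.ofLp) * (v ⬝ᵥ z.1.ofLp - noise W z c)) ^ 2) P ∧
    ∫ z, (w - η * (u ⬝ᵥ z.1.ofLp) * (v ⬝ᵥ z.1.ofLp - noise W z c)) ^ 2 ∂P =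
      w ^ 2 - 2 * η * w * (u ⬝ᵥ G *ᵥ v) +
      η ^ 2 * ((u ⬝ᵥ G *ᵥ u) * (v ⬝ᵥ G *ᵥ v) + 2 * (u ⬝ᵥ G *ᵥ v) ^ 2 +
        ∫ z, noise W z c ^ 2 * (u ⬝ᵥ z.1.ofLp) ^ 2 ∂P) := by
  have hmu : Measurable fun x : EuclideanSpace ℝ (Fin d) => u ⬝ᵥ x.ofLp := by
    simp only [dotProduct]; fun_prop
  have hmv : Measurable fun x : EuclideanSpace ℝ (Fin d) => v ⬝ᵥ x.ofLp := by
    simp only [dotProduct]; fun_prop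
  have hu := h.memLp_dotProduct hG u 2
  have hv := h.memLp_dotProduct hG v 2
  have h1 := h.integral_mul_noise hG hmu hu c
  -- Sixth moments put `(u·x)² (v·x)` in `L²`, so the noise is orthogonal to this cubic function as
  -- well.
  have h6 : ∀ u : Fin d → ℝ, Integrable (fun z : Example d p => (u ⬝ᵥ z.1.ofLp) ^ 6) P := fun u => by
    have h1 := (h.memLp_dotProduct hG u 6).integrable_norm_pow (by norm_num)
    refine h1.congr (ae_of_all _ fun z => ?_)
    simp only [Real.norm_eq_abs]
    exact Even.pow_abs (by decide) _
  have hmuv : Measurable fun x : EuclideanSpace ℝ (Fin d) => (u ⬝ᵥ x.ofLp) ^ 2 * (v ⬝ᵥ x.ofLp) :=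
    (hmu.pow_const 2).mul hmv
  have huv : MemLp (fun z : Example d p => (u ⬝ᵥ z.1.ofLp) ^ 2 * (v ⬝ᵥ z.1.ofLp)) 2 P := by
    have hmm : Measurable fun z : Example d p => (u ⬝ᵥ z.1.ofLp) ^ 2 * (v ⬝ᵥ z.1.ofLp) :=
      hmuv.comp measurable_fst
    rw [memLp_two_iff_integrable_sq hmm.aestronglyMeasurable]
    refine ((h6 u).add (h6 v)).mono (hmm.pow_const 2).aestronglyMeasurable (ae_of_all _ fun z => ?_)
    set a := u ⬝ᵥ z.1.ofLp
    set b := v ⬝ᵥ z.1.ofLp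
    have ha : 0 ≤ a ^ 2 := sq_nonneg a
    have hb : 0 ≤ b ^ 2 := sq_nonneg b
    rw [Pi.add_apply, Real.norm_of_nonneg (sq_nonneg _), Real.norm_of_nonneg (by positivity)]
    rcases le_total (a ^ 2) (b ^ 2) with hab | hab
    · have : (a ^ 2) ^ 2 * b ^ 2 ≤ (b ^ 2) ^ 2 * b ^ 2 := by gcongr
      have : 0 ≤ (a ^ 2) ^ 3 := by positivity
      nlinarith
    · have : (a ^ 2) ^ 2 * b ^ 2 ≤ (a ^ 2) ^ 2 * a ^ 2 := by gcongr
      have : 0 ≤ (b ^ 2) ^ 3 := by positivity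
      nlinarith
  have h2 := h.integral_mul_noise hG hmuv huv c
  have iuv : Integrable (fun z : Example d p => (u ⬝ᵥ z.1.ofLp) * (v ⬝ᵥ z.1.ofLp)) P :=
    hu.integrable_mul (p := (2 : ℝ≥0∞)) (q := (2 : ℝ≥0∞)) hv
  have i4 := h.integrable_sq_mul_sq hG u v
  -- Terms of the expanded square. `f3` and `f5`, linear in the noise, integrate to zero; `f4` is
  -- evaluated by Wick's formula.
  let f1 : Example d p → ℝ := fun z => w ^ 2
  let f2 : Example d p → ℝ := fun z => 2 * η * w * ((u ⬝ᵥ z.1.ofLp) * (v ⬝ᵥ z.1.ofLp))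
  let f3 : Example d p → ℝ := fun z => 2 * η * w * ((u ⬝ᵥ z.1.ofLp) * noise W z c)
  let f4 : Example d p → ℝ := fun z => η ^ 2 * ((u ⬝ᵥ z.1.ofLp) ^ 2 * (v ⬝ᵥ z.1.ofLp) ^ 2)
  let f5 : Example d p → ℝ := fun z =>
    2 * η ^ 2 * ((u ⬝ᵥ z.1.ofLp) ^ 2 * (v ⬝ᵥ z.1.ofLp) * noise W z c)
  let f6 : Example d p → ℝ := fun z => η ^ 2 * (noise W z c ^ 2 * (u ⬝ᵥ z.1.ofLp) ^ 2)
  have j1 : Integrable f1 P := integrable_const _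
  have j2 : Integrable f2 P := iuv.const_mul _
  have j3 : Integrable f3 P := h1.1.const_mul _
  have j4 : Integrable f4 P := i4.const_mul _
  have j5 : Integrable f5 P := h2.1.const_mul _
  have j6 : Integrable f6 P := hN.const_mul _
  have he : (fun z : Example d p =>
      (w - η * (u ⬝ᵥ z.1.ofLp) * (v ⬝ᵥ z.1.ofLp - noise W z c)) ^ 2) =
      f1 - f2 + f3 + f4 - f5 + f6 := by
    funext z
    simp only [f1, f2, f3, f4, f5, f6, Pi.add_apply, Pi.sub_apply]
    ring
  rw [he]
  refine ⟨((((j1.sub j2).add j3).add j4).sub j5).add j6, ?_⟩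
  rw [integral_add' ((((j1.sub j2).add j3).add j4).sub j5) j6,
    integral_sub' (((j1.sub j2).add j3).add j4) j5, integral_add' ((j1.sub j2).add j3) j4,
    integral_add' (j1.sub j2) j3, integral_sub' j1 j2]
  simp only [f1, f2, f3, f4, f5, f6]
  rw [integral_const_mul, integral_const_mul, integral_const_mul, integral_const_mul,
    integral_const_mul, h1.2, h2.2, h.integral_mul hG, h.integral_sq_mul_sq hG]
  simp
  ring

/-- One step of SGD from `V` on the example `z`. -/
noncomputable def sgdStep (R : Matrix (Fin m) (Fin d) ℝ) (η : ℝ) (V : Matrix (Fin m) (Fin p) ℝ)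
    (z : Example d p) : Matrix (Fin m) (Fin p) ℝ :=
  V - η • Matrix.vecMulVec (R *ᵥ z.1.ofLp) (Vᵀ *ᵥ (R *ᵥ z.1.ofLp) - z.2.ofLp)

/-- Squared error of `V` in the `l`-th eigendirection of the sketched covariance. -/
noncomputable def eigenError (hH : (sketchedCov G R).PosDef) (W : Matrix (Fin d) (Fin p) ℝ)
    (V : Matrix (Fin m) (Fin p) ℝ) (l : Fin m) : ℝ :=
  ∑ c, ((V - optSketched G R W)ᵀ *ᵥ (hH.1.eigenvectorBasis l).ofLp) c ^ 2

theorem eigenError_nonneg (hH : (sketchedCov G R).PosDef) (W : Matrix (Fin d) (Fin p) ℝ)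
    (V : Matrix (Fin m) (Fin p) ℝ) (l : Fin m) : 0 ≤ eigenError hH W V l :=
  Finset.sum_nonneg fun _ _ => sq_nonneg _

/-- Expected effect of one step of SGD on the squared error in an eigendirection. -/
theorem GaussianWellSpecified.integral_eigenError_step [IsProbabilityMeasure P]
    (h : GaussianWellSpecified P G W σ)
    (hG : G.PosSemidef) (hH : (sketchedCov G R).PosDef) (V : Matrix (Fin m) (Fin p) ℝ) (η : ℝ)
    (l : Fin m)
    (hN : Integrable (fun z : Example d p => ‖z.2 - predict W z.1‖ ^ 2 *
      ((Rᵀ *ᵥ (hH.1.eigenvectorBasis l).ofLp) ⬝ᵥ z.1.ofLp) ^ 2) P) :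
    Integrable (fun z => eigenError hH W (sgdStep R η V z) l) P ∧
    ∫ z, eigenError hH W (sgdStep R η V z) l ∂P =
      (1 - 2 * (η * hH.1.eigenvalues l) + 2 * (η * hH.1.eigenvalues l) ^ 2) *
        eigenError hH W V l +
      η ^ 2 * hH.1.eigenvalues l * (sqNorm G (Rᵀ * optSketched G R W - W) +
        ∑ j, hH.1.eigenvalues j * eigenError hH W V j) +
      η ^ 2 * ∫ z, ‖z.2 - predict W z.1‖ ^ 2 *
        ((Rᵀ *ᵥ (hH.1.eigenvectorBasis l).ofLp) ⬝ᵥ z.1.ofLp) ^ 2 ∂P := by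
  set q := (hH.1.eigenvectorBasis l).ofLp with hq
  set lam := hH.1.eigenvalues l with hlam
  set w := (V - optSketched G R W)ᵀ *ᵥ q with hw
  have he : ∀ z : Example d p, eigenError hH W (sgdStep R η V z) l = ∑ c,
      (w c - η * ((Rᵀ *ᵥ q) ⬝ᵥ z.1.ofLp) *
        ((fun k => (Rᵀ * V - W) k c) ⬝ᵥ z.1.ofLp - noise W z c)) ^ 2 := by
    intro z
    refine Finset.sum_congr rfl fun c _ => ?_
    congr 1
    have h1 : sgdStep R η V z - optSketched G R W = (V - optSketched G R W) -
        η • Matrix.vecMulVec (R *ᵥ z.1.ofLp) (Vᵀ *ᵥ (R *ᵥ z.1.ofLp) - z.2.ofLp) := by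
      rw [sgdStep]; abel
    have h2 : (Rᵀ *ᵥ q) ⬝ᵥ z.1.ofLp = (R *ᵥ z.1.ofLp) ⬝ᵥ q := by
      rw [Matrix.mulVec_transpose, ← Matrix.dotProduct_mulVec, dotProduct_comm]
    have h3 : (Vᵀ *ᵥ (R *ᵥ z.1.ofLp) - z.2.ofLp) c =
        (fun k => (Rᵀ * V - W) k c) ⬝ᵥ z.1.ofLp - noise W z c := by
      have h4 : (fun k => (Rᵀ * V - W) k c) = (fun k => (Rᵀ * V) k c) - fun k => W k c := rfl
      have h5 : (Vᵀ *ᵥ (R *ᵥ z.1.ofLp)) c = (fun k => (Rᵀ * V) k c) ⬝ᵥ z.1.ofLp := by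
        rw [Matrix.mulVec_mulVec, ← Matrix.transpose_transpose R, ← Matrix.transpose_mul,
          Matrix.transpose_transpose]
        rfl
      rw [Pi.sub_apply, h5, h4, sub_dotProduct, noise]
      ring
    rw [h1, Matrix.transpose_sub, Matrix.sub_mulVec, Pi.sub_apply, ← hq, ← hw, h2, ← h3,
      Matrix.transpose_smul, Matrix.transpose_vecMulVec, Matrix.smul_mulVec,
      Matrix.vecMulVec_mulVec]
    simp only [Pi.smul_apply, smul_eq_mul, MulOpposite.smul_eq_mul_unop, MulOpposite.unop_op]
    ring
  have hNc : ∀ c, Integrable (fun z : Example d p =>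
      noise W z c ^ 2 * ((Rᵀ *ᵥ q) ⬝ᵥ z.1.ofLp) ^ 2) P := by
    intro c
    have hm : Measurable fun z : Example d p => noise W z c ^ 2 * ((Rᵀ *ᵥ q) ⬝ᵥ z.1.ofLp) ^ 2 := by
      have := measurable_noise W c
      simp only [dotProduct]
      fun_prop
    refine hN.mono hm.aestronglyMeasurable (ae_of_all _ fun z => ?_)
    rw [sq_norm_sub_predict, Real.norm_of_nonneg (by positivity), Real.norm_of_nonneg (by positivity)]
    gcongr
    exact Finset.single_le_sum (f := fun c => noise W z c ^ 2) (fun c _ => sq_nonneg _)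
      (Finset.mem_univ c)
  have hstep := fun c => h.integral_sgd_coordinate hG (Rᵀ *ᵥ q) (fun k => (Rᵀ * V - W) k c) (w c) η c
    (hNc c)
  simp only [he]
  refine ⟨integrable_finsetSum _ fun c _ => (hstep c).1, ?_⟩
  rw [integral_finsetSum _ fun c _ => (hstep c).1]
  simp only [(hstep _).2]
  have hNs : ∫ z, ‖z.2 - predict W z.1‖ ^ 2 * ((Rᵀ *ᵥ q) ⬝ᵥ z.1.ofLp) ^ 2 ∂P =
      ∑ c, ∫ z, noise W z c ^ 2 * ((Rᵀ *ᵥ q) ⬝ᵥ z.1.ofLp) ^ 2 ∂P := by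
    rw [← integral_finsetSum _ fun c _ => hNc c]
    simp only [sq_norm_sub_predict, Finset.sum_mul]
  -- The signal risk in Wick's formula splits by Pythagoras into a constant and the
  -- eigenvalue-weighted sum of all squared errors, which couples the eigendirections.
  have hS : ∑ c, (fun k => (Rᵀ * V - W) k c) ⬝ᵥ G *ᵥ (fun k => (Rᵀ * V - W) k c) =
      sqNorm G (Rᵀ * optSketched G R W - W) + ∑ j, hH.1.eigenvalues j * eigenError hH W V j := by
    rw [← sqNorm_eq_sum, sketch_pythagoras hG.1 hH, sqNorm_eq_sum_eigenvalues hH.1]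
    rfl
  rw [hNs, ← hS]
  simp only [hq, eigen_cross_term hH, eigen_square_term hH]
  rw [← hq, ← hw, ← hlam]
  have hE : eigenError hH W V l = ∑ c, w c ^ 2 := rfl
  rw [hE]
  simp only [Finset.mul_sum, ← Finset.sum_add_distrib]
  refine Finset.sum_congr rfl fun c _ => ?_
  ring

end Risk

end SketchedRegression

namespace SketchedRegression

/-! ### The exact second moment recursion along the SGD trajectory. -/

section Run

variable {m d p : ℕ}

/-- One-pass SGD with an arbitrary sequence of stepsizes. -/
noncomputable def sgdRun (R : Matrix (Fin m) (Fin d) ℝ) (η : ℕ → ℝ) :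
    (k : ℕ) → (Fin k → Example d p) → Matrix (Fin m) (Fin p) ℝ
  | 0, _ => 0
  | k + 1, D => sgdStep R (η k) (sgdRun R η k fun i => D i.castSucc) (D (Fin.last k))

/-- `sgdRun` peels off the last sample and keeps its stepsizes independent of the number of samples,
which suits induction over product measures. -/
theorem sgdOutput_eq_sgdRun {n : ℕ} (R : Matrix (Fin m) (Fin d) ℝ) (γ : ℝ)
    (D : Fin n → Example d p) :
    sgdOutput R γ D = sgdRun R (fun t => stepSize γ n (t + 1)) n D := by
  have key : ∀ (k : ℕ) (hk : k ≤ n), sgdIterate R γ D ⟨k, Nat.lt_succ_of_le hk⟩ =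
      sgdRun R (fun t => stepSize γ n (t + 1)) k fun i => D (Fin.castLE hk i) := by
    intro k
    induction k with
    | zero => intro _; rfl
    | succ k ih =>
      intro hk
      have h1 : (⟨k + 1, Nat.lt_succ_of_le hk⟩ : Fin (n + 1)) = Fin.succ ⟨k, hk⟩ := rfl
      rw [h1, sgdIterate, Fin.induction_succ]
      have h2 := ih (Nat.le_of_succ_le hk)
      rw [sgdIterate] at h2
      have h3 : (Fin.castSucc ⟨k, hk⟩ : Fin (n + 1)) =
        ⟨k, Nat.lt_succ_of_le (Nat.le_of_succ_le hk)⟩ := rfl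
      rw [h3, h2]
      rfl
  exact key n le_rfl

theorem continuous_sgdStep (R : Matrix (Fin m) (Fin d) ℝ) (η : ℝ) :
    Continuous fun q : Matrix (Fin m) (Fin p) ℝ × Example d p => sgdStep R η q.1 q.2 := by
  unfold sgdStep
  have h1 : Continuous fun q : Matrix (Fin m) (Fin p) ℝ × Example d p => R *ᵥ q.2.1.ofLp :=
    Continuous.matrix_mulVec continuous_const (by fun_prop)
  refine continuous_fst.sub (Continuous.const_smul (Continuous.matrix_vecMulVec h1 ?_) η)
  exact (Continuous.matrix_mulVec continuous_fst.matrix_transpose h1).sub (by fun_prop)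

theorem continuous_sgdRun (R : Matrix (Fin m) (Fin d) ℝ) (η : ℕ → ℝ) (k : ℕ) :
    Continuous fun D : Fin k → Example d p => sgdRun R η k D := by
  induction k with
  | zero => exact continuous_const
  | succ k ih =>
    have h1 : Continuous fun (D : Fin (k + 1) → Example d p) (i : Fin k) => D i.castSucc := by
      fun_prop
    exact (continuous_sgdStep R (η k)).comp ((ih.comp h1).prodMk (continuous_apply (Fin.last k)))

variable {P : Measure (Example d p)}
  {G : Matrix (Fin d) (Fin d) ℝ} {W : Matrix (Fin d) (Fin p) ℝ} {σ : ℝ}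
  {R : Matrix (Fin m) (Fin d) ℝ}

theorem continuous_eigenError_right (hH : (sketchedCov G R).PosDef) (W : Matrix (Fin d) (Fin p) ℝ)
    (l : Fin m) : Continuous fun V : Matrix (Fin m) (Fin p) ℝ => eigenError hH W V l := by
  unfold eigenError
  refine continuous_finsetSum _ fun c _ => Continuous.pow ?_ 2
  refine (continuous_apply c).comp (Continuous.matrix_mulVec ?_ continuous_const)
  exact (continuous_id.sub continuous_const).matrix_transpose

theorem continuous_eigenError_left (hH : (sketchedCov G R).PosDef) (V : Matrix (Fin m) (Fin p) ℝ)
    (l : Fin m) : Continuous fun W : Matrix (Fin d) (Fin p) ℝ => eigenError hH W V l := by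
  unfold eigenError optSketched
  refine continuous_finsetSum _ fun c _ => Continuous.pow ?_ 2
  refine (continuous_apply c).comp (Continuous.matrix_mulVec ?_ continuous_const)
  exact (continuous_const.sub (continuous_const.matrix_mul continuous_id)).matrix_transpose

/-- The one-step expectation is affine in the current squared errors, so averaging over earlier
samples simply replaces them by their means. -/
theorem integral_affine {Ω ι : Type*} [Fintype ι] [MeasurableSpace Ω] {μ : Measure Ω}
    [IsProbabilityMeasure μ] {e : ι → Ω → ℝ} (he : ∀ j, Integrable (e j) μ) (l : ι)
    (r s A c : ℝ) (lam : ι → ℝ) :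
    Integrable (fun D => r * e l D + s * (A + ∑ j, lam j * e j D) + c) μ ∧
    ∫ D, (r * e l D + s * (A + ∑ j, lam j * e j D) + c) ∂μ =
      r * ∫ D, e l D ∂μ + s * (A + ∑ j, lam j * ∫ D, e j D ∂μ) + c := by
  have i1 : Integrable (fun D => r * e l D) μ := (he l).const_mul _
  have i2 : Integrable (fun D => ∑ j, lam j * e j D) μ :=
    integrable_finsetSum _ fun j _ => (he j).const_mul _
  have i3 : Integrable (fun D => s * (A + ∑ j, lam j * e j D)) μ :=
    ((integrable_const _).add i2).const_mul _
  have i13 : Integrable (fun D => r * e l D + s * (A + ∑ j, lam j * e j D)) μ := i1.add i3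
  refine ⟨i13.add (integrable_const _), ?_⟩
  rw [integral_add i13 (integrable_const _), integral_add i1 i3, integral_const_mul,
    integral_const_mul, integral_add (integrable_const _) i2,
    integral_finsetSum _ fun j _ => (he j).const_mul _]
  simp only [integral_const_mul, integral_const, probReal_univ, one_smul]

/-- The exact recursion for the expected squared errors of SGD in the eigendirections. -/
theorem GaussianWellSpecified.integral_eigenError_sgdRun [IsProbabilityMeasure P]
    (h : GaussianWellSpecified P G W σ) (hG : G.PosSemidef) (hH : (sketchedCov G R).PosDef)
    (η : ℕ → ℝ)
    (hN : ∀ l, Integrable (fun z : Example d p => ‖z.2 - predict W z.1‖ ^ 2 *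
      ((Rᵀ *ᵥ (hH.1.eigenvectorBasis l).ofLp) ⬝ᵥ z.1.ofLp) ^ 2) P) (k : ℕ) :
    (∀ l, Integrable (fun D : Fin k → Example d p => eigenError hH W (sgdRun R η k D) l)
      (Measure.pi fun _ => P)) ∧
    ∀ l, ∫ D : Fin (k + 1) → Example d p, eigenError hH W (sgdRun R η (k + 1) D) l
        ∂(Measure.pi fun _ => P) =
      (1 - 2 * (η k * hH.1.eigenvalues l) + 2 * (η k * hH.1.eigenvalues l) ^ 2) *
        ∫ D : Fin k → Example d p, eigenError hH W (sgdRun R η k D) l ∂(Measure.pi fun _ => P) +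
      η k ^ 2 * hH.1.eigenvalues l * (sqNorm G (Rᵀ * optSketched G R W - W) +
        ∑ j, hH.1.eigenvalues j *
          ∫ D : Fin k → Example d p, eigenError hH W (sgdRun R η k D) j ∂(Measure.pi fun _ => P)) +
      η k ^ 2 * ∫ z, ‖z.2 - predict W z.1‖ ^ 2 *
        ((Rᵀ *ᵥ (hH.1.eigenvectorBasis l).ofLp) ⬝ᵥ z.1.ofLp) ^ 2 ∂P := by
  have hcE := fun l => continuous_eigenError_right hH W l
  have hstep := fun k l (D : Fin k → Example d p) =>
    h.integral_eigenError_step hG hH (sgdRun R η k D) (η k) l (hN l)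
  have hprod : ∀ k, (∀ l, Integrable (fun D : Fin k → Example d p =>
      eigenError hH W (sgdRun R η k D) l) (Measure.pi fun _ => P)) → ∀ l,
      Integrable (fun q : Example d p × (Fin k → Example d p) =>
        eigenError hH W (sgdStep R (η k) (sgdRun R η k q.2) q.1) l)
        (P.prod (Measure.pi fun _ => P)) := by
    intro k ih l
    have hc : Continuous fun q : Example d p × (Fin k → Example d p) =>
        eigenError hH W (sgdStep R (η k) (sgdRun R η k q.2) q.1) l := by
      have c1 : Continuous fun q : Example d p × (Fin k → Example d p) =>
          sgdStep R (η k) (sgdRun R η k q.2) q.1 :=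
        (continuous_sgdStep R (η k)).comp
          (((continuous_sgdRun R η k).comp continuous_snd).prodMk continuous_fst)
      exact (hcE l).comp c1
    have hm : Measurable fun q : Example d p × (Fin k → Example d p) =>
        eigenError hH W (sgdStep R (η k) (sgdRun R η k q.2) q.1) l := hc.measurable
    have hae : AEStronglyMeasurable (fun q : Example d p × (Fin k → Example d p) =>
        eigenError hH W (sgdStep R (η k) (sgdRun R η k q.2) q.1) l)
        (P.prod (Measure.pi fun _ => P)) := hm.aestronglyMeasurable
    -- Tonelli: the errors are nonnegative, so the inner integral of the norm is again the affine
    -- one-step expression, integrable by induction.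
    rw [integrable_prod_iff' hae]
    have hi : ∀ D : Fin k → Example d p,
        Integrable (fun z => eigenError hH W (sgdStep R (η k) (sgdRun R η k D) z) l) P :=
      fun D => (hstep k l D).1
    have hv : (fun D : Fin k → Example d p =>
        ∫ z, ‖eigenError hH W (sgdStep R (η k) (sgdRun R η k D) z) l‖ ∂P) = _ :=
      funext fun D => (integral_congr_ae (ae_of_all _ fun z =>
        Real.norm_of_nonneg (eigenError_nonneg hH W _ l))).trans (hstep k l D).2
    refine ⟨ae_of_all _ hi, ?_⟩
    change Integrable (fun D : Fin k → Example d p =>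
        ∫ z, ‖eigenError hH W (sgdStep R (η k) (sgdRun R η k D) z) l‖ ∂P) _
    rw [hv]
    exact (integral_affine (e := fun j (D : Fin k → Example d p) =>
      eigenError hH W (sgdRun R η k D) j) ih l _ _ _ _ _).1
  -- Splits off the last sample, which is independent of the iterate it updates.
  have hmp : ∀ k, MeasurePreserving
      (MeasurableEquiv.piFinSuccAbove (fun _ : Fin (k + 1) => Example d p) (Fin.last k))
      (Measure.pi fun _ : Fin (k + 1) => P) (P.prod (Measure.pi fun _ : Fin k => P)) :=
    fun k => measurePreserving_piFinSuccAbove (fun _ : Fin (k + 1) => P) (Fin.last k)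
  have hfun : ∀ k l, (fun D : Fin (k + 1) → Example d p => eigenError hH W (sgdRun R η (k + 1) D) l) =
      (fun q : Example d p × (Fin k → Example d p) =>
        eigenError hH W (sgdStep R (η k) (sgdRun R η k q.2) q.1) l) ∘
      (MeasurableEquiv.piFinSuccAbove (fun _ : Fin (k + 1) => Example d p) (Fin.last k)) := by
    intro k l
    funext D
    simp only [Function.comp_apply, sgdRun, MeasurableEquiv.piFinSuccAbove_apply,
      Fin.insertNthEquiv_symm_apply, Fin.removeNth_last]
    rfl
  have hint : ∀ k, ∀ l, Integrable (fun D : Fin k → Example d p =>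
      eigenError hH W (sgdRun R η k D) l) (Measure.pi fun _ => P) := by
    intro k
    induction k with
    | zero => intro l; exact integrable_const (eigenError hH W 0 l)
    | succ k ih =>
      intro l
      rw [hfun, (hmp k).integrable_comp_emb (MeasurableEquiv.measurableEmbedding _)]
      exact hprod k ih l
  refine ⟨hint k, fun l => ?_⟩
  have h1 : ∫ D : Fin (k + 1) → Example d p, eigenError hH W (sgdRun R η (k + 1) D) l
      ∂(Measure.pi fun _ => P) = ∫ q : Example d p × (Fin k → Example d p),
        eigenError hH W (sgdStep R (η k) (sgdRun R η k q.2) q.1) l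
        ∂(P.prod (Measure.pi fun _ => P)) := by
    rw [hfun]
    exact (hmp k).integral_comp (MeasurableEquiv.measurableEmbedding _)
      fun q : Example d p × (Fin k → Example d p) =>
        eigenError hH W (sgdStep R (η k) (sgdRun R η k q.2) q.1) l
  rw [h1, integral_prod_symm _ (hprod k (hint k) l)]
  have hv : (fun D : Fin k → Example d p =>
      ∫ z, eigenError hH W (sgdStep R (η k) (sgdRun R η k D) z) l ∂P) = _ :=
    funext fun D => (hstep k l D).2
  refine (congrArg (fun f : (Fin k → Example d p) → ℝ => ∫ D, f D ∂(Measure.pi fun _ : Fin k => P)) hv).trans ?_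
  exact (integral_affine (e := fun j (D : Fin k → Example d p) =>
    eigenError hH W (sgdRun R η k D) j) (hint k) l _ _ _ _ _).2

end Run

end SketchedRegression

namespace SketchedRegression

/-! ### Tail sums of a power law. -/

section PowerLaw

/-- With `q = x/(x+1)`, `log q ≤ q - 1` and `e^y ≥ 1 + y` give `q^{1-a} ≥ 1 + (a-1)/(x+1)`. The
right side telescopes, replacing an integral comparison. -/
theorem rpow_sub_rpow_add_one_ge {a x : ℝ} (ha : 1 < a) (hx : 0 < x) :
    (a - 1) * (x + 1) ^ (-a) ≤ x ^ (1 - a) - (x + 1) ^ (1 - a) := by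
  have hx1 : 0 < x + 1 := by linarith
  have hq : 0 < x / (x + 1) := div_pos hx hx1
  have h1 : 1 + (a - 1) / (x + 1) ≤ (x / (x + 1)) ^ (1 - a) := by
    rw [Real.rpow_def_of_pos hq]
    have h2 := Real.log_le_sub_one_of_pos hq
    have h3 : x / (x + 1) - 1 = -(1 / (x + 1)) := by field_simp; ring
    rw [h3] at h2
    have h4 := Real.add_one_le_exp (Real.log (x / (x + 1)) * (1 - a))
    have h5 : (a - 1) * (1 / (x + 1)) ≤ (a - 1) * -Real.log (x / (x + 1)) :=
      mul_le_mul_of_nonneg_left (by linarith) (by linarith)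
    have h6 : (a - 1) / (x + 1) = (a - 1) * (1 / (x + 1)) := by ring
    rw [h6]
    nlinarith
  have h7 : x ^ (1 - a) = (x / (x + 1)) ^ (1 - a) * (x + 1) ^ (1 - a) := by
    rw [← Real.mul_rpow hq.le hx1.le, div_mul_cancel₀ _ hx1.ne']
  have h8 : (x + 1) ^ (-a) = (x + 1) ^ (1 - a) / (x + 1) := by
    rw [show -a = (1 - a) - 1 by ring, Real.rpow_sub_one hx1.ne']
  have h9 := mul_le_mul_of_nonneg_right h1 (Real.rpow_pos_of_pos hx1 (1 - a)).le
  rw [h7, h8]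
  calc (a - 1) * ((x + 1) ^ (1 - a) / (x + 1))
      = (1 + (a - 1) / (x + 1)) * (x + 1) ^ (1 - a) - (x + 1) ^ (1 - a) := by ring
    _ ≤ _ := by linarith

theorem sum_range_rpow_le {a : ℝ} (ha : 1 < a) (k r : ℕ) :
    ∑ i ∈ Finset.range r, ((k : ℝ) + i + 1) ^ (-a) ≤
      (1 + 1 / (a - 1)) * ((k : ℝ) + 1) ^ (1 - a) := by
  have ha1 : 0 < a - 1 := by linarith
  -- The telescoping remainder is kept in the induction. With `r + 1` terms the base case is the
  -- first summand, bounded by `(k+1)^{-a} ≤ (k+1)^{1-a}`.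
  have key : ∑ i ∈ Finset.range (r + 1), ((k : ℝ) + i + 1) ^ (-a) ≤
      (1 + 1 / (a - 1)) * ((k : ℝ) + 1) ^ (1 - a) - 1 / (a - 1) * ((k : ℝ) + r + 1) ^ (1 - a) := by
    induction r with
    | zero =>
      have : ((k : ℝ) + 1) ^ (-a) ≤ ((k : ℝ) + 1) ^ (1 - a) :=
        Real.rpow_le_rpow_of_exponent_le (by linarith [Nat.cast_nonneg (α := ℝ) k]) (by linarith)
      simp only [zero_add, Finset.range_one, Finset.sum_singleton, Nat.cast_zero, add_zero]
      linarith
    | succ r ih =>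
      rw [Finset.sum_range_succ]
      have h := rpow_sub_rpow_add_one_ge ha (show 0 < (k : ℝ) + r + 1 by positivity)
      have h' := mul_le_mul_of_nonneg_left h (one_div_pos.2 ha1).le
      rw [← mul_assoc, one_div_mul_cancel ha1.ne', one_mul] at h'
      have e : (k : ℝ) + ((r + 1 : ℕ) : ℝ) + 1 = (k : ℝ) + r + 1 + 1 := by push_cast; ring
      rw [e]
      linarith
  have h0 : 0 ≤ 1 / (a - 1) * ((k : ℝ) + r + 1) ^ (1 - a) := by positivity
  have h1 := Finset.sum_le_sum_of_subset_of_nonneg (s := Finset.range r) (t := Finset.range (r + 1))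
    (f := fun i : ℕ => ((k : ℝ) + i + 1) ^ (-a)) (by simp) (fun i _ _ => by positivity)
  linarith

theorem sum_filter_rpow_le {a : ℝ} (ha : 1 < a) {d : ℕ} (ρ : Fin d ≃ Fin d) (k : ℕ) :
    ∑ j ∈ Finset.univ.filter (fun j => k ≤ (ρ j : ℕ)), (((ρ j : ℕ) : ℝ) + 1) ^ (-a) ≤
      (1 + 1 / (a - 1)) * ((k : ℝ) + 1) ^ (1 - a) := by
  rw [Finset.sum_filter,
    Equiv.sum_comp ρ fun i : Fin d => if k ≤ (i : ℕ) then (((i : ℕ) : ℝ) + 1) ^ (-a) else 0,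
    Fin.sum_univ_eq_sum_range fun i : ℕ => if k ≤ i then ((i : ℝ) + 1) ^ (-a) else 0,
    ← Finset.sum_filter]
  have h1 : (Finset.range d).filter (fun i => k ≤ i) = Finset.Ico k d := by
    ext i; simp [and_comm]
  rw [h1, Finset.sum_Ico_eq_sum_range]
  simpa using sum_range_rpow_le ha k (d - k)

variable {d : ℕ} {G : Matrix (Fin d) (Fin d) ℝ} {a b B : ℝ}

/-- `eigenvalues` is a reindexing of the sorted `eigenvalues₀`; `ρ j` is the zero-based rank of the
`j`-th eigenvalue. -/
theorem PowerLawSpectrum.exists_equiv {hG : G.IsHermitian} (h : PowerLawSpectrum hG a b B) :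
    ∃ ρ : Fin d ≃ Fin d, ∀ j, b * (((ρ j : ℕ) : ℝ) + 1) ^ (-a) ≤ hG.eigenvalues j ∧
      hG.eigenvalues j ≤ B * (((ρ j : ℕ) : ℝ) + 1) ^ (-a) := by
  refine ⟨(Fintype.equivOfCardEq (Fintype.card_fin _)).symm.trans
    (finCongr (Fintype.card_fin d)), fun j => ?_⟩
  exact h ((Fintype.equivOfCardEq (Fintype.card_fin _)).symm j)

end PowerLaw

/-! ### From Gaussian columns to the sketch of a general covariance. -/

section Transfer

variable {m d : ℕ} {G : Matrix (Fin d) (Fin d) ℝ}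

theorem gram_map (Λ : Fin d → ℝ) (A : Fin d → Fin d → ℝ) (R : Matrix (Fin m) (Fin d) ℝ) :
    gram Λ (fun j => R *ᵥ A j) = R * gram Λ A * Rᵀ := by
  simp only [gram, Matrix.mul_sum, Matrix.sum_mul, Matrix.mul_smul, Matrix.smul_mul,
    Matrix.mul_vecMulVec, Matrix.vecMulVec_mul, Matrix.vecMul_transpose]

theorem sketchedCov_eq_gram (hG : G.IsHermitian) (R : Matrix (Fin m) (Fin d) ℝ) :
    sketchedCov G R =
      gram hG.eigenvalues fun j => R *ᵥ (hG.eigenvectorBasis j).ofLp := by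
  rw [gram_map, ← eq_gram_eigenvectorBasis hG, sketchedCov]

theorem exists_eigenvector_matrix (hG : G.IsHermitian) :
    ∃ U : Matrix (Fin d) (Fin d) ℝ, U * Uᵀ = 1 ∧
      ∀ j, (fun k => U k j) = (hG.eigenvectorBasis j).ofLp := by
  refine ⟨hG.eigenvectorUnitary, ?_, fun j => rfl⟩
  have h := Unitary.coe_mul_star_self hG.eigenvectorUnitary
  rwa [Unitary.coe_star, Matrix.star_eq_conjTranspose,
    Matrix.conjTranspose_eq_transpose_of_trivial] at h

theorem trace_eq_sum_eigenvectorBasis (hG : G.IsHermitian) (M : Matrix (Fin d) (Fin d) ℝ) :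
    M.trace = ∑ j, (hG.eigenvectorBasis j).ofLp ⬝ᵥ M *ᵥ (hG.eigenvectorBasis j).ofLp := by
  obtain ⟨U, hU, hUu⟩ := exists_eigenvector_matrix hG
  rw [← Matrix.mul_one M, ← hU, ← Matrix.mul_assoc, Matrix.trace_mul_comm, ← Matrix.mul_assoc]
  refine Finset.sum_congr rfl fun j _ => ?_
  rw [← hUu, Matrix.diag_apply, Matrix.mul_assoc, Matrix.mul_assoc, hU, Matrix.mul_one]
  rfl

/-- With overwhelming probability the Gaussian sketch is non-degenerate, has bounded trace, and
captures all but the tail of the spectrum. -/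
theorem sketch_good_event (hm : 1 ≤ m) (hmd : m ≤ d) (hG : G.IsHermitian)
    (hΛ : ∀ j, 0 < hG.eigenvalues j) (J : Finset (Fin d)) (hJ : 4 * J.card ≤ m) :
    sketchLaw m d {R | ¬ ((sketchedCov G R).PosDef ∧
        (sketchedCov G R).trace ≤ 10 * ∑ j, hG.eigenvalues j ∧
        ∑ j, hG.eigenvalues j * (1 - leverage hG.eigenvalues
          (fun j => R *ᵥ (hG.eigenvectorBasis j).ofLp) j) ≤
            50 * Real.exp 16 * ∑ j ∈ Jᶜ, hG.eigenvalues j)} ≤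
      ENNReal.ofReal (Real.exp (-(1 / 2 * m))) := by
  obtain ⟨U, hU, hUu⟩ := exists_eigenvector_matrix hG
  -- Rotating into the eigenbasis of `G` and transposing sends `R` to its columns `R u_j`, which are
  -- again independent isotropic Gaussians.
  have hT := (measurePreserving_swap_sketchLaw m d (1 / (m : NNReal))).comp
    (measurePreserving_mul_sketchLaw (m := m) U hU)
  refine le_trans ?_ (sketch_columns_good_event hm hmd hΛ J hJ)
  rw [← hT.map_eq]
  -- This inequality between outer measures spares the measurability of the bad event.
  refine le_trans (measure_mono ?_) (Measure.le_map_apply hT.measurable.aemeasurable _)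
  intro R hR
  have hA : (((fun (R : Fin m → Fin d → ℝ) (j : Fin d) (i : Fin m) => R i j) ∘
      fun (R : Fin m → Fin d → ℝ) i j => (fun k => U k j) ⬝ᵥ R i) R) =
      fun j => R *ᵥ (hG.eigenvectorBasis j).ofLp := by
    funext j i
    rw [← hUu]
    exact dotProduct_comm _ _
  have h : ∀ A : Fin d → Fin m → ℝ, (A = fun j => R *ᵥ (hG.eigenvectorBasis j).ofLp) →
      ¬ ((gram hG.eigenvalues A).PosDef ∧
        (gram hG.eigenvalues A).trace ≤ 10 * ∑ j, hG.eigenvalues j ∧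
        ∑ j, hG.eigenvalues j * (1 - leverage hG.eigenvalues A j) ≤
          50 * Real.exp 16 * ∑ j ∈ Jᶜ, hG.eigenvalues j) := by
    rintro _ rfl
    rw [← sketchedCov_eq_gram hG]
    exact hR
  exact h _ hA

variable {R : Matrix (Fin m) (Fin d) ℝ}

theorem sqNorm_one (A : Matrix (Fin m) (Fin m) ℝ) : sqNorm A (1 : Matrix (Fin m) (Fin m) ℝ) = A.trace := by
  simp [sqNorm]

theorem trace_eq_sum_of_isHermitian (hG : G.IsHermitian) : G.trace = ∑ j, hG.eigenvalues j := by
  simpa using hG.trace_eq_sum_eigenvalues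

/-- The approximation error for the identity prior in terms of leverage scores. -/
theorem sqNorm_approx_one (hG : G.IsHermitian) (hH : (sketchedCov G R).PosDef) :
    sqNorm G (Rᵀ * optSketched G R (1 : Matrix (Fin d) (Fin d) ℝ) - 1) =
      ∑ j, hG.eigenvalues j * (1 - leverage hG.eigenvalues
        (fun j => R *ᵥ (hG.eigenvectorBasis j).ofLp) j) := by
  have hu := (Matrix.isUnit_iff_isUnit_det _).1 hH.isUnit
  have h1 := sqNorm_eq_approx_add hG hH (1 : Matrix (Fin d) (Fin d) ℝ)
  have h2 : sqNorm (sketchedCov G R) (optSketched G R (1 : Matrix (Fin d) (Fin d) ℝ)) =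
      (G * Rᵀ * (sketchedCov G R)⁻¹ * R * G).trace := by
    have hinv : ((sketchedCov G R)⁻¹)ᵀ = (sketchedCov G R)⁻¹ := transpose_eq_self hH.inv.1
    rw [sqNorm, optSketched, Matrix.mul_one, Matrix.transpose_mul, Matrix.transpose_mul, hinv,
      transpose_eq_self hG]
    congr 1
    simp only [Matrix.mul_assoc]
    rw [← Matrix.mul_assoc (sketchedCov G R), Matrix.mul_nonsing_inv _ hu, Matrix.one_mul]
  -- In the eigenbasis each outer `G` acts as `Λ_j`, and `Λ_j² A_jᵀ H⁻¹ A_j` is `Λ_j` times the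
  -- leverage.
  have h3 : (G * Rᵀ * (sketchedCov G R)⁻¹ * R * G).trace = ∑ j, hG.eigenvalues j *
      leverage hG.eigenvalues (fun j => R *ᵥ (hG.eigenvectorBasis j).ofLp) j := by
    rw [trace_eq_sum_eigenvectorBasis hG]
    refine Finset.sum_congr rfl fun j _ => ?_
    rw [leverage, ← sketchedCov_eq_gram hG]
    set u := (hG.eigenvectorBasis j).ofLp
    have hu : G *ᵥ u = hG.eigenvalues j • u := hG.mulVec_eigenvectorBasis j
    rw [← Matrix.mulVec_mulVec, hu, Matrix.mul_assoc, Matrix.mul_assoc, ← Matrix.mulVec_mulVec,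
      dotProduct_mulVec_comm hG, hu]
    simp only [Matrix.mulVec_smul, smul_dotProduct, dotProduct_smul, smul_eq_mul]
    rw [← Matrix.mulVec_mulVec, ← Matrix.mulVec_mulVec, dotProduct_comm, Matrix.dotProduct_mulVec,
      Matrix.vecMul_transpose]
  rw [sqNorm_one, trace_eq_sum_of_isHermitian hG, h2, h3] at h1
  simp only [mul_sub, mul_one, Finset.sum_sub_distrib]
  linarith

end Transfer

end SketchedRegression

namespace SketchedRegression

/-! ### Averages over the isotropic prior. -/

section Prior

variable {m d p : ℕ}

instance : BorelSpace (Matrix (Fin m) (Fin d) ℝ) :=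
  inferInstanceAs (BorelSpace (Fin m → Fin d → ℝ))

/-- The form depends on `W` only through `W Wᵀ`, so the second moment of the prior determines its
mean. -/
theorem sqNorm_eq_sum_mul_transpose (K : Matrix (Fin d) (Fin d) ℝ) (W : Matrix (Fin d) (Fin p) ℝ) :
    sqNorm K W = ∑ i, ∑ j, K i j * (W * Wᵀ) i j := by
  rw [sqNorm, Matrix.mul_assoc, Matrix.trace_mul_comm, Matrix.mul_assoc, Matrix.trace]
  refine Finset.sum_congr rfl fun i _ => ?_
  rw [Matrix.diag_apply, Matrix.mul_apply]
  refine Finset.sum_congr rfl fun j _ => ?_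
  congr 1
  rw [← Matrix.transpose_apply (W * Wᵀ), Matrix.transpose_mul, Matrix.transpose_transpose]

variable {prior : Measure (Matrix (Fin d) (Fin p) ℝ)}

theorem measurable_mul_transpose_apply (i j : Fin d) :
    Measurable fun W : Matrix (Fin d) (Fin p) ℝ => (W * Wᵀ) i j := by
  have h : Continuous fun W : Matrix (Fin d) (Fin p) ℝ => W * Wᵀ :=
    continuous_id.matrix_mul continuous_id.matrix_transpose
  exact ((continuous_apply j).comp ((continuous_apply i).comp h)).measurable

/-- A non-integrable diagonal entry would have integral 0 by convention, not 1. Off-diagonal entries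
are dominated by the diagonal ones through `2|xy| ≤ x² + y²`. -/
theorem integrable_mul_transpose
    (hprior : ∀ i j, ∫ W, (W * Wᵀ) i j ∂prior = (1 : Matrix (Fin d) (Fin d) ℝ) i j)
    (i j : Fin d) : Integrable (fun W => (W * Wᵀ) i j) prior := by
  have hdiag : ∀ i, Integrable (fun W => (W * Wᵀ) i i) prior := fun i => by
    by_contra hcon
    have h1 := hprior i i
    rw [integral_undef hcon, Matrix.one_apply_eq] at h1
    exact zero_ne_one h1
  refine ((hdiag i).add (hdiag j)).mono (measurable_mul_transpose_apply i j).aestronglyMeasurable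
    (ae_of_all _ fun W => ?_)
  simp only [Pi.add_apply, Matrix.mul_apply, Matrix.transpose_apply]
  rw [← Finset.sum_add_distrib]
  refine ((norm_sum_le _ _).trans (Finset.sum_le_sum fun c _ => ?_)).trans (Real.le_norm_self _)
  rw [Real.norm_eq_abs, abs_le]
  constructor <;> nlinarith [sq_nonneg (W i c + W j c), sq_nonneg (W i c - W j c),
    sq_nonneg (W i c), sq_nonneg (W j c)]

/-- Under an isotropic prior, `E ‖X W‖²_A = ‖X‖²_A`. -/
theorem integral_sqNorm_mul
    (hprior : ∀ i j, ∫ W, (W * Wᵀ) i j ∂prior = (1 : Matrix (Fin d) (Fin d) ℝ) i j)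
    (A : Matrix (Fin m) (Fin m) ℝ) (X : Matrix (Fin m) (Fin d) ℝ) :
    Integrable (fun W => sqNorm A (X * W)) prior ∧
      ∫ W, sqNorm A (X * W) ∂prior = sqNorm A X := by
  have e : ∀ W : Matrix (Fin d) (Fin p) ℝ, sqNorm A (X * W) =
      ∑ i, ∑ j, (Xᵀ * A * X) i j * (W * Wᵀ) i j := fun W => by
    rw [sqNorm_mul, sqNorm_eq_sum_mul_transpose]
  simp only [e]
  have hi : ∀ i j, Integrable (fun W : Matrix (Fin d) (Fin p) ℝ =>
      (Xᵀ * A * X) i j * (W * Wᵀ) i j) prior :=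
    fun i j => (integrable_mul_transpose hprior i j).const_mul _
  refine ⟨integrable_finsetSum _ fun i _ => integrable_finsetSum _ fun j _ => hi i j, ?_⟩
  rw [integral_finsetSum _ fun i _ => integrable_finsetSum _ fun j _ => hi i j]
  rw [sqNorm, Matrix.trace]
  refine Finset.sum_congr rfl fun i _ => ?_
  rw [integral_finsetSum _ fun j _ => hi i j]
  simp only [integral_const_mul, hprior, Matrix.one_apply, Matrix.diag_apply]
  simp

theorem integral_sqNorm
    (hprior : ∀ i j, ∫ W, (W * Wᵀ) i j ∂prior = (1 : Matrix (Fin d) (Fin d) ℝ) i j)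
    (A : Matrix (Fin d) (Fin d) ℝ) :
    Integrable (fun W => sqNorm A W) prior ∧ ∫ W, sqNorm A W ∂prior = A.trace := by
  have h := integral_sqNorm_mul hprior A (1 : Matrix (Fin d) (Fin d) ℝ)
  simpa only [Matrix.one_mul, sqNorm_one] using h

variable {G : Matrix (Fin d) (Fin d) ℝ} {R : Matrix (Fin m) (Fin d) ℝ}

theorem optSketched_eq_mul (W : Matrix (Fin d) (Fin p) ℝ) :
    optSketched G R W = optSketched G R (1 : Matrix (Fin d) (Fin d) ℝ) * W := by
  simp only [optSketched, Matrix.mul_one]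

theorem integral_sqNorm_approx
    (hprior : ∀ i j, ∫ W, (W * Wᵀ) i j ∂prior = (1 : Matrix (Fin d) (Fin d) ℝ) i j) :
    Integrable (fun W => sqNorm G (Rᵀ * optSketched G R W - W)) prior ∧
      ∫ W, sqNorm G (Rᵀ * optSketched G R W - W) ∂prior =
        sqNorm G (Rᵀ * optSketched G R (1 : Matrix (Fin d) (Fin d) ℝ) - 1) := by
  have h : ∀ W : Matrix (Fin d) (Fin p) ℝ, Rᵀ * optSketched G R W - W =
      (Rᵀ * optSketched G R (1 : Matrix (Fin d) (Fin d) ℝ) - 1) * W := fun W => by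
    rw [optSketched_eq_mul, Matrix.sub_mul, Matrix.one_mul, Matrix.mul_assoc]
  simp only [h]
  exact integral_sqNorm_mul hprior _ _

theorem integrable_biasError
    (hprior : ∀ i j, ∫ W, (W * Wᵀ) i j ∂prior = (1 : Matrix (Fin d) (Fin d) ℝ) i j)
    (γ : ℝ) (n : ℕ) : Integrable (fun W => biasError G R γ n W) prior := by
  unfold biasError
  simp only [optSketched_eq_mul (p := p), ← Matrix.mul_assoc]
  exact (integral_sqNorm_mul hprior _ _).1

end Prior

/-! ### Bias, variance and second moments in the eigenbasis of `H`. -/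

section Errors

variable {m d p : ℕ} {G : Matrix (Fin d) (Fin d) ℝ} {R : Matrix (Fin m) (Fin d) ℝ}

theorem vecMul_prod_eigenvectorBasis {H : Matrix (Fin m) (Fin m) ℝ} (hH : H.IsHermitian)
    (η : ℕ → ℝ) (n : ℕ) (l : Fin m) :
    (hH.eigenvectorBasis l).ofLp ᵥ* ((List.range n).map fun t => 1 - η t • H).prod =
      (∏ t ∈ Finset.range n, (1 - η t * hH.eigenvalues l)) • (hH.eigenvectorBasis l).ofLp := by
  have h1 : (hH.eigenvectorBasis l).ofLp ᵥ* H =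
      hH.eigenvalues l • (hH.eigenvectorBasis l).ofLp := by
    rw [← Matrix.mulVec_transpose, transpose_eq_self hH]
    exact hH.mulVec_eigenvectorBasis l
  induction n with
  | zero => simp
  | succ n ih =>
    rw [List.range_succ, List.map_append, List.prod_append, List.map_singleton,
      List.prod_singleton, ← Matrix.vecMul_vecMul, ih, Matrix.smul_vecMul, Matrix.vecMul_sub,
      Matrix.vecMul_one, Matrix.vecMul_smul, h1, Finset.prod_range_succ]
    ext i
    simp only [Pi.smul_apply, Pi.sub_apply, smul_eq_mul]
    ring

theorem biasError_eq_sum (hH : (sketchedCov G R).PosDef) (γ : ℝ) (n : ℕ)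
    (W : Matrix (Fin d) (Fin p) ℝ) :
    biasError G R γ n W = ∑ l, hH.1.eigenvalues l *
      ((∏ t ∈ Finset.range n, (1 - stepSize γ n (t + 1) * hH.1.eigenvalues l)) ^ 2 *
        eigenError hH W 0 l) := by
  rw [biasError, sqNorm_eq_sum_eigenvalues hH.1]
  refine Finset.sum_congr rfl fun l _ => ?_
  rw [eigenError, Matrix.mulVec_transpose, ← Matrix.vecMul_vecMul,
    vecMul_prod_eigenvectorBasis hH.1 (fun t => stepSize γ n (t + 1)), zero_sub,
    Matrix.mulVec_transpose, Matrix.smul_vecMul, Matrix.vecMul_neg]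
  congr 1
  rw [Finset.mul_sum]
  refine Finset.sum_congr rfl fun c _ => ?_
  simp only [Pi.smul_apply, Pi.neg_apply, smul_eq_mul]
  ring

/-- Each eigenvalue contributes 1 above the threshold and `(Nγλ)²` below it, which is the minimum of
the two. -/
theorem varError_eq_sum {H : Matrix (Fin m) (Fin m) ℝ} (hH : H.PosDef) {γ : ℝ} (hγ : 0 < γ)
    {n : ℕ} (hn : 2 ≤ n) (hH' : H.IsHermitian) :
    varError hH' γ n =
      ∑ l, min 1 ((effSampleSize n * γ * hH.1.eigenvalues l) ^ 2) / effSampleSize n := by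
  have hN := one_le_effSampleSize hn
  have hNγ : 0 < effSampleSize n * γ := mul_pos (by linarith) hγ
  rw [varError, ← Finset.sum_div]
  congr 1
  rw [Finset.card_filter, Finset.mul_sum, Finset.sum_filter, Nat.cast_sum, ← Finset.sum_add_distrib]
  refine Finset.sum_congr rfl fun l _ => ?_
  have hl : 0 < hH.1.eigenvalues l := hH.eigenvalues_pos l
  by_cases h : 1 / (effSampleSize n * γ) ≤ hH.1.eigenvalues l
  · rw [if_pos h, if_neg (not_lt.2 h)]
    have h1 : 1 ≤ effSampleSize n * γ * hH.1.eigenvalues l := by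
      rw [div_le_iff₀ hNγ] at h; linarith
    rw [min_eq_left (one_le_pow₀ h1)]
    simp
  · rw [if_neg h, if_pos (not_le.1 h)]
    have h1 : effSampleSize n * γ * hH.1.eigenvalues l ≤ 1 := by
      have := not_le.1 h
      rw [lt_div_iff₀ hNγ] at this; linarith
    rw [min_eq_right (pow_le_one₀ (by positivity) h1), mul_pow _ (hH.1.eigenvalues l)]
    simp

/-- The expected squared errors of SGD in the eigendirections, as a function of the noise
levels `Z`. -/
noncomputable def eigenMoment (hH : (sketchedCov G R).PosDef) (η : ℕ → ℝ)
    (W : Matrix (Fin d) (Fin p) ℝ) (Z : Fin m → ℝ) : ℕ → Fin m → ℝ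
  | 0, l => eigenError hH W 0 l
  | k + 1, l =>
    (1 - 2 * (η k * hH.1.eigenvalues l) + 2 * (η k * hH.1.eigenvalues l) ^ 2) *
        eigenMoment hH η W Z k l +
      η k ^ 2 * hH.1.eigenvalues l * (sqNorm G (Rᵀ * optSketched G R W - W) +
        ∑ j, hH.1.eigenvalues j * eigenMoment hH η W Z k j) +
      η k ^ 2 * Z l

/-- The noise level in the direction of the `l`-th eigenvector of the sketched covariance. -/
noncomputable def eigenNoise (P : Measure (Example d p)) (hH : (sketchedCov G R).PosDef)
    (W : Matrix (Fin d) (Fin p) ℝ) (l : Fin m) : ℝ :=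
  ∫ z, ‖z.2 - predict W z.1‖ ^ 2 *
    ((Rᵀ *ᵥ (hH.1.eigenvectorBasis l).ofLp) ⬝ᵥ z.1.ofLp) ^ 2 ∂P

theorem continuous_sqNorm_comp {X : Type*} [TopologicalSpace X] (A : Matrix (Fin m) (Fin m) ℝ)
    {f : X → Matrix (Fin m) (Fin p) ℝ} (hf : Continuous f) : Continuous fun x => sqNorm A (f x) :=
  ((hf.matrix_transpose.matrix_mul continuous_const).matrix_mul hf).matrix_trace

theorem measurable_sqNorm_approx : Measurable fun W : Matrix (Fin d) (Fin p) ℝ =>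
    sqNorm G (Rᵀ * optSketched G R W - W) := by
  refine (continuous_sqNorm_comp _ ?_).measurable
  unfold optSketched
  exact (continuous_const.matrix_mul (continuous_const.matrix_mul continuous_id)).sub continuous_id

/-- The law of the samples varies with `W`. Writing their mean squared errors as an explicit
recursion reduces measurability in `W` to that of the noise levels. -/
theorem measurable_eigenMoment (hH : (sketchedCov G R).PosDef) (η : ℕ → ℝ)
    {Z : Matrix (Fin d) (Fin p) ℝ → Fin m → ℝ} (hZ : ∀ l, Measurable fun W => Z W l) (k : ℕ)
    (l : Fin m) : Measurable fun W => eigenMoment hH η W (Z W) k l := by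
  induction k generalizing l with
  | zero => exact (continuous_eigenError_left hH 0 l).measurable
  | succ k ih =>
    simp only [eigenMoment]
    have := hZ l
    have := measurable_sqNorm_approx (p := p) (G := G) (R := R)
    fun_prop

theorem measurable_eigenNoise (P : Kernel (Matrix (Fin d) (Fin p) ℝ) (Example d p))
    [IsMarkovKernel P] (hH : (sketchedCov G R).PosDef) (l : Fin m) :
    Measurable fun W => eigenNoise (P W) hH W l := by
  unfold eigenNoise
  have hc : Continuous fun q : Matrix (Fin d) (Fin p) ℝ × Example d p =>
      ‖q.2.2 - predict q.1 q.2.1‖ ^ 2 *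
        ((Rᵀ *ᵥ (hH.1.eigenvectorBasis l).ofLp) ⬝ᵥ q.2.1.ofLp) ^ 2 := by
    have h1 : Continuous fun q : Matrix (Fin d) (Fin p) ℝ × Example d p => predict q.1 q.2.1 := by
      unfold predict
      refine (PiLp.continuous_toLp 2 _).comp ?_
      exact Continuous.matrix_mulVec continuous_fst.matrix_transpose (by fun_prop)
    have h2 : Continuous fun q : Matrix (Fin d) (Fin p) ℝ × Example d p =>
        (Rᵀ *ᵥ (hH.1.eigenvectorBasis l).ofLp) ⬝ᵥ q.2.1.ofLp := by
      simp only [dotProduct]; fun_prop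
    fun_prop
  exact (hc.measurable.stronglyMeasurable.integral_kernel_prod_right' (κ := P)).measurable

end Errors

/-! ### Excess error for a fixed true parameter. -/

section Bounds

variable {m d p : ℕ} {P : Measure (Example d p)}
  {G : Matrix (Fin d) (Fin d) ℝ} {W : Matrix (Fin d) (Fin p) ℝ} {σ ν : ℝ}
  {R : Matrix (Fin m) (Fin d) ℝ}

theorem eigenNoise_bounds (hC : ComparableNoise P G W σ ν) (hH : (sketchedCov G R).PosDef)
    (l : Fin m) :
    ν⁻¹ * σ ^ 2 * hH.1.eigenvalues l ≤ eigenNoise P hH W l ∧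
      eigenNoise P hH W l ≤ ν * σ ^ 2 * hH.1.eigenvalues l := by
  have h := hC (Rᵀ *ᵥ (hH.1.eigenvectorBasis l).ofLp)
  rwa [eigen_square_term hH] at h

/-- A non-integrable integrand would have integral 0 by convention, against the strictly positive
lower bound on the noise. -/
theorem integrable_noise_of_comparable (hC : ComparableNoise P G W σ ν)
    (hH : (sketchedCov G R).PosDef) (hσ : 0 < σ ^ 2) (hν : 1 ≤ ν) (l : Fin m) :
    Integrable (fun z : Example d p => ‖z.2 - predict W z.1‖ ^ 2 *
      ((Rᵀ *ᵥ (hH.1.eigenvectorBasis l).ofLp) ⬝ᵥ z.1.ofLp) ^ 2) P := by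
  by_contra hcon
  have h1 := (eigenNoise_bounds hC hH l).1
  have h2 : 0 < ν⁻¹ * σ ^ 2 * hH.1.eigenvalues l :=
    mul_pos (mul_pos (inv_pos.2 (by linarith)) hσ) (hH.eigenvalues_pos l)
  rw [eigenNoise, integral_undef hcon] at h1
  linarith

theorem sqNorm_sub_optSketched (hH : (sketchedCov G R).PosDef) (W : Matrix (Fin d) (Fin p) ℝ)
    (V : Matrix (Fin m) (Fin p) ℝ) :
    sqNorm (sketchedCov G R) (V - optSketched G R W) =
      ∑ l, hH.1.eigenvalues l * eigenError hH W V l :=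
  sqNorm_eq_sum_eigenvalues hH.1 _

theorem GaussianWellSpecified.integral_eigenError_eq_eigenMoment [IsProbabilityMeasure P]
    (h : GaussianWellSpecified P G W σ) (hC : ComparableNoise P G W σ ν)
    (hG : G.PosSemidef) (hH : (sketchedCov G R).PosDef) (hσ : 0 < σ ^ 2) (hν : 1 ≤ ν)
    (η : ℕ → ℝ) (k : ℕ) (l : Fin m) :
    ∫ D : Fin k → Example d p, eigenError hH W (sgdRun R η k D) l ∂(Measure.pi fun _ => P) =
      eigenMoment hH η W (eigenNoise P hH W) k l := by
  have hN := integrable_noise_of_comparable hC hH hσ hν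
  induction k generalizing l with
  | zero =>
    simp only [sgdRun, integral_const, probReal_univ, one_smul]
    rfl
  | succ k ih =>
    rw [(h.integral_eigenError_sgdRun hG hH η hN k).2 l]
    simp only [ih]
    rfl

/-- Two-sided bounds on the expected excess error for a fixed true parameter. -/
theorem GaussianWellSpecified.integral_excessError_bounds [IsProbabilityMeasure P]
    (h : GaussianWellSpecified P G W σ) (hC : ComparableNoise P G W σ ν)
    (hG : G.PosSemidef) (hH : (sketchedCov G R).PosDef) (hσ : 0 < σ ^ 2) (hν : 1 ≤ ν)
    {n : ℕ} (hn : 2 ≤ n) {γ : ℝ} (hγ : 0 < γ) (htr : γ * (sketchedCov G R).trace ≤ 1 / 4)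
    (hH' : (sketchedCov G R).IsHermitian) :
    Integrable (fun D : Fin n → Example d p => excessError P R (sgdOutput R γ D))
      (Measure.pi fun _ => P) ∧
    ∫ D : Fin n → Example d p, excessError P R (sgdOutput R γ D) ∂(Measure.pi fun _ => P) =
      ∑ l, hH.1.eigenvalues l * eigenMoment hH (fun t => stepSize γ n (t + 1)) W
        (eigenNoise P hH W) n l ∧
    biasError G R γ n W + ν⁻¹ * σ ^ 2 * (Real.exp (-16) / 16 * varError hH' γ n) ≤
      ∫ D : Fin n → Example d p, excessError P R (sgdOutput R γ D) ∂(Measure.pi fun _ => P) ∧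
    ∫ D : Fin n → Example d p, excessError P R (sgdOutput R γ D) ∂(Measure.pi fun _ => P) ≤
      biasError G R γ n W + 5 * (sqNorm G W + ν * σ ^ 2) * (8 * varError hH' γ n) := by
  have hN := integrable_noise_of_comparable hC hH hσ hν
  have hrun := fun l => (h.integral_eigenError_sgdRun hG hH (fun t => stepSize γ n (t + 1)) hN n).1 l
  have he : (fun D : Fin n → Example d p => excessError P R (sgdOutput R γ D)) =
      fun D => ∑ l, hH.1.eigenvalues l *
        eigenError hH W (sgdRun R (fun t => stepSize γ n (t + 1)) n D) l := by
    funext D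
    rw [h.excessError_eq hG hH, sqNorm_sub_optSketched hH, sgdOutput_eq_sgdRun]
  have hi : ∀ l, Integrable (fun D : Fin n → Example d p => hH.1.eigenvalues l *
      eigenError hH W (sgdRun R (fun t => stepSize γ n (t + 1)) n D) l) (Measure.pi fun _ => P) :=
    fun l => (hrun l).const_mul _
  have hI : ∫ D : Fin n → Example d p, excessError P R (sgdOutput R γ D) ∂(Measure.pi fun _ => P) =
      ∑ l, hH.1.eigenvalues l * eigenMoment hH (fun t => stepSize γ n (t + 1)) W
        (eigenNoise P hH W) n l := by
    rw [he, integral_finsetSum _ fun l _ => hi l]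
    refine Finset.sum_congr rfl fun l _ => ?_
    rw [integral_const_mul, h.integral_eigenError_eq_eigenMoment hC hG hH hσ hν]
  have hν0 : 0 < ν := by linarith
  -- Here `A` is the approximation error, and the noise sources lie between `ν⁻¹ σ² λ` and `ν σ² λ`.
  have hmain := second_moment_recursion_bounds hn hγ (fun l => hH.eigenvalues_pos l)
    (by rwa [← trace_eq_sum_of_isHermitian hH.1]) (sqNorm_nonneg hG (Rᵀ * optSketched G R W - W))
    (mul_nonneg (inv_pos.2 hν0).le hσ.le) (mul_nonneg hν0.le hσ.le)
    (fun l => (eigenNoise_bounds hC hH l).1) (fun l => (eigenNoise_bounds hC hH l).2)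
    (α := eigenMoment hH (fun t => stepSize γ n (t + 1)) W (eigenNoise P hH W))
    (fun l => eigenError_nonneg hH W 0 l) (fun _ _ => rfl)
  have h0 : ∑ l, hH.1.eigenvalues l * eigenMoment hH (fun t => stepSize γ n (t + 1)) W
      (eigenNoise P hH W) 0 l = sqNorm (sketchedCov G R) (optSketched G R W) := by
    rw [← sqNorm_neg, ← zero_sub, sqNorm_sub_optSketched hH]
    rfl
  have hb : biasError G R γ n W = ∑ l, hH.1.eigenvalues l *
      ((∏ t ∈ Finset.range n, (1 - stepSize γ n (t + 1) * hH.1.eigenvalues l)) ^ 2 *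
        eigenMoment hH (fun t => stepSize γ n (t + 1)) W (eigenNoise P hH W) 0 l) :=
    biasError_eq_sum hH γ n W
  have hs := sqNorm_eq_approx_add hG.1 hH W
  rw [h0, ← hb, ← varError_eq_sum hH hγ hn hH'] at hmain
  refine ⟨by rw [he]; exact integrable_finsetSum _ fun l _ => hi l, hI, ?_, ?_⟩
  · rw [hI]; exact hmain.1
  · rw [hI, hs, add_comm (sqNorm G _)]; exact hmain.2

end Bounds

end SketchedRegression

namespace SketchedRegression

/-! ### Power law bounds for the residual sums. -/

section Spectrum

variable {d : ℕ}

theorem card_filter_equiv_lt (ρ : Fin d ≃ Fin d) {k : ℕ} (hk : k ≤ d) :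
    (Finset.univ.filter fun j => (ρ j : ℕ) < k).card = k := by
  rw [Finset.card_filter, Equiv.sum_comp ρ fun i : Fin d => if (i : ℕ) < k then 1 else 0,
    Fin.sum_univ_eq_sum_range fun i : ℕ => if i < k then 1 else 0, ← Finset.card_filter]
  have h : (Finset.range d).filter (fun i => i < k) = Finset.range k := by
    ext i; simp; omega
  rw [h, Finset.card_range]

variable {a b B : ℝ} {ρ : Fin d ≃ Fin d} {Λ : Fin d → ℝ}

theorem sum_le_of_power_law (ha : 1 < a) (hB : 0 ≤ B)
    (hΛ : ∀ j, Λ j ≤ B * (((ρ j : ℕ) : ℝ) + 1) ^ (-a)) :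
    ∑ j, Λ j ≤ B * (1 + 1 / (a - 1)) := by
  have h := sum_filter_rpow_le ha ρ 0
  simp only [Nat.zero_le, Finset.filter_true, Nat.cast_zero, zero_add, Real.one_rpow, mul_one] at h
  calc ∑ j, Λ j ≤ B * ∑ j, (((ρ j : ℕ) : ℝ) + 1) ^ (-a) := by
        rw [Finset.mul_sum]; exact Finset.sum_le_sum fun j _ => hΛ j
    _ ≤ _ := mul_le_mul_of_nonneg_left h hB

theorem tail_sum_le_of_power_law (ha : 1 < a) (hB : 0 ≤ B)
    (hΛ : ∀ j, Λ j ≤ B * (((ρ j : ℕ) : ℝ) + 1) ^ (-a)) {m : ℕ} (hm : 1 ≤ m) :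
    ∑ j ∈ (Finset.univ.filter fun j => (ρ j : ℕ) < m / 4)ᶜ, Λ j ≤
      B * (1 + 1 / (a - 1)) * 4 ^ (a - 1) * (m : ℝ) ^ (1 - a) := by
  have hc : (Finset.univ.filter fun j => (ρ j : ℕ) < m / 4)ᶜ =
      Finset.univ.filter fun j => m / 4 ≤ (ρ j : ℕ) := by
    ext j; simp
  have hm0 : (0 : ℝ) < m := by exact_mod_cast hm
  -- Rounding `m / 4` down is compensated by the `+ 1` of the rank.
  have h1 : (m : ℝ) / 4 ≤ ((m / 4 : ℕ) : ℝ) + 1 := by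
    have : m ≤ 4 * (m / 4 + 1) := by omega
    have : (m : ℝ) ≤ 4 * (((m / 4 : ℕ) : ℝ) + 1) := by exact_mod_cast this
    linarith
  have h2 : (((m / 4 : ℕ) : ℝ) + 1) ^ (1 - a) ≤ 4 ^ (a - 1) * (m : ℝ) ^ (1 - a) := by
    refine (Real.rpow_le_rpow_of_nonpos (by positivity) h1 (by linarith)).trans (le_of_eq ?_)
    rw [Real.div_rpow hm0.le (by norm_num), show a - 1 = -(1 - a) by ring,
      Real.rpow_neg (by norm_num), div_eq_inv_mul]
  have hT : 0 ≤ 1 + 1 / (a - 1) := by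
    have : 0 < a - 1 := by linarith
    positivity
  rw [hc]
  calc ∑ j ∈ Finset.univ.filter (fun j => m / 4 ≤ (ρ j : ℕ)), Λ j
      ≤ B * ∑ j ∈ Finset.univ.filter (fun j => m / 4 ≤ (ρ j : ℕ)),
          (((ρ j : ℕ) : ℝ) + 1) ^ (-a) := by
        rw [Finset.mul_sum]; exact Finset.sum_le_sum fun j _ => hΛ j
    _ ≤ B * ((1 + 1 / (a - 1)) * (4 ^ (a - 1) * (m : ℝ) ^ (1 - a))) :=
        mul_le_mul_of_nonneg_left ((sum_filter_rpow_le ha ρ (m / 4)).trans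
          (mul_le_mul_of_nonneg_left h2 hT)) hB
    _ = _ := by ring

/-- Applies `le_sum_residual` to the top `min d (2m)` indices: their eigenvalues are at least `b
(2m)^{-a}`, and they outnumber `m` by at least `min (κ - 1) 1 · m`. -/
theorem residual_lower_of_power_law (ha : 1 < a) (hb : 0 < b)
    (hΛ : ∀ j, b * (((ρ j : ℕ) : ℝ) + 1) ^ (-a) ≤ Λ j) {m : ℕ} (hm : 1 ≤ m)
    {κ : ℝ} (hκd : κ * m ≤ d) {A : Fin d → Fin m → ℝ} (hH : (gram Λ A).PosDef) :
    b * 2 ^ (-a) * min (κ - 1) 1 * (m : ℝ) ^ (1 - a) ≤ ∑ j, Λ j * (1 - leverage Λ A j) := by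
  have hm0 : (0 : ℝ) < m := by exact_mod_cast hm
  have hpos : ∀ j, 0 < Λ j := fun j => lt_of_lt_of_le (by positivity) (hΛ j)
  have hl : ∀ j ∈ Finset.univ.filter (fun j => (ρ j : ℕ) < min d (2 * m)),
      b * (2 * m : ℝ) ^ (-a) ≤ Λ j := by
    intro j hj
    refine le_trans (mul_le_mul_of_nonneg_left ?_ hb.le) (hΛ j)
    refine Real.rpow_le_rpow_of_nonpos (by positivity) ?_ (by linarith)
    have h : (ρ j : ℕ) + 1 ≤ 2 * m :=
      (Nat.succ_le_of_lt (Finset.mem_filter.1 hj).2).trans (min_le_right _ _)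
    exact_mod_cast h
  have h1 := le_sum_residual hpos hH _ (by positivity) hl
  rw [card_filter_equiv_lt ρ (min_le_left _ _)] at h1
  refine le_trans ?_ h1
  have h2 : min (κ - 1) 1 * (m : ℝ) ≤ ((min d (2 * m) : ℕ) : ℝ) - m := by
    rcases le_total d (2 * m) with h | h
    · rw [min_eq_left h]
      nlinarith [min_le_left (κ - 1) 1]
    · rw [min_eq_right h]
      push_cast
      nlinarith [min_le_right (κ - 1) 1]
  refine le_trans (le_of_eq ?_) (mul_le_mul_of_nonneg_left h2 (by positivity))
  rw [Real.mul_rpow (by norm_num) hm0.le, show 1 - a = -a + 1 by ring, Real.rpow_add_one hm0.ne']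
  ring

end Spectrum

/-! ### Averaging the error bounds over the true parameter. -/

section Average

variable {m d p : ℕ} {G : Matrix (Fin d) (Fin d) ℝ} {R : Matrix (Fin m) (Fin d) ℝ}
  {prior : Measure (Matrix (Fin d) (Fin p) ℝ)}
  {P : Kernel (Matrix (Fin d) (Fin p) ℝ) (Example d p)} {σ ν : ℝ}

theorem integral_approxError [IsMarkovKernel P]
    (hprior : ∀ i j, ∫ W, (W * Wᵀ) i j ∂prior = (1 : Matrix (Fin d) (Fin d) ℝ) i j)
    (h : ∀ᵐ W ∂prior, GaussianWellSpecified (P W) G W σ)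
    (hG : G.PosSemidef) (hH : (sketchedCov G R).PosDef) :
    Integrable (fun W => approxError (P W) R) prior ∧
      ∫ W, approxError (P W) R ∂prior =
        ∑ j, hG.1.eigenvalues j * (1 - leverage hG.1.eigenvalues
          (fun j => R *ᵥ (hG.1.eigenvectorBasis j).ofLp) j) := by
  have he : (fun W => approxError (P W) R) =ᵐ[prior]
      fun W => sqNorm G (Rᵀ * optSketched G R W - W) := by
    filter_upwards [h] with W hW using hW.approxError_eq hG hH
  have h1 := integral_sqNorm_approx (G := G) (R := R) hprior
  exact ⟨h1.1.congr he.symm, by rw [integral_congr_ae he, h1.2, sqNorm_approx_one hG.1 hH]⟩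

/-- Two-sided bounds on the average of the expected excess error over the prior. -/
theorem integral_integral_excessError_bounds [IsProbabilityMeasure prior] [IsMarkovKernel P]
    (hprior : ∀ i j, ∫ W, (W * Wᵀ) i j ∂prior = (1 : Matrix (Fin d) (Fin d) ℝ) i j)
    (h : ∀ᵐ W ∂prior, GaussianWellSpecified (P W) G W σ)
    (hC : ∀ᵐ W ∂prior, ComparableNoise (P W) G W σ ν)
    (hG : G.PosSemidef) (hH : (sketchedCov G R).PosDef) (hσ : 0 < σ ^ 2) (hν : 1 ≤ ν)
    {n : ℕ} (hn : 2 ≤ n) {γ : ℝ} (hγ : 0 < γ) (htr : γ * (sketchedCov G R).trace ≤ 1 / 4)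
    (hH' : (sketchedCov G R).IsHermitian) :
    (∀ᵐ W ∂prior, Integrable (fun D : Fin n → Example d p =>
      excessError (P W) R (sgdOutput R γ D)) (Measure.pi fun _ => P W)) ∧
    Integrable (fun W => ∫ D : Fin n → Example d p,
      excessError (P W) R (sgdOutput R γ D) ∂(Measure.pi fun _ => P W)) prior ∧
    (∫ W, biasError G R γ n W ∂prior) +
        ν⁻¹ * σ ^ 2 * (Real.exp (-16) / 16 * varError hH' γ n) ≤
      ∫ W, ∫ D : Fin n → Example d p,
        excessError (P W) R (sgdOutput R γ D) ∂(Measure.pi fun _ => P W) ∂prior ∧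
    ∫ W, ∫ D : Fin n → Example d p,
        excessError (P W) R (sgdOutput R γ D) ∂(Measure.pi fun _ => P W) ∂prior ≤
      (∫ W, biasError G R γ n W ∂prior) +
        5 * (G.trace + ν * σ ^ 2) * (8 * varError hH' γ n) := by
  set E : Matrix (Fin d) (Fin p) ℝ → ℝ := fun W => ∫ D : Fin n → Example d p,
    excessError (P W) R (sgdOutput R γ D) ∂(Measure.pi fun _ => P W) with hE
  have hall := (h.and hC).mono fun W hW =>
    hW.1.integral_excessError_bounds hW.2 hG hH hσ hν hn hγ htr hH'
  have hbias := integrable_biasError (G := G) (R := R) hprior γ n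
  have hsq := integral_sqNorm hprior G
  have hLi : Integrable (fun W => biasError G R γ n W +
      ν⁻¹ * σ ^ 2 * (Real.exp (-16) / 16 * varError hH' γ n)) prior :=
    hbias.add (integrable_const _)
  have hS1 : Integrable (fun W => sqNorm G W + ν * σ ^ 2) prior := hsq.1.add (integrable_const _)
  have hS2 : Integrable (fun W => 5 * (sqNorm G W + ν * σ ^ 2) * (8 * varError hH' γ n)) prior :=
    (hS1.const_mul 5).mul_const _
  have hUi : Integrable (fun W => biasError G R γ n W +
      5 * (sqNorm G W + ν * σ ^ 2) * (8 * varError hH' γ n)) prior := hbias.add hS2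
  have hmeas : AEStronglyMeasurable E prior := by
    have hm : Measurable fun W => ∑ l, hH.1.eigenvalues l *
        eigenMoment hH (fun t => stepSize γ n (t + 1)) W (eigenNoise (P W) hH W) n l := by
      have := fun l => measurable_eigenMoment hH (fun t => stepSize γ n (t + 1))
        (Z := fun W => eigenNoise (P W) hH W) (fun l => measurable_eigenNoise P hH l) n l
      fun_prop
    refine hm.aestronglyMeasurable.congr ?_
    filter_upwards [hall] with W hW using hW.2.1.symm
  -- Integrability follows from the pointwise bounds, both integrable since they are quadratic in
  -- `W`.
  have hEi : Integrable E prior :=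
    integrable_of_le_of_le hmeas (by filter_upwards [hall] with W hW using hW.2.2.1)
      (by filter_upwards [hall] with W hW using hW.2.2.2) hLi hUi
  refine ⟨by filter_upwards [hall] with W hW using hW.1, hEi, ?_, ?_⟩
  · have h1 := integral_mono_ae hLi hEi (by filter_upwards [hall] with W hW using hW.2.2.1)
    rw [integral_add hbias (integrable_const _)] at h1
    simpa using h1
  · have h1 := integral_mono_ae hEi hUi (by filter_upwards [hall] with W hW using hW.2.2.2)
    rw [integral_add hbias hS2, integral_mul_const, integral_const_mul,
      integral_add hsq.1 (integrable_const _), hsq.2] at h1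
    simpa using h1

end Average

end SketchedRegression

/-! ### Assembly and choice of the constants. -/

open SketchedRegression in
theorem mainTheorem2 (a b B : ℝ) (ha : 1 < a) (hb : 0 < b) (hbB : b ≤ B) :
    ∃ c : ℝ, 0 < c ∧ ∀ κ : ℝ, 1 < κ →
    ∃ c₁ c₂ C₂ : ℝ, 0 < c₁ ∧ 0 < c₂ ∧ 0 < C₂ ∧ ∀ s ν : ℝ, 0 < s → 1 ≤ ν →
    ∃ c₃ C₃ : ℝ, 0 < c₃ ∧ 0 < C₃ ∧
    ∀ (m d p n : ℕ), 1 ≤ m → m ≤ d → 2 ≤ n →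
    ∀ (G : Matrix (Fin d) (Fin d) ℝ) (hG : G.IsHermitian), PowerLawSpectrum hG a b B →
    ∀ (prior : Measure (Matrix (Fin d) (Fin p) ℝ)) [IsProbabilityMeasure prior],
      (∀ i j, ∫ W, (W * Wᵀ) i j ∂prior = (1 : Matrix (Fin d) (Fin d) ℝ) i j) →
    ∀ (P : Kernel (Matrix (Fin d) (Fin p) ℝ) (Example d p)) [IsMarkovKernel P] (σ : ℝ),
      (∀ᵐ W ∂prior, GaussianWellSpecified (P W) G W σ) →
    ∀ γ : ℝ, 0 < γ → γ ≤ c →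
    sketchLaw m d {R | ¬ (
      -- Part 1
      (∀ᵐ W ∂prior, irredError (P W) = σ ^ 2) ∧
      -- Part 2
      (κ * m ≤ d →
        Integrable (fun W => approxError (P W) R) prior ∧
        c₂ * (m : ℝ) ^ (1 - a) ≤ ∫ W, approxError (P W) R ∂prior ∧
        ∫ W, approxError (P W) R ∂prior ≤ C₂ * (m : ℝ) ^ (1 - a)) ∧
      -- Part 3
      (s ≤ σ ^ 2 → (∀ᵐ W ∂prior, ComparableNoise (P W) G W σ ν) →
        (∀ᵐ W ∂prior, Integrable (fun D : Fin n → Example d p =>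
          excessError (P W) R (sgdOutput R γ D)) (Measure.pi fun _ => P W)) ∧
        Integrable (fun W => ∫ D : Fin n → Example d p,
          excessError (P W) R (sgdOutput R γ D) ∂(Measure.pi fun _ => P W)) prior ∧
        Integrable (fun W => biasError G R γ n W) prior ∧
        c₃ * ((∫ W, biasError G R γ n W ∂prior) +
            σ ^ 2 * varError (sketchedCov_isHermitian hG R) γ n) ≤
          ∫ W, ∫ D : Fin n → Example d p,
            excessError (P W) R (sgdOutput R γ D) ∂(Measure.pi fun _ => P W) ∂prior ∧
        ∫ W, ∫ D : Fin n → Example d p,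
            excessError (P W) R (sgdOutput R γ D) ∂(Measure.pi fun _ => P W) ∂prior ≤
          C₃ * ((∫ W, biasError G R γ n W ∂prior) +
            σ ^ 2 * varError (sketchedCov_isHermitian hG R) γ n)))}
      ≤ ENNReal.ofReal (Real.exp (-(c₁ * m))) := by
  have hB : 0 < B := hb.trans_le hbB
  have ha1 : 0 < a - 1 := by linarith
  have hT : 0 < 1 + 1 / (a - 1) := by positivity
  have hCG : 0 < B * (1 + 1 / (a - 1)) := mul_pos hB hT
  -- `B (1 + 1/(a-1))` bounds `tr G`, so on the good event `γ tr H ≤ c · 10 tr G ≤ 1/4`.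
  refine ⟨1 / (40 * (B * (1 + 1 / (a - 1)))), by positivity, fun κ hκ => ?_⟩
  have hκ1 : 0 < min (κ - 1) 1 := lt_min (by linarith) one_pos
  -- `2^{-a}` comes from ranks up to `2m`, and `4^{a-1}` from cutting the spectrum at `m/4`.
  refine ⟨1 / 2, b * 2 ^ (-a) * min (κ - 1) 1,
    50 * Real.exp 16 * (B * (1 + 1 / (a - 1)) * 4 ^ (a - 1)), by norm_num, by positivity,
    by positivity, fun s ν hs hν => ?_⟩
  have hν0 : 0 < ν := by linarith
  -- The 1 in the minimum and the maximum serves the bias; the term with `s` absorbs `tr G` into the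
  -- noise through `tr G ≤ (B (1 + 1/(a-1)) / s) σ²`.
  refine ⟨min 1 (ν⁻¹ * (Real.exp (-16) / 16)),
    max 1 (40 * (B * (1 + 1 / (a - 1)) / s + ν)), lt_min one_pos (by positivity),
    lt_max_of_lt_left one_pos, ?_⟩
  intro m d p n hm hmd hn G hG hspec prior _ hprior P _ σ hP γ hγ hγc
  obtain ⟨ρ, hρ⟩ := hspec.exists_equiv
  have hpos : ∀ j, 0 < hG.eigenvalues j := fun j => lt_of_lt_of_le (by positivity) (hρ j).1
  have hGp : G.PosSemidef := hG.posSemidef_iff_eigenvalues_nonneg.2 fun j => (hpos j).le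
  have hsum := sum_le_of_power_law ha hB.le fun j => (hρ j).2
  refine le_trans (measure_mono ?_) (sketch_good_event hm hmd hG hpos
    (Finset.univ.filter fun j => (ρ j : ℕ) < m / 4) (by
      rw [card_filter_equiv_lt ρ (by omega)]; omega))
  intro R hR hgood
  refine hR ?_
  obtain ⟨hH, htr, hres⟩ := hgood
  refine ⟨?_, fun hκd => ?_, fun hsσ hC => ?_⟩
  · filter_upwards [hP] with W hW using hW.irredError_eq hGp
  · obtain ⟨hint, hval⟩ := integral_approxError hprior hP hGp hH
    refine ⟨hint, ?_, ?_⟩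
    · rw [hval]
      refine residual_lower_of_power_law ha hb (fun j => (hρ j).1) hm hκd ?_
      rwa [← sketchedCov_eq_gram hG]
    · rw [hval]
      refine hres.trans ?_
      rw [mul_assoc _ _ ((m : ℝ) ^ (1 - a))]
      exact mul_le_mul_of_nonneg_left
        (tail_sum_le_of_power_law ha hB.le (fun j => (hρ j).2) hm) (by positivity)
  · have hσ : 0 < σ ^ 2 := hs.trans_le hsσ
    have hγtr : γ * (sketchedCov G R).trace ≤ 1 / 4 := by
      have h1 : (sketchedCov G R).trace ≤ 10 * (B * (1 + 1 / (a - 1))) := by linarith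
      calc γ * (sketchedCov G R).trace ≤ γ * (10 * (B * (1 + 1 / (a - 1)))) :=
            mul_le_mul_of_nonneg_left h1 hγ.le
        _ ≤ 1 / (40 * (B * (1 + 1 / (a - 1)))) * (10 * (B * (1 + 1 / (a - 1)))) :=
            mul_le_mul_of_nonneg_right hγc (by positivity)
        _ = 1 / 4 := by field_simp; norm_num
    obtain ⟨h1, h2, h3, h4⟩ := integral_integral_excessError_bounds hprior hP hC hGp hH hσ hν hn hγ
      hγtr (sketchedCov_isHermitian hG R)
    have hbias : 0 ≤ ∫ W, biasError G R γ n W ∂prior :=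
      integral_nonneg fun W => sqNorm_nonneg hH.posSemidef _
    have hvar : 0 ≤ varError (sketchedCov_isHermitian hG R) γ n := by
      rw [varError_eq_sum hH hγ hn]
      have := one_le_effSampleSize hn
      exact Finset.sum_nonneg fun l _ => by positivity
    refine ⟨h1, h2, integrable_biasError hprior γ n, le_trans ?_ h3, h4.trans ?_⟩
    · rw [mul_add]
      refine add_le_add (mul_le_of_le_one_left hbias (min_le_left _ _)) ?_
      calc _ ≤ ν⁻¹ * (Real.exp (-16) / 16) *
            (σ ^ 2 * varError (sketchedCov_isHermitian hG R) γ n) :=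
            mul_le_mul_of_nonneg_right (min_le_right _ _) (by positivity)
        _ = _ := by ring
    · rw [mul_add (max 1 _)]
      refine add_le_add (le_mul_of_one_le_left hbias (le_max_left _ _)) ?_
      have h5 : G.trace ≤ B * (1 + 1 / (a - 1)) / s * σ ^ 2 := by
        rw [trace_eq_sum_of_isHermitian hG, div_mul_eq_mul_div, le_div_iff₀ hs]
        exact mul_le_mul hsum hsσ hs.le hCG.le
      calc 5 * (G.trace + ν * σ ^ 2) * (8 * varError (sketchedCov_isHermitian hG R) γ n)
          ≤ 5 * (B * (1 + 1 / (a - 1)) / s * σ ^ 2 + ν * σ ^ 2) *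
              (8 * varError (sketchedCov_isHermitian hG R) γ n) := by gcongr
        _ = 40 * (B * (1 + 1 / (a - 1)) / s + ν) *
              (σ ^ 2 * varError (sketchedCov_isHermitian hG R) γ n) := by ring
        _ ≤ _ := mul_le_mul_of_nonneg_right (le_max_right _ _) (by positivity)
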